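/- Let $M$ be a compact smooth manifold with smooth boundary $\partial M$, of dimension $n\ge 2$, every connected component of which meets $\partial M$ (for instance, $M$ connected with $\partial M\neq\emptyset$), and let $g_0$ be a smooth Riemannian metric on $M$. For a smooth metric $g$ on $M$ let $R_g$ be its scalar curvature, $\Delta_g$ its Laplace–Beltrami operator ($\Delta_g=\mathrm{div}_g\nabla_g$), and $H_g=\mathrm{div}_g\,\eta_g$ the mean curvature of $\partial M$ with respect to the exterior unit normal $\eta_g$. Set $$\mathcal L_{g_0}f=\Delta_{g_0}f+\frac{1}{n-1}R_{g_0}f .$$ Let $g=\mu^2g_0$, where $\mu$ is a positive smooth function on $M$, and suppose that $g=g_0$ on $\partial M$. Let $f\in C^1(M)\cap C^2(M\setminus\partial M)$ be positive almost everywhere on $M$ and such that $$\int_M f\,(R_g-R_{g_0})\,d\mathrm{vol}_{g_0}+2\int_{\partial M}f\,(H_g-H_{g_0})\,d\mathcal H^{n-1}_{g_0}\ \ge\ 0,$$ where $d\mathcal H^{n-1}_{g_0}$ is the $(n-1)$-dimensional Riemannian measure of $\partial M$ induced by $g_0$. If the function $\mathcal L_{g_0}f\,(1-\mu^{-2})$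 is integrable on $M$ with respect to $d\mathrm{vol}_{g_0}$ and $$\int_M \mathcal L_{g_0}f\,(1-\mu^{-2})\,d\mathrm{vol}_{g_0}\ \ge\ 0,$$ then $g=g_0$ on $M$. -/

import Mathlib

open MeasureTheory Set
open scoped Manifold ContDiff

noncomputable section

namespace ConformalRigidity

/-! ### Coordinate formulas on the closed half space

Coordinates are `y = (y₀, …, yₘ)` in the closed half space `{y₀ ≥ 0}` of `ℝ^(m+1)`, the dimension is
`n = m + 1`, and `G` is the matrix `(g_ij)` of a Riemannian metric in these coordinates. -/

/-- The model vector space `ℝ^(m+1)`. -/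
abbrev Coord (m : ℕ) : Type := EuclideanSpace ℝ (Fin (m + 1))

/-- The partial derivative `∂_i h` at `y` of a function `h` on the closed half space `{y₀ ≥ 0}`
(one-sided at points of `{y₀ = 0}`). -/
def pd {m : ℕ} (i : Fin (m + 1)) (h : Coord m → ℝ) (y : Coord m) : ℝ :=
  fderivWithin ℝ h (range (𝓡∂ (m + 1))) y (EuclideanSpace.single i 1)

/-- The Christoffel symbol
`Γ^k_ij = (1/2) ∑_l g^kl (∂_i g_jl + ∂_j g_il - ∂_l g_ij)`. -/
def christoffel {m : ℕ} (G : Coord m → Matrix (Fin (m + 1)) (Fin (m + 1)) ℝ)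
    (k i j : Fin (m + 1)) (y : Coord m) : ℝ :=
  (1 / 2 : ℝ) * ∑ l, (G y)⁻¹ k l *
    (pd i (fun z => G z j l) y + pd j (fun z => G z i l) y - pd l (fun z => G z i j) y)

/-- The Ricci tensor `Ric_jk =
∑_i (∂_i Γ^i_jk - ∂_j Γ^i_ik) + ∑_{i,l} (Γ^i_il Γ^l_jk - Γ^i_jl Γ^l_ik)`. -/
def ricciCoord {m : ℕ} (G : Coord m → Matrix (Fin (m + 1)) (Fin (m + 1)) ℝ)
    (j k : Fin (m + 1)) (y : Coord m) : ℝ :=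
  ∑ i, (pd i (christoffel G i j k) y - pd j (christoffel G i i k) y) +
    ∑ i, ∑ l, (christoffel G i i l y * christoffel G l j k y -
      christoffel G i j l y * christoffel G l i k y)

/-- The scalar curvature `R = ∑_{j,k} g^jk Ric_jk`. -/
def scalarCoord {m : ℕ} (G : Coord m → Matrix (Fin (m + 1)) (Fin (m + 1)) ℝ)
    (y : Coord m) : ℝ :=
  ∑ j, ∑ k, (G y)⁻¹ j k * ricciCoord G j k y

/-- The divergence `div X = (det G)^(-1/2) ∑_i ∂_i ((det G)^(1/2) X^i)` of a vector field `X`. -/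
def divCoord {m : ℕ} (G : Coord m → Matrix (Fin (m + 1)) (Fin (m + 1)) ℝ)
    (X : Fin (m + 1) → Coord m → ℝ) (y : Coord m) : ℝ :=
  (√(G y).det)⁻¹ * ∑ i, pd i (fun z => √(G z).det * X i z) y

/-- The gradient `(∇h)^i = ∑_j g^ij ∂_j h`. -/
def gradCoord {m : ℕ} (G : Coord m → Matrix (Fin (m + 1)) (Fin (m + 1)) ℝ)
    (h : Coord m → ℝ) (i : Fin (m + 1)) (y : Coord m) : ℝ :=
  ∑ j, (G y)⁻¹ i j * pd j h y

/-- The Laplace-Beltrami operator `Δh = div ∇h`. -/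
def laplaceCoord {m : ℕ} (G : Coord m → Matrix (Fin (m + 1)) (Fin (m + 1)) ℝ)
    (h : Coord m → ℝ) (y : Coord m) : ℝ :=
  divCoord G (gradCoord G h) y

/-- The unit vector field `η = -∇y₀ / |∇y₀|`, with components `η^i = -g^i0 / (g^00)^(1/2)`. It is the
exterior unit normal of the boundary along `{y₀ = 0}`. -/
def normalCoord {m : ℕ} (G : Coord m → Matrix (Fin (m + 1)) (Fin (m + 1)) ℝ)
    (i : Fin (m + 1)) (y : Coord m) : ℝ :=
  -(G y)⁻¹ i 0 / √((G y)⁻¹ 0 0)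

/-- The mean curvature `H = div η` of the boundary. As `|η| = 1` also off the boundary,
`⟨∇_η η, η⟩ = 0`, so this is the trace of `v ↦ ∇_v η` over vectors tangent to the boundary: it
depends on `η` along the boundary only. -/
def meanCoord {m : ℕ} (G : Coord m → Matrix (Fin (m + 1)) (Fin (m + 1)) ℝ)
    (y : Coord m) : ℝ :=
  divCoord G (normalCoord G) y

/-- The inclusion `z ↦ (0, z)` of `ℝ^m` as the boundary of the half space. -/
def bdryIncl {m : ℕ} (z : Fin m → ℝ) : Coord m :=
  WithLp.toLp 2 (Fin.cons 0 z)

/-! ### Riemannian manifolds with boundary -/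

section Manifold

variable {m : ℕ} {M : Type*} [TopologicalSpace M] [ChartedSpace (EuclideanHalfSpace (m + 1)) M]
  [IsManifold (𝓡∂ (m + 1)) ∞ M]

variable (m M) in
/-- Smooth Riemannian metrics on the `(m+1)`-dimensional smooth manifold with boundary `M`. -/
abbrev Metric : Type _ :=
  Bundle.ContMDiffRiemannianMetric (𝓡∂ (m + 1)) ∞ (Coord m)
    (fun x : M => TangentSpace (𝓡∂ (m + 1)) x)

variable (m) in
/-- The coordinate vector field `∂/∂y_i` of the chart around `a`, at the point with coordinates
`y`. -/
def coordVec (a : M) (y : Coord m) (i : Fin (m + 1)) :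
    TangentSpace (𝓡∂ (m + 1)) ((extChartAt (𝓡∂ (m + 1)) a).symm y) :=
  mfderivWithin 𝓘(ℝ, Coord m) (𝓡∂ (m + 1)) (extChartAt (𝓡∂ (m + 1)) a).symm
    (range (𝓡∂ (m + 1))) y (EuclideanSpace.single i (1 : ℝ) : Coord m)

/-- The matrix `g_ij = g(∂/∂y_i, ∂/∂y_j)` of the metric in the chart around `a`. -/
def gram (g : Metric m M) (a : M) (y : Coord m) : Matrix (Fin (m + 1)) (Fin (m + 1)) ℝ :=
  Matrix.of fun i j => g.inner _ (coordVec m a y i) (coordVec m a y j)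

/-- The scalar curvature `R_g`, computed at `x` in the chart around `x`. -/
def scalarCurvature (g : Metric m M) (x : M) : ℝ :=
  scalarCoord (gram g x) (extChartAt (𝓡∂ (m + 1)) x x)

/-- The Laplace-Beltrami operator `Δ_g`, computed at `x` in the chart around `x`. -/
def laplacian (g : Metric m M) (f : M → ℝ) (x : M) : ℝ :=
  laplaceCoord (gram g x) (f ∘ (extChartAt (𝓡∂ (m + 1)) x).symm) (extChartAt (𝓡∂ (m + 1)) x x)

/-- The mean curvature `H_g = div_g η_g` of the boundary with respect to the exterior unit normal
`η_g`, computed at `x` in the chart around `x`. Only its values at boundary points matter. -/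
def meanCurvature (g : Metric m M) (x : M) : ℝ :=
  meanCoord (gram g x) (extChartAt (𝓡∂ (m + 1)) x x)

/-- The operator `𝓛_g f = Δ_g f + R_g f / (n - 1)`, where `n = m + 1`. -/
def linOp (g : Metric m M) (f : M → ℝ) (x : M) : ℝ :=
  laplacian g f x + scalarCurvature g x / m * f x

variable [MeasurableSpace M]

/-- The measure `(det g_ij)^(1/2) dy₀ ⋯ dyₘ` on the domain of the chart around `a`. -/
def chartVolume (g : Metric m M) (a : M) : Measure M :=
  (((volume : Measure (Coord m)).restrict (extChartAt (𝓡∂ (m + 1)) a).target).withDensity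
    fun y => ENNReal.ofReal √(gram g a y).det).map (extChartAt (𝓡∂ (m + 1)) a).symm

/-- The Riemannian volume measure of `(M, g)`. The measures `chartVolume g a` agree on the
overlaps of the charts, so their supremum is the measure that restricts to each of them. -/
def vol (g : Metric m M) : Measure M :=
  ⨆ a : M, chartVolume g a

/-- The measure `(det (g_ij)_{i,j ≥ 1})^(1/2) dy₁ ⋯ dyₘ` on the part of the boundary in the domain
of the chart around `a`. -/
def chartArea (g : Metric m M) (a : M) : Measure M :=
  (((volume : Measure (Fin m → ℝ)).restrict
      {z | bdryIncl z ∈ (extChartAt (𝓡∂ (m + 1)) a).target}).withDensity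
    fun z => ENNReal.ofReal √((gram g a (bdryIncl z)).submatrix Fin.succ Fin.succ).det).map
      fun z => (extChartAt (𝓡∂ (m + 1)) a).symm (bdryIncl z)

/-- The `(n-1)`-dimensional Riemannian measure of the boundary of `(M, g)`, as a measure on `M`
concentrated on the boundary. The measures `chartArea g a` agree on the overlaps of the charts, so
their supremum is the measure that restricts to each of them. -/
def area (g : Metric m M) : Measure M :=
  ⨆ a : M, chartArea g a

end Manifold

end ConformalRigidity

end

/-! Write `n = m + 1`, `w = log μ`, so that `g = exp (2 w) g₀`, and put `u = 1 - exp (-2 w) = 1 -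
μ⁻²`. In terms of `u` the conformal change of both curvatures becomes linear, up to one term of
definite sign: `R_g - R_{g₀} = -u R_{g₀} - m Δu - m (m + 3) exp (-2 w) |∇w|²` on `M`, and `2 (H_g -
H_{g₀}) = m ∂u/∂η` on the boundary, where `w = 0`. Multiply by `f` and integrate. Since `u` vanishes
on the boundary, Green's formula gives `∫ (f Δu - u Δf) = ∫_∂M f ∂u/∂η`, and the boundary terms
cancel: the curvature expression of the hypothesis equals `-m ∫ u 𝓛f - m (m + 3) ∫ f exp (-2 w)
|∇w|²`. It is nonnegative, `∫ u 𝓛f` is nonnegative and `f > 0` almost everywhere, so the last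
integral is zero. Hence `∇w = 0` almost everywhere, then everywhere by continuity. So `w` is
constant on connected components, each of which meets the boundary, where `w = 0`.

The lemmas that carry this are `scalarCurvature_conformal`, `two_mul_meanCurvature_conformal`,
`integral_green`, `gradDot_eq_zero_of_conformal` and `eq_of_gradDot_eq_zero`.

Two points cost most of the work. Curvature and Laplacian are defined at each point in the chart
around that point, and the measures are suprema over charts. Both must therefore be shown
independent of the chart: the former by the transformation laws of connections, ending in
`IsPullbackAt.scalarCoord_eq` and `IsPullbackAt.laplaceCoord_eq`, the latter by the change of
variables formula, ending in `ParamFamily.total_restrict`. For the mean curvature, the difference at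
a point is computed in the chart around that point, and it suffices that the normal derivative of
`u` is independent of the chart. Secondly, `f` is `C²` only in the interior and `Δf` need not be
integrable, so Green's formula is proved assuming only that the combination `f Δu - u Δf` is
integrable. The divergence theorem behind it needs continuity up to the boundary and
differentiability inside. -/

noncomputable section

namespace ConformalRigidity

open Filter Topology

/-! ### Connections in coordinates -/

section Abstract

variable {E : Type*} [NormedAddCommGroup E] [NormedSpace ℝ E]

/-- The curvature endomorphism `u ↦ R(u, v) w` of a connection with Christoffel symbols `Γ` whose
derivative is `dΓ`. -/
def curv (Γ : E →L[ℝ] E →L[ℝ] E) (dΓ : E →L[ℝ] E →L[ℝ] E →L[ℝ] E) (v w : E) : E →ₗ[ℝ] E where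
  toFun u := dΓ u v w - dΓ v u w + Γ u (Γ v w) - Γ v (Γ u w)
  map_add' := by intro a b; simp; abel
  map_smul' := by intro c a; simp [smul_add, smul_sub]

lemma curv_apply (Γ : E →L[ℝ] E →L[ℝ] E) (dΓ : E →L[ℝ] E →L[ℝ] E →L[ℝ] E) (v w u : E) :
    curv Γ dΓ v w u = dΓ u v w - dΓ v u w + Γ u (Γ v w) - Γ v (Γ u w) := rfl

/-- The Ricci tensor of a connection. -/
def ric (Γ : E →L[ℝ] E →L[ℝ] E) (dΓ : E →L[ℝ] E →L[ℝ] E →L[ℝ] E) (v w : E) : ℝ :=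
  LinearMap.trace ℝ E (curv Γ dΓ v w)

variable {s t : Set E} {y : E} {φ : E → E} {φ' : E → E →L[ℝ] E} {φ'' : E → E →L[ℝ] E →L[ℝ] E}

/-- Product rule for `B' = φ^* B`. All derivatives are taken within a set, so `UniqueDiffWithinAt`
is what allows two of them to be compared. -/
lemma pullback_fderiv {B B' : E → E →L[ℝ] E →L[ℝ] ℝ} {dB dB' : E →L[ℝ] E →L[ℝ] E →L[ℝ] ℝ}
    (hs : UniqueDiffWithinAt ℝ s y)
    (hφ : HasFDerivWithinAt φ (φ' y) s y) (hφ' : HasFDerivWithinAt φ' (φ'' y) s y)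
    (hmaps : Tendsto φ (𝓝[s] y) (𝓝[t] (φ y)))
    (hB : HasFDerivWithinAt B dB t (φ y)) (hB' : HasFDerivWithinAt B' dB' s y)
    (h : ∀ᶠ z in 𝓝[s] y, ∀ v w, B' z v w = B (φ z) (φ' z v) (φ' z w)) (hy : y ∈ s)
    (u v w : E) :
    dB' u v w = dB (φ' y u) (φ' y v) (φ' y w) + B (φ y) (φ'' y u v) (φ' y w) +
      B (φ y) (φ' y v) (φ'' y u w) := by
  have h1 : HasFDerivWithinAt (fun z => B (φ z)) (dB.comp (φ' y)) s y :=
    HasFDerivWithinAt.comp_of_tendsto (G := E →L[ℝ] E →L[ℝ] ℝ) y hB hφ hmaps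
  have hv (v : E) : HasFDerivWithinAt (fun z => φ' z v) ((φ'' y).flip v) s y := by
    simpa using hφ'.clm_apply (hasFDerivWithinAt_const v y s)
  have h2 := (h1.clm_apply (hv v)).clm_apply (hv w)
  have h3 := (hB'.clm_apply (hasFDerivWithinAt_const v y s)).clm_apply
    (hasFDerivWithinAt_const w y s)
  have h4 := h2.congr_of_eventuallyEq (h.mono fun z hz => hz v w) (h.self_of_nhdsWithin hy v w)
  have h5 := congrArg (fun L : E →L[ℝ] ℝ => L u) (hs.eq h3 h4)
  simp at h5
  rw [h5]; ring

/-- Both connections are determined by the Koszul formula. In the combination of the three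
derivatives of `B'`, the terms with the second derivative `S` cancel except for `2 B (S v w) (A z)`;
nondegeneracy of `B` then removes `z`. -/
lemma christoffel_change {B B' : E →L[ℝ] E →L[ℝ] ℝ} {dB dB' : E →L[ℝ] E →L[ℝ] E →L[ℝ] ℝ}
    {Γ Γ' : E →L[ℝ] E →L[ℝ] E} {A : E →L[ℝ] E} {S : E →L[ℝ] E →L[ℝ] E}
    (hA : Function.Surjective A) (hS : ∀ u v, S u v = S v u)
    (hsymm : ∀ v w, B v w = B w v)
    (hnd : ∀ x, (∀ z, B x z = 0) → x = 0)
    (hBB' : ∀ v w, B' v w = B (A v) (A w))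
    (hΓ : ∀ v w z, 2 * B (Γ v w) z = dB v w z + dB w v z - dB z v w)
    (hΓ' : ∀ v w z, 2 * B' (Γ' v w) z = dB' v w z + dB' w v z - dB' z v w)
    (hd : ∀ u v w, dB' u v w = dB (A u) (A v) (A w) + B (S u v) (A w) + B (A v) (S u w))
    (v w : E) : A (Γ' v w) = Γ (A v) (A w) + S v w := by
  rw [← sub_eq_zero]
  refine hnd _ fun z => ?_
  obtain ⟨z, rfl⟩ := hA z
  have h1 := hΓ (A v) (A w) (A z)
  have h2 := hΓ' v w z
  rw [hBB', hd, hd, hd] at h2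
  simp only [map_sub, map_add, sub_apply, add_apply]
  rw [hS w v, hS z v, hS z w, hsymm (A w) (S v z), hsymm (A v) (S w z)] at h2
  linarith

/-- The curvature is a tensor: after differentiating the inhomogeneous transformation law of `Γ`,
the third derivative of `φ` and the terms in `φ''` cancel on antisymmetrizing in `u` and `v`. -/
lemma curv_change {Γ Γ' : E → E →L[ℝ] E →L[ℝ] E} {dΓ dΓ' : E →L[ℝ] E →L[ℝ] E →L[ℝ] E}
    {φ''' : E →L[ℝ] E →L[ℝ] E →L[ℝ] E}
    (hs : UniqueDiffWithinAt ℝ s y) (hy : y ∈ s)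
    (hφ : HasFDerivWithinAt φ (φ' y) s y) (hφ' : HasFDerivWithinAt φ' (φ'' y) s y)
    (hφ'' : HasFDerivWithinAt φ'' φ''' s y)
    (hsymm : ∀ u v, φ'' y u v = φ'' y v u) (hsymm' : ∀ u v w, φ''' u v w = φ''' v u w)
    (hmaps : Tendsto φ (𝓝[s] y) (𝓝[t] (φ y)))
    (hΓ : HasFDerivWithinAt Γ dΓ t (φ y)) (hΓ' : HasFDerivWithinAt Γ' dΓ' s y)
    (h : ∀ᶠ z in 𝓝[s] y, ∀ v w, φ' z (Γ' z v w) = Γ (φ z) (φ' z v) (φ' z w) + φ'' z v w)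
    (u v w : E) :
    φ' y (curv (Γ' y) dΓ' v w u) = curv (Γ (φ y)) dΓ (φ' y v) (φ' y w) (φ' y u) := by
  have h1 : HasFDerivWithinAt (fun z => Γ (φ z)) (dΓ.comp (φ' y)) s y :=
    HasFDerivWithinAt.comp_of_tendsto (G := E →L[ℝ] E →L[ℝ] E) y hΓ hφ hmaps
  have hv (v : E) : HasFDerivWithinAt (fun z => φ' z v) ((φ'' y).flip v) s y := by
    simpa using hφ'.clm_apply (hasFDerivWithinAt_const v y s)
  have key (u v w : E) : φ'' y u (Γ' y v w) + φ' y (dΓ' u v w) =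
      dΓ (φ' y u) (φ' y v) (φ' y w) + Γ (φ y) (φ'' y u v) (φ' y w) +
        Γ (φ y) (φ' y v) (φ'' y u w) + φ''' u v w := by
    have h2 := ((h1.clm_apply (hv v)).clm_apply (hv w)).add
      ((hφ''.clm_apply (hasFDerivWithinAt_const v y s)).clm_apply (hasFDerivWithinAt_const w y s))
    have h3 := hφ'.clm_apply ((hΓ'.clm_apply (hasFDerivWithinAt_const v y s)).clm_apply
      (hasFDerivWithinAt_const w y s))
    have h4 := h2.congr_of_eventuallyEq (h.mono fun z hz => hz v w) (h.self_of_nhdsWithin hy v w)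
    have h5 := congrArg (fun L : E →L[ℝ] E => L u) (hs.eq h3 h4)
    simp at h5
    rw [add_comm, h5]; abel
  have h0 := h.self_of_nhdsWithin hy
  have e1 := h0 u (Γ' y v w)
  have e2 := h0 v (Γ' y u w)
  rw [h0 v w] at e1
  rw [h0 u w] at e2
  simp only [curv_apply, map_add, map_sub, e1, e2]
  rw [eq_sub_iff_add_eq.mpr (add_comm _ _ |>.trans (key u v w)), eq_sub_iff_add_eq.mpr
    (add_comm _ _ |>.trans (key v u w)), ← hsymm u v, ← hsymm' u v]
  abel

lemma trace_eq_of_conj [FiniteDimensional ℝ E] {A : E →L[ℝ] E} (hA : Function.Bijective A)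
    {L L' : E →ₗ[ℝ] E} (h : ∀ u, A (L' u) = L (A u)) :
    LinearMap.trace ℝ E L' = LinearMap.trace ℝ E L := by
  let e : E ≃ₗ[ℝ] E := LinearEquiv.ofBijective A.toLinearMap hA
  rw [← LinearMap.trace_conj' L' e]
  congr 1
  ext x
  obtain ⟨x, rfl⟩ := hA.2 x
  have : e.symm (A x) = x := e.symm_apply_apply x
  rw [LinearEquiv.conj_apply_apply, this]
  exact h x

/-- The covariant derivative `u ↦ ∇_u X`. -/
def cov (Γ : E →L[ℝ] E →L[ℝ] E) (X : E) (dX : E →L[ℝ] E) : E →ₗ[ℝ] E :=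
  dX.toLinearMap + (Γ.flip X).toLinearMap

lemma cov_apply (Γ : E →L[ℝ] E →L[ℝ] E) (X : E) (dX : E →L[ℝ] E) (u : E) :
    cov Γ X dX u = dX u + Γ u X := rfl

/-- The term `φ'' u X'` from the product rule cancels the inhomogeneous term in the transformation
law of `Γ`. -/
lemma cov_change {Γ Γ' : E →L[ℝ] E →L[ℝ] E} {X X' : E → E} {dX dX' : E →L[ℝ] E}
    (hs : UniqueDiffWithinAt ℝ s y) (hy : y ∈ s)
    (hφ : HasFDerivWithinAt φ (φ' y) s y) (hφ' : HasFDerivWithinAt φ' (φ'' y) s y)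
    (hmaps : Tendsto φ (𝓝[s] y) (𝓝[t] (φ y)))
    (hX : HasFDerivWithinAt X dX t (φ y)) (hX' : HasFDerivWithinAt X' dX' s y)
    (hΓ : ∀ v w, φ' y (Γ' v w) = Γ (φ' y v) (φ' y w) + φ'' y v w)
    (h : ∀ᶠ z in 𝓝[s] y, φ' z (X' z) = X (φ z)) (u : E) :
    φ' y (cov Γ' (X' y) dX' u) = cov Γ (X (φ y)) dX (φ' y u) := by
  have h1 : HasFDerivWithinAt (fun z => X (φ z)) (dX.comp (φ' y)) s y :=
    HasFDerivWithinAt.comp_of_tendsto y hX hφ hmaps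
  have h2 := (hφ'.clm_apply hX').congr_of_eventuallyEq (h.mono fun z hz => hz.symm)
    (h.self_of_nhdsWithin hy).symm
  have h5 := congrArg (fun L : E →L[ℝ] E => L u) (hs.eq h1 h2)
  simp at h5
  rw [cov_apply, cov_apply, map_add, hΓ, h.self_of_nhdsWithin hy, h5]
  abel

end Abstract

/-! ### Smoothness of determinants and inverses -/

section Det

variable {E ι : Type*} [NormedAddCommGroup E] [NormedSpace ℝ E] [Fintype ι] [DecidableEq ι]
  {s : Set E} {y : E} {k : WithTop ℕ∞} {A : E → Matrix ι ι ℝ}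

lemma contDiffWithinAt_det (h : ∀ i j, ContDiffWithinAt ℝ k (fun z => A z i j) s y) :
    ContDiffWithinAt ℝ k (fun z => (A z).det) s y := by
  simp only [Matrix.det_apply']
  exact ContDiffWithinAt.sum fun σ _ =>
    contDiffWithinAt_const.mul (contDiffWithinAt_prod fun i _ => h _ _)

lemma contDiffWithinAt_inv (h : ∀ i j, ContDiffWithinAt ℝ k (fun z => A z i j) s y)
    (hdet : (A y).det ≠ 0) (i j : ι) :
    ContDiffWithinAt ℝ k (fun z => (A z)⁻¹ i j) s y := by
  simp only [Matrix.inv_def, Ring.inverse_eq_inv', Matrix.smul_apply, smul_eq_mul,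
    Matrix.adjugate_apply]
  refine ((contDiffWithinAt_det h).inv hdet).mul (contDiffWithinAt_det fun a b => ?_)
  simp only [Matrix.updateRow_apply]
  split_ifs
  · exact contDiffWithinAt_const
  · exact h a b

/-- Jacobi's formula. Differentiating the Leibniz expansion replaces one column at a time, and
Cramer's rule expresses those determinants by the adjugate. -/
lemma hasFDerivWithinAt_det {A' : ι → ι → E →L[ℝ] ℝ}
    (h : ∀ i j, HasFDerivWithinAt (fun z => A z i j) (A' i j) s y) :
    HasFDerivWithinAt (fun z => (A z).det)
      (∑ i, ∑ j, (A y).adjugate i j • A' j i) s y := by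
  simp only [Matrix.det_apply']
  have h1 := HasFDerivWithinAt.fun_sum (u := (Finset.univ : Finset (Equiv.Perm ι))) fun σ _ =>
    (HasFDerivWithinAt.finsetProd (u := (Finset.univ : Finset ι))
      (fun i _ => h (σ i) i)).const_mul ((Equiv.Perm.sign σ : ℤ) : ℝ)
  refine h1.congr_fderiv ?_
  ext u
  have h2 (i : ι) : ∑ j, (A y).adjugate i j * A' j i u =
      ((A y).updateCol i fun j => A' j i u).det := by
    rw [← Matrix.cramer_apply, Matrix.cramer_eq_adjugate_mulVec]; rfl
  simp only [sum_apply, smul_apply, smul_eq_mul, h2, Matrix.det_apply', Finset.smul_sum]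
  rw [Finset.sum_comm]
  refine Finset.sum_congr rfl fun i _ => Finset.sum_congr rfl fun σ _ => ?_
  rw [← Finset.mul_prod_erase _ _ (Finset.mem_univ i)]
  simp only [Matrix.updateCol_self]
  rw [Finset.prod_congr rfl fun j hj => Matrix.updateCol_ne (Finset.ne_of_mem_erase hj)]
  ring

end Det

lemma contDiffWithinAt_smul_const {E F : Type*} [NormedAddCommGroup E] [NormedSpace ℝ E]
    [NormedAddCommGroup F] [NormedSpace ℝ F] {s : Set E} {y : E} {k : WithTop ℕ∞} {c : E → ℝ}
    (h : ContDiffWithinAt ℝ k c s y) (T : F) : ContDiffWithinAt ℝ k (fun z => c z • T) s y :=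
  h.smul contDiffWithinAt_const

/-! ### Metrics in half space coordinates -/

variable {m : ℕ}

/-- The closed half space `{y₀ ≥ 0}`. -/
abbrev halfSpace (m : ℕ) : Set (Coord m) := range (𝓡∂ (m + 1))

/-- The standard basis. -/
abbrev bvec (i : Fin (m + 1)) : Coord m := EuclideanSpace.single i 1

lemma uniqueDiffOn_halfSpace : UniqueDiffOn ℝ (halfSpace m) := (𝓡∂ (m + 1)).uniqueDiffOn

lemma sum_bvec (u : Coord m) : ∑ k, u k • bvec k = u := by
  ext i; simp [Finset.sum_apply, Pi.single_apply]

lemma fderivWithin_eq_sum_pd (h : Coord m → ℝ) (y u : Coord m) :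
    fderivWithin ℝ h (halfSpace m) y u = ∑ k, u k * pd k h y := by
  conv_lhs => rw [← sum_bvec u]
  rw [map_sum]
  exact Finset.sum_congr rfl fun k _ => by rw [map_smul]; rfl

/-- `G` is the matrix of a Riemannian metric of class `C^2` near the point `y` of the half space. -/
structure IsMetricAt (G : Coord m → Matrix (Fin (m + 1)) (Fin (m + 1)) ℝ) (y : Coord m) :
    Prop where
  mem : y ∈ halfSpace m
  contDiff : ∀ i j, ContDiffWithinAt ℝ 2 (fun z => G z i j) (halfSpace m) y
  posDef : ∀ᶠ z in 𝓝[halfSpace m] y, (G z).PosDef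

/-- The bilinear form with matrix `G`. -/
def bil (G : Coord m → Matrix (Fin (m + 1)) (Fin (m + 1)) ℝ) (y : Coord m) :
    Coord m →L[ℝ] Coord m →L[ℝ] ℝ :=
  ∑ i, ∑ j, G y i j • (EuclideanSpace.proj i : Coord m →L[ℝ] ℝ).smulRight
    (EuclideanSpace.proj j : Coord m →L[ℝ] ℝ)

/-- The Christoffel symbols as a bilinear map. -/
def gam (G : Coord m → Matrix (Fin (m + 1)) (Fin (m + 1)) ℝ) (y : Coord m) :
    Coord m →L[ℝ] Coord m →L[ℝ] Coord m :=
  ∑ k, ∑ i, ∑ j, christoffel G k i j y • (EuclideanSpace.proj i : Coord m →L[ℝ] ℝ).smulRight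
    ((EuclideanSpace.proj j : Coord m →L[ℝ] ℝ).smulRight (bvec k))

variable {G : Coord m → Matrix (Fin (m + 1)) (Fin (m + 1)) ℝ} {y : Coord m}

lemma bil_apply (v w : Coord m) : bil G y v w = ∑ i, ∑ j, G y i j * (v i * w j) := by
  simp [bil, sum_apply]

lemma bil_bvec (i j : Fin (m + 1)) : bil G y (bvec i) (bvec j) = G y i j := by
  simp [bil_apply]

lemma gam_apply (v w : Coord m) (k : Fin (m + 1)) :
    gam G y v w k = ∑ i, ∑ j, christoffel G k i j y * (v i * w j) := by
  simp [gam, sum_apply, Finset.sum_apply, Pi.single_apply]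

lemma gam_bvec (i j k : Fin (m + 1)) : gam G y (bvec i) (bvec j) k = christoffel G k i j y := by
  simp [gam_apply]

namespace IsMetricAt

lemma posDef_self (h : IsMetricAt G y) : (G y).PosDef := h.posDef.self_of_nhdsWithin h.mem

lemma det_pos (h : IsMetricAt G y) : 0 < (G y).det := h.posDef_self.det_pos

lemma symm_apply (h : IsMetricAt G y) (i j : Fin (m + 1)) : G y i j = G y j i := by
  simpa using h.posDef_self.isHermitian.apply j i

lemma inv_symm_apply (h : IsMetricAt G y) (i j : Fin (m + 1)) : (G y)⁻¹ i j = (G y)⁻¹ j i := by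
  simpa using h.posDef_self.inv.isHermitian.apply j i

/-- Pointwise identities for metrics thereby hold near `y`, so they can be differentiated at `y`. -/
lemma eventually (h : IsMetricAt G y) : ∀ᶠ z in 𝓝[halfSpace m] y, IsMetricAt G z := by
  have h1 : ∀ᶠ z in 𝓝[halfSpace m] y, ∀ i j,
      ContDiffWithinAt ℝ 2 (fun z => G z i j) (halfSpace m) z := by
    simp only [eventually_all]
    intro i j
    have := (h.contDiff i j).eventually (by simp)
    rwa [insert_eq_of_mem h.mem] at this
  filter_upwards [h1, eventually_eventually_nhdsWithin.2 h.posDef, self_mem_nhdsWithin]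
    with z hz1 hz2 hz3 using ⟨hz3, hz1, hz2⟩

lemma mul_inv (h : IsMetricAt G y) : G y * (G y)⁻¹ = 1 :=
  Matrix.mul_nonsing_inv _ h.det_pos.ne'.isUnit

lemma inv_mul (h : IsMetricAt G y) : (G y)⁻¹ * G y = 1 :=
  Matrix.nonsing_inv_mul _ h.det_pos.ne'.isUnit

lemma contDiff_inv (h : IsMetricAt G y) (i j : Fin (m + 1)) :
    ContDiffWithinAt ℝ 2 (fun z => (G z)⁻¹ i j) (halfSpace m) y :=
  contDiffWithinAt_inv h.contDiff h.det_pos.ne' i j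

lemma contDiff_pd {h : Coord m → ℝ} {k l : WithTop ℕ∞}
    (hh : ContDiffWithinAt ℝ k h (halfSpace m) y) (hkl : l + 1 ≤ k) (hy : y ∈ halfSpace m)
    (i : Fin (m + 1)) : ContDiffWithinAt ℝ l (pd i h) (halfSpace m) y :=
  (hh.fderivWithin_right uniqueDiffOn_halfSpace hkl hy).clm_apply contDiffWithinAt_const

lemma contDiff_christoffel (h : IsMetricAt G y) (k i j : Fin (m + 1)) :
    ContDiffWithinAt ℝ 1 (christoffel G k i j) (halfSpace m) y := by
  have hp (a b c) : ContDiffWithinAt ℝ 1 (pd a (fun z => G z b c)) (halfSpace m) y :=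
    contDiff_pd (h.contDiff b c) (by norm_num) h.mem a
  refine contDiffWithinAt_const.mul (ContDiffWithinAt.sum fun l _ => ?_)
  exact ((h.contDiff_inv k l).of_le (by norm_num)).mul (((hp _ _ _).add (hp _ _ _)).sub (hp _ _ _))

lemma contDiff_bil (h : IsMetricAt G y) : ContDiffWithinAt ℝ 2 (bil G) (halfSpace m) y :=
  ContDiffWithinAt.sum fun i _ => ContDiffWithinAt.sum fun j _ =>
    contDiffWithinAt_smul_const (F := Coord m →L[ℝ] Coord m →L[ℝ] ℝ) (h.contDiff i j) _

lemma contDiff_gam (h : IsMetricAt G y) : ContDiffWithinAt ℝ 1 (gam G) (halfSpace m) y :=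
  ContDiffWithinAt.sum fun k _ => ContDiffWithinAt.sum fun i _ => ContDiffWithinAt.sum fun j _ =>
    contDiffWithinAt_smul_const (F := Coord m →L[ℝ] Coord m →L[ℝ] Coord m)
      (h.contDiff_christoffel k i j) _

lemma hasFDerivWithinAt_bil (h : IsMetricAt G y) :
    HasFDerivWithinAt (bil G) (fderivWithin ℝ (bil G) (halfSpace m) y) (halfSpace m) y :=
  (h.contDiff_bil.differentiableWithinAt (by norm_num)).hasFDerivWithinAt

lemma hasFDerivWithinAt_gam (h : IsMetricAt G y) :
    HasFDerivWithinAt (gam G) (fderivWithin ℝ (gam G) (halfSpace m) y) (halfSpace m) y :=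
  (h.contDiff_gam.differentiableWithinAt (by norm_num)).hasFDerivWithinAt

lemma fderivWithin_bil (h : IsMetricAt G y) (u v w : Coord m) :
    fderivWithin ℝ (bil G) (halfSpace m) y u v w =
      ∑ i, ∑ j, v i * w j * ∑ k, u k * pd k (fun z => G z i j) y := by
  have h1 := ((h.hasFDerivWithinAt_bil.clm_apply (hasFDerivWithinAt_const v y _)).clm_apply
    (hasFDerivWithinAt_const w y _))
  have h2 : HasFDerivWithinAt (fun z => ∑ i, ∑ j, G z i j * (v i * w j))
      (∑ i, ∑ j, (v i * w j) • fderivWithin ℝ (fun z => G z i j) (halfSpace m) y)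
      (halfSpace m) y :=
    HasFDerivWithinAt.fun_sum fun i _ => HasFDerivWithinAt.fun_sum fun j _ =>
      (((h.contDiff i j).differentiableWithinAt (by norm_num)).hasFDerivWithinAt).mul_const _
  simp only [bil_apply] at h1
  have h3 := congrArg (fun L : Coord m →L[ℝ] ℝ => L u)
    ((uniqueDiffOn_halfSpace y h.mem).eq h1 h2)
  simp only [sum_apply, smul_apply, fderivWithin_eq_sum_pd (fun z => G z _ _)] at h3
  simpa using h3

lemma pd_symm (h : IsMetricAt G y) (k i j : Fin (m + 1)) :
    pd k (fun z => G z i j) y = pd k (fun z => G z j i) y := by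
  unfold pd
  congr 1
  refine Filter.EventuallyEq.fderivWithin_eq ?_ (h.symm_apply i j)
  filter_upwards [h.eventually] with z hz using hz.symm_apply i j

/-- Lowering the upper index removes the inverse matrix; this is the Koszul formula on basis
vectors. -/
lemma sum_mul_christoffel (h : IsMetricAt G y) (i j l : Fin (m + 1)) :
    2 * ∑ k, G y k l * christoffel G k i j y =
      pd i (fun z => G z j l) y + pd j (fun z => G z i l) y - pd l (fun z => G z i j) y := by
  simp only [christoffel, Finset.mul_sum]
  rw [Finset.sum_comm]
  have (a : Fin (m + 1)) : ∑ k, G y k l * (G y)⁻¹ k a = (1 : Matrix _ _ ℝ) l a := by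
    rw [← h.mul_inv, Matrix.mul_apply]
    exact Finset.sum_congr rfl fun k _ => by rw [h.symm_apply]
  calc _ = ∑ a, (∑ k, G y k l * (G y)⁻¹ k a) * (pd i (fun z => G z j a) y +
        pd j (fun z => G z i a) y - pd a (fun z => G z i j) y) := by
        refine Finset.sum_congr rfl fun a _ => ?_
        rw [Finset.sum_mul]
        refine Finset.sum_congr rfl fun k _ => ?_
        ring
    _ = _ := by simp [this, Matrix.one_apply]

lemma eq_zero_of_bvec {L : Coord m → ℝ} (hL : IsLinearMap ℝ L) (h : ∀ i, L (bvec i) = 0)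
    (v : Coord m) : L v = 0 := by
  have h1 : L v = (IsLinearMap.mk' L hL) (∑ k, v k • bvec k) := by rw [sum_bvec]; rfl
  rw [h1, map_sum]
  exact Finset.sum_eq_zero fun k _ => by rw [map_smul, IsLinearMap.mk'_apply, h, smul_zero]

lemma koszul (h : IsMetricAt G y) (v w z : Coord m) :
    2 * bil G y (gam G y v w) z = fderivWithin ℝ (bil G) (halfSpace m) y v w z +
      fderivWithin ℝ (bil G) (halfSpace m) y w v z -
      fderivWithin ℝ (bil G) (halfSpace m) y z v w := by
  rw [← sub_eq_zero]
  revert z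
  refine eq_zero_of_bvec (by constructor <;> intros <;> simp <;> ring) fun l => ?_
  revert w
  refine eq_zero_of_bvec (by constructor <;> intros <;> simp <;> ring) fun j => ?_
  revert v
  refine eq_zero_of_bvec (by constructor <;> intros <;> simp <;> ring) fun i => ?_
  have h1 (i j l : Fin (m + 1)) : fderivWithin ℝ (bil G) (halfSpace m) y (bvec i) (bvec j)
      (bvec l) = pd i (fun z => G z j l) y := by
    simp [h.fderivWithin_bil]
  have h2 : bil G y (gam G y (bvec i) (bvec j)) (bvec l) =
      ∑ k, G y k l * christoffel G k i j y := by
    rw [bil_apply]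
    refine Finset.sum_congr rfl fun k _ => ?_
    rw [gam_bvec]
    simp
  rw [h1, h1, h1, h2, h.sum_mul_christoffel, sub_self]

lemma bil_symm (h : IsMetricAt G y) (v w : Coord m) : bil G y v w = bil G y w v := by
  rw [bil_apply, bil_apply, Finset.sum_comm]
  exact Finset.sum_congr rfl fun i _ => Finset.sum_congr rfl fun j _ => by
    rw [h.symm_apply, mul_comm (v j)]

/-- Metric compatibility: adding the Koszul formulas for `(u, v, w)` and `(u, w, v)` leaves only the
derivative in the direction `u`. -/
lemma bil_compat (h : IsMetricAt G y) (u v w : Coord m) :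
    fderivWithin ℝ (bil G) (halfSpace m) y u v w =
      bil G y (gam G y u v) w + bil G y v (gam G y u w) := by
  have hs (u v w : Coord m) : fderivWithin ℝ (bil G) (halfSpace m) y u v w =
      fderivWithin ℝ (bil G) (halfSpace m) y u w v := by
    rw [h.fderivWithin_bil, h.fderivWithin_bil, Finset.sum_comm]
    refine Finset.sum_congr rfl fun i _ => Finset.sum_congr rfl fun j _ => ?_
    rw [mul_comm (v j)]
    congr 1
    exact Finset.sum_congr rfl fun k _ => by rw [h.pd_symm]
  have h1 := h.koszul u v w
  have h2 := h.koszul u w v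
  rw [h.bil_symm v]
  rw [hs w u v, hs v u w, hs u w v] at *
  linarith

lemma gam_symm (h : IsMetricAt G y) (v w : Coord m) : gam G y v w = gam G y w v := by
  ext k
  rw [gam_apply, gam_apply, Finset.sum_comm]
  refine Finset.sum_congr rfl fun i _ => Finset.sum_congr rfl fun j _ => ?_
  rw [mul_comm (v j)]
  congr 1
  unfold christoffel
  congr 1
  refine Finset.sum_congr rfl fun l _ => ?_
  rw [h.pd_symm l j i]
  ring

lemma bil_nondegenerate (h : IsMetricAt G y) (v : Coord m) (hv : ∀ z, bil G y v z = 0) :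
    v = 0 := by
  by_contra hne
  have h1 : (v : Fin (m + 1) → ℝ) ≠ 0 := fun h0 => hne (by ext i; exact congrFun h0 i)
  have h2 := h.posDef_self.dotProduct_mulVec_pos h1
  have h3 : star (v : Fin (m + 1) → ℝ) ⬝ᵥ (G y).mulVec v = bil G y v v := by
    simp only [bil_apply, dotProduct, Matrix.mulVec, Finset.mul_sum]
    exact Finset.sum_congr rfl fun i _ => Finset.sum_congr rfl fun j _ => by simp; ring
  rw [h3, hv] at h2
  exact lt_irrefl _ h2

lemma pd_christoffel_eq (h : IsMetricAt G y) (a k i j : Fin (m + 1)) :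
    fderivWithin ℝ (gam G) (halfSpace m) y (bvec a) (bvec i) (bvec j) k =
      pd a (christoffel G k i j) y := by
  have h1 := ((h.hasFDerivWithinAt_gam.clm_apply (hasFDerivWithinAt_const (bvec i) y _)).clm_apply
    (hasFDerivWithinAt_const (bvec j) y _))
  have h2 := (EuclideanSpace.proj k : Coord m →L[ℝ] ℝ).hasFDerivAt.comp_hasFDerivWithinAt y h1
  have h3 : (EuclideanSpace.proj k : Coord m →L[ℝ] ℝ) ∘ (fun z => gam G z (bvec i) (bvec j)) =
      christoffel G k i j := by
    funext z; exact gam_bvec i j k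
  rw [h3] at h2
  have h4 := h2.fderivWithin (uniqueDiffOn_halfSpace y h.mem)
  simp only [pd]
  erw [h4]
  simp

lemma trace_eq_sum (L : Coord m →ₗ[ℝ] Coord m) :
    LinearMap.trace ℝ (Coord m) L = ∑ i, L (bvec i) i := by
  rw [LinearMap.trace_eq_matrix_trace ℝ (EuclideanSpace.basisFun (Fin (m + 1)) ℝ).toBasis]
  simp [Matrix.trace, LinearMap.toMatrix_apply]

/-- Bridge from the index formula to the trace of `u ↦ R(u, v) w`, which behaves well under changes
of coordinates and of the metric. -/
lemma ricciCoord_eq (h : IsMetricAt G y) (j k : Fin (m + 1)) :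
    ricciCoord G j k y =
      ric (gam G y) (fderivWithin ℝ (gam G) (halfSpace m) y) (bvec j) (bvec k) := by
  have h2 (i j l : Fin (m + 1)) (v : Coord m) :
      gam G y (bvec j) v i = ∑ l, christoffel G i j l y * v l := by
    simp [gam_apply]
  rw [ric, trace_eq_sum, ricciCoord, ← Finset.sum_add_distrib]
  refine Finset.sum_congr rfl fun i _ => ?_
  simp only [curv_apply, PiLp.add_apply, PiLp.sub_apply, h.pd_christoffel_eq, h2 i _ i,
    gam_bvec, Finset.sum_sub_distrib]
  ring

/-- The first and third derivatives in `Γ^k_kj` are exchanged by swapping the summation indices,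
since `g^kl` is symmetric, so they cancel. -/
lemma sum_christoffel (h : IsMetricAt G y) (j : Fin (m + 1)) :
    ∑ k, christoffel G k k j y =
      (1 / 2 : ℝ) * ∑ k, ∑ l, (G y)⁻¹ k l * pd j (fun z => G z k l) y := by
  simp only [christoffel, ← Finset.mul_sum, mul_sub, mul_add, Finset.sum_sub_distrib,
    Finset.sum_add_distrib]
  rw [Finset.sum_comm (f := fun k l => (G y)⁻¹ k l * pd l (fun z => G z k j) y)]
  have : ∑ k, ∑ l, (G y)⁻¹ k l * pd k (fun z => G z j l) y =
      ∑ k, ∑ l, (G y)⁻¹ l k * pd k (fun z => G z l j) y :=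
    Finset.sum_congr rfl fun k _ => Finset.sum_congr rfl fun l _ => by
      rw [h.inv_symm_apply, h.pd_symm]
  rw [this]
  ring

lemma contDiff_sqrt_det (h : IsMetricAt G y) :
    ContDiffWithinAt ℝ 2 (fun z => √(G z).det) (halfSpace m) y :=
  (contDiffWithinAt_det h.contDiff).sqrt h.det_pos.ne'

/-- Jacobi's formula gives `∂_j √det = (1/2) √det · g^kl ∂_j g_kl`, which is the contracted
Christoffel symbol. -/
lemma pd_sqrt_det (h : IsMetricAt G y) (j : Fin (m + 1)) :
    pd j (fun z => √(G z).det) y = √(G y).det * ∑ k, christoffel G k k j y := by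
  have h1 := (hasFDerivWithinAt_det fun a b =>
    ((h.contDiff a b).differentiableWithinAt (by norm_num)).hasFDerivWithinAt).sqrt h.det_pos.ne'
  have h2 := congrArg (fun L : Coord m →L[ℝ] ℝ => L (bvec j))
    (h1.fderivWithin (uniqueDiffOn_halfSpace y h.mem))
  have h3 : pd j (fun z => √(G z).det) y = _ := h2
  rw [h3, h.sum_christoffel]
  have h4 (i k : Fin (m + 1)) : (G y).adjugate i k = (G y).det * (G y)⁻¹ i k := by
    rw [Matrix.inv_def, Matrix.smul_apply, Ring.inverse_eq_inv', smul_eq_mul,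
      mul_inv_cancel_left₀ h.det_pos.ne']
  have h5 : (∑ i, ∑ k, (G y).adjugate i k • fderivWithin ℝ (fun z => G z k i) (halfSpace m) y)
      (bvec j) = (G y).det * ∑ k, ∑ l, (G y)⁻¹ k l * pd j (fun z => G z k l) y := by
    simp only [sum_apply, smul_apply, smul_eq_mul, h4, Finset.mul_sum]
    refine Finset.sum_congr rfl fun i _ => Finset.sum_congr rfl fun k _ => ?_
    rw [h.pd_symm, mul_assoc]; rfl
  rw [smul_apply, h5, smul_eq_mul]
  have h6 := Real.mul_self_sqrt h.det_pos.le
  have h7 := (Real.sqrt_pos.2 h.det_pos).ne'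
  field_simp
  rw [sq, h6]

/-- The coordinate divergence is the trace of the covariant derivative. -/
lemma divCoord_eq (h : IsMetricAt G y) {X : Fin (m + 1) → Coord m → ℝ} {X' : Coord m → Coord m}
    (hX : ∀ i z, X' z i = X i z) {dX : Coord m →L[ℝ] Coord m}
    (hd : HasFDerivWithinAt X' dX (halfSpace m) y) :
    divCoord G X y = LinearMap.trace ℝ (Coord m) (cov (gam G y) (X' y) dX) := by
  have h1 (i : Fin (m + 1)) : HasFDerivWithinAt (X i)
      ((EuclideanSpace.proj i : Coord m →L[ℝ] ℝ).comp dX) (halfSpace m) y := by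
    have := (EuclideanSpace.proj i : Coord m →L[ℝ] ℝ).hasFDerivAt.comp_hasFDerivWithinAt y hd
    refine this.congr_of_eventuallyEq (Eventually.of_forall fun z => ?_) ?_ <;> simp [hX]
  have h2 (i : Fin (m + 1)) : pd i (fun z => √(G z).det * X i z) y =
      √(G y).det * (dX (bvec i) i + X i y * ∑ k, christoffel G k k i y) := by
    have h3 := (((h.contDiff_sqrt_det).differentiableWithinAt
      (by norm_num)).hasFDerivWithinAt.mul (h1 i)).fderivWithin (uniqueDiffOn_halfSpace y h.mem)
    have h4 := congrArg (fun L : Coord m →L[ℝ] ℝ => L (bvec i)) h3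
    have h5 : pd i (fun z => √(G z).det * X i z) y = _ := h4
    rw [h5, add_apply, smul_apply, smul_apply]
    have h6 : fderivWithin ℝ (fun z => √(G z).det) (halfSpace m) y (bvec i) = _ :=
      h.pd_sqrt_det i
    rw [h6]
    simp only [ContinuousLinearMap.comp_apply, PiLp.proj_apply, smul_eq_mul]
    ring
  rw [divCoord, trace_eq_sum]
  simp only [h2, ← Finset.mul_sum]
  rw [inv_mul_cancel_left₀ (Real.sqrt_pos.2 h.det_pos).ne']
  simp only [cov_apply, PiLp.add_apply, Finset.sum_add_distrib]
  congr 1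
  have h7 (i : Fin (m + 1)) (v : Coord m) :
      gam G y (bvec i) v i = ∑ l, christoffel G i i l y * v l := by
    simp [gam_apply]
  simp only [h7, Finset.mul_sum]
  rw [Finset.sum_comm]
  exact Finset.sum_congr rfl fun i _ => Finset.sum_congr rfl fun j _ => by rw [hX, mul_comm]

end IsMetricAt

/-! ### The Ricci tensor under a conformal change of the metric. -/

section Ricci

variable {E : Type*} [NormedAddCommGroup E] [NormedSpace ℝ E]

/-- The Ricci tensor as a bilinear map. -/
def ricBilin (Γ : E →L[ℝ] E →L[ℝ] E) (dΓ : E →L[ℝ] E →L[ℝ] E →L[ℝ] E) : E →ₗ[ℝ] E →ₗ[ℝ] ℝ :=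
  LinearMap.mk₂ ℝ (ric Γ dΓ)
    (fun a b c => by
      rw [ric, ric, ric, ← map_add]; congr 1; ext u; simp [curv_apply]; abel)
    (fun r a c => by
      rw [ric, ric, ← map_smul]; congr 1; ext u; simp [curv_apply, smul_sub, smul_add])
    (fun a b c => by
      rw [ric, ric, ric, ← map_add]; congr 1; ext u; simp [curv_apply]; abel)
    (fun r a c => by
      rw [ric, ric, ← map_smul]; congr 1; ext u; simp [curv_apply, smul_sub, smul_add])

lemma ricBilin_apply (Γ : E →L[ℝ] E →L[ℝ] E) (dΓ : E →L[ℝ] E →L[ℝ] E →L[ℝ] E) (v w : E) :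
    ricBilin Γ dΓ v w = ric Γ dΓ v w := rfl

/-- The change of the Ricci tensor under a conformal change of the metric. -/
lemma ric_conformal [FiniteDimensional ℝ E] {Γ Γt : E →L[ℝ] E →L[ℝ] E}
    {dΓ dΓt : E →L[ℝ] E →L[ℝ] E →L[ℝ] E} {B : E →L[ℝ] E →L[ℝ] ℝ}
    {dB : E →L[ℝ] E →L[ℝ] E →L[ℝ] ℝ} {α : E →L[ℝ] ℝ} {dα : E →L[ℝ] E →L[ℝ] ℝ} {N : E}
    {dN : E →L[ℝ] E}
    (hΓt : ∀ v x, Γt v x = Γ v x + α v • x + α x • v - B v x • N)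
    (hdΓt : ∀ u v x, dΓt u v x = dΓ u v x + dα u v • x + dα u x • v -
      (dB u v x • N + B v x • dN u))
    (hdB : ∀ u v x, dB u v x = B (Γ u v) x + B v (Γ u x))
    (hN : ∀ v, B N v = α v) (hdα : ∀ u v, dα u v = dB u N v + B (dN u) v)
    (hdα_symm : ∀ u v, dα u v = dα v u) (hΓ : ∀ u v, Γ u v = Γ v u)
    (hB : ∀ u v, B u v = B v u) (v x : E) :
    ric Γt dΓt v x = ric Γ dΓ v x - (Module.finrank ℝ E - 2) * (B (cov Γ N dN v) x - α v * α x) -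
      (LinearMap.trace ℝ E (cov Γ N dN) + (Module.finrank ℝ E - 2) * α N) * B v x := by
  -- The second derivative of the conformal exponent is its covariant Hessian plus a Christoffel
  -- term. Writing everything in the Hessian makes the Christoffel terms cancel below.
  have hH (u v : E) : dα u v = B (cov Γ N dN u) v + α (Γ u v) := by
    rw [hdα, hdB, hN, cov_apply, map_add, add_apply]; ring
  have hHs (u v : E) : B (cov Γ N dN u) v = B (cov Γ N dN v) u := by
    have h1 := hH u v
    have h2 := hH v u
    rw [hΓ v u] at h2
    linarith [hdα_symm u v]
  have hN' (v : E) : B v N = α v := by rw [hB, hN]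
  set L := cov Γ N dN with hL
  have hdN (u : E) : dN u = L u - Γ u N := by rw [hL, cov_apply]; abel
  -- The difference of the curvatures is a sum of rank-one maps, a multiple of `L` and a multiple of
  -- the identity, so its trace can be read off term by term.
  have key : curv Γt dΓt v x = curv Γ dΓ v x +
      ((((B.flip x).toLinearMap ∘ₗ L - α x • α.toLinearMap + α N • (B.flip x).toLinearMap).smulRight
        v) - B v x • L + (α v * α x - α N * B v x - B (L v) x) • LinearMap.id +
      ((B.flip x).toLinearMap).smulRight (L v - α v • N) +
      (B v x • α.toLinearMap).smulRight N) := by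
    ext u
    simp only [curv_apply, LinearMap.add_apply, LinearMap.sub_apply, LinearMap.smul_apply,
      LinearMap.smulRight_apply, LinearMap.comp_apply, ContinuousLinearMap.coe_coe,
      ContinuousLinearMap.flip_apply, LinearMap.id_apply, hΓt, hdΓt, hH, hdB, hdN, map_add, map_sub,
      map_smul, smul_eq_mul, hN']
    rw [hHs v u, hΓ v u, hB (Γ u v) x, hB v (Γ u x), hB v u, hB u (Γ v x)]
    rw [hB x (Γ u v)]
    module
  rw [ric, key]
  simp only [map_add, map_sub, map_smul, LinearMap.trace_smulRight, LinearMap.trace_id,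
    LinearMap.add_apply, LinearMap.sub_apply, LinearMap.smul_apply, LinearMap.comp_apply,
    ContinuousLinearMap.coe_coe, ContinuousLinearMap.flip_apply, smul_eq_mul, hN]
  rw [ric]
  ring

end Ricci

/-! ### Gradients and metric traces in coordinates. -/

variable {m : ℕ} {G G' : Coord m → Matrix (Fin (m + 1)) (Fin (m + 1)) ℝ} {y : Coord m}

/-- The gradient as a vector. -/
def gradVec (G : Coord m → Matrix (Fin (m + 1)) (Fin (m + 1)) ℝ) (h : Coord m → ℝ)
    (y : Coord m) : Coord m := WithLp.toLp 2 fun i => gradCoord G h i y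

/-- The pairing `⟨∇h, ∇k⟩`. -/
def gradPair (G : Coord m → Matrix (Fin (m + 1)) (Fin (m + 1)) ℝ) (h k : Coord m → ℝ)
    (y : Coord m) : ℝ := fderivWithin ℝ h (halfSpace m) y (gradVec G k y)

lemma gradPair_eq_sum (h k : Coord m → ℝ) :
    gradPair G h k y = ∑ i, gradCoord G k i y * pd i h y := by
  rw [gradPair, fderivWithin_eq_sum_pd]; rfl

namespace IsMetricAt

/-- Raising an index with `G⁻¹` and pairing by `G` gives back the covector. -/
lemma bil_toLp (h : IsMetricAt G y) (a : Fin (m + 1) → ℝ) (v : Coord m) :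
    bil G y (WithLp.toLp 2 fun i => ∑ j, (G y)⁻¹ i j * a j) v = ∑ j, a j * v j := by
  rw [bil_apply, Finset.sum_comm]
  refine Finset.sum_congr rfl fun j _ => ?_
  simp only [Finset.sum_mul, Finset.mul_sum]
  rw [Finset.sum_comm]
  have (l : Fin (m + 1)) : ∑ i, G y j i * (G y)⁻¹ i l = (1 : Matrix _ _ ℝ) j l := by
    rw [← h.mul_inv, Matrix.mul_apply]
  calc _ = ∑ l, (∑ i, G y j i * (G y)⁻¹ i l) * (a l * v j) := by
        refine Finset.sum_congr rfl fun l _ => ?_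
        rw [Finset.sum_mul]
        exact Finset.sum_congr rfl fun i _ => by rw [h.symm_apply i j]; ring
    _ = _ := by simp [this, Matrix.one_apply]

lemma bil_gradVec (h : IsMetricAt G y) (k : Coord m → ℝ) (v : Coord m) :
    bil G y (gradVec G k y) v = fderivWithin ℝ k (halfSpace m) y v := by
  rw [gradVec]
  simp only [gradCoord]
  rw [h.bil_toLp, fderivWithin_eq_sum_pd]
  exact Finset.sum_congr rfl fun i _ => mul_comm _ _

lemma ext_bil (h : IsMetricAt G y) {v w : Coord m} (hvw : ∀ z, bil G y v z = bil G y w z) :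
    v = w := by
  rw [← sub_eq_zero]
  exact h.bil_nondegenerate _ fun z => by rw [map_sub, sub_apply, hvw, sub_self]

lemma gradPair_symm (h : IsMetricAt G y) (k l : Coord m → ℝ) :
    gradPair G k l y = gradPair G l k y := by
  rw [gradPair, ← h.bil_gradVec, h.bil_symm, h.bil_gradVec, gradPair]

lemma contDiff_gradVec (h : IsMetricAt G y) {k : Coord m → ℝ}
    (hk : ContDiffWithinAt ℝ 2 k (halfSpace m) y) :
    ContDiffWithinAt ℝ 1 (gradVec G k) (halfSpace m) y := by
  rw [contDiffWithinAt_euclidean]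
  intro i
  change ContDiffWithinAt ℝ 1 (fun z => ∑ j, (G z)⁻¹ i j * pd j k z) _ _
  exact ContDiffWithinAt.sum fun j _ => ((h.contDiff_inv i j).of_le (by norm_num)).mul
    (contDiff_pd hk (by norm_num) h.mem j)

lemma hasFDerivWithinAt_gradVec (h : IsMetricAt G y) {k : Coord m → ℝ}
    (hk : ContDiffWithinAt ℝ 2 k (halfSpace m) y) :
    HasFDerivWithinAt (gradVec G k) (fderivWithin ℝ (gradVec G k) (halfSpace m) y)
      (halfSpace m) y :=
  ((h.contDiff_gradVec hk).differentiableWithinAt (by norm_num)).hasFDerivWithinAt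

lemma laplaceCoord_eq (h : IsMetricAt G y) {k : Coord m → ℝ}
    (hk : ContDiffWithinAt ℝ 2 k (halfSpace m) y) :
    laplaceCoord G k y = LinearMap.trace ℝ (Coord m)
      (cov (gam G y) (gradVec G k y) (fderivWithin ℝ (gradVec G k) (halfSpace m) y)) :=
  h.divCoord_eq (fun _ _ => rfl) (h.hasFDerivWithinAt_gradVec hk)

/-- The metric trace of a bilinear form. -/
lemma sum_inv_eq_trace (h : IsMetricAt G y) {b : Coord m → Coord m → ℝ}
    {T : Coord m →ₗ[ℝ] Coord m} (hT : ∀ v w, bil G y (T v) w = b w v) :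
    ∑ j, ∑ k, (G y)⁻¹ j k * b (bvec j) (bvec k) = LinearMap.trace ℝ (Coord m) T := by
  rw [trace_eq_sum, Finset.sum_comm]
  refine Finset.sum_congr rfl fun k _ => ?_
  have h1 : T (bvec k) = WithLp.toLp 2 fun i => ∑ j, (G y)⁻¹ i j * b (bvec j) (bvec k) := by
    refine h.ext_bil fun z => ?_
    rw [h.bil_toLp]
    conv_lhs => rw [← sum_bvec z]
    rw [map_sum]
    exact Finset.sum_congr rfl fun j _ => by rw [map_smul, hT, smul_eq_mul, mul_comm]
  rw [h1]
  exact Finset.sum_congr rfl fun j _ => by rw [h.inv_symm_apply]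

/-- Turns the Ricci form into an endomorphism, so that by `sum_inv_eq_trace` the scalar curvature is
an ordinary trace. -/
lemma exists_endomorphism (h : IsMetricAt G y) (b : Coord m →ₗ[ℝ] Coord m →ₗ[ℝ] ℝ) :
    ∃ T : Coord m →ₗ[ℝ] Coord m, ∀ v w, bil G y (T v) w = b w v := by
  refine ⟨{ toFun := fun v => WithLp.toLp 2 fun i => ∑ j, (G y)⁻¹ i j * b (bvec j) v
            map_add' := ?_, map_smul' := ?_ }, fun v w => ?_⟩
  · intro v w; ext i; simp [mul_add, Finset.sum_add_distrib]
  · intro c v; ext i; simp [Finset.mul_sum, mul_left_comm]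
  · simp only [LinearMap.coe_mk, AddHom.coe_mk]
    rw [h.bil_toLp]
    conv_rhs => rw [← sum_bvec w]
    simp [map_sum, mul_comm]

end IsMetricAt

/-! ### Changes of coordinates -/

/-- `φ` is a change of coordinates of the half space near `y`. -/
structure IsChangeAt (φ : Coord m → Coord m) (y : Coord m) : Prop where
  mem : y ∈ halfSpace m
  contDiff : ContDiffWithinAt ℝ 3 φ (halfSpace m) y
  maps : ∀ᶠ z in 𝓝[halfSpace m] y, φ z ∈ halfSpace m
  bij : ∀ᶠ z in 𝓝[halfSpace m] y, Function.Bijective (fderivWithin ℝ φ (halfSpace m) z)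

/-- `G'` is the pullback of `G` by `φ` near `y`. -/
def IsPullbackAt (G' G : Coord m → Matrix (Fin (m + 1)) (Fin (m + 1)) ℝ) (φ : Coord m → Coord m)
    (y : Coord m) : Prop :=
  ∀ᶠ z in 𝓝[halfSpace m] y, ∀ v w, bil G' z v w =
    bil G (φ z) (fderivWithin ℝ φ (halfSpace m) z v) (fderivWithin ℝ φ (halfSpace m) z w)

namespace IsChangeAt

variable {φ : Coord m → Coord m}

lemma eventually (h : IsChangeAt φ y) : ∀ᶠ z in 𝓝[halfSpace m] y, IsChangeAt φ z := by
  have h1 := h.contDiff.eventually (by simp)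
  rw [insert_eq_of_mem h.mem] at h1
  filter_upwards [h1, eventually_eventually_nhdsWithin.2 h.maps,
    eventually_eventually_nhdsWithin.2 h.bij, self_mem_nhdsWithin]
    with z hz1 hz2 hz3 hz4 using ⟨hz4, hz1, hz2, hz3⟩

lemma tendsto (h : IsChangeAt φ y) :
    Tendsto φ (𝓝[halfSpace m] y) (𝓝[halfSpace m] (φ y)) :=
  tendsto_nhdsWithin_iff.2 ⟨h.contDiff.continuousWithinAt, h.maps⟩

lemma bij_self (h : IsChangeAt φ y) : Function.Bijective (fderivWithin ℝ φ (halfSpace m) y) :=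
  h.bij.self_of_nhdsWithin h.mem

lemma contDiff_fderiv (h : IsChangeAt φ y) :
    ContDiffWithinAt ℝ 2 (fderivWithin ℝ φ (halfSpace m)) (halfSpace m) y :=
  h.contDiff.fderivWithin_right uniqueDiffOn_halfSpace (by norm_num) h.mem

lemma contDiff_fderiv_fderiv (h : IsChangeAt φ y) :
    ContDiffWithinAt ℝ 1 (fderivWithin ℝ (fderivWithin ℝ φ (halfSpace m)) (halfSpace m))
      (halfSpace m) y :=
  h.contDiff_fderiv.fderivWithin_right uniqueDiffOn_halfSpace (by norm_num) h.mem

lemma hasFDerivWithinAt (h : IsChangeAt φ y) :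
    HasFDerivWithinAt φ (fderivWithin ℝ φ (halfSpace m) y) (halfSpace m) y :=
  (h.contDiff.differentiableWithinAt (by norm_num)).hasFDerivWithinAt

lemma hasFDerivWithinAt' (h : IsChangeAt φ y) :
    HasFDerivWithinAt (fderivWithin ℝ φ (halfSpace m))
      (fderivWithin ℝ (fderivWithin ℝ φ (halfSpace m)) (halfSpace m) y) (halfSpace m) y :=
  (h.contDiff_fderiv.differentiableWithinAt (by norm_num)).hasFDerivWithinAt

lemma hasFDerivWithinAt'' (h : IsChangeAt φ y) :
    HasFDerivWithinAt (fderivWithin ℝ (fderivWithin ℝ φ (halfSpace m)) (halfSpace m))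
      (fderivWithin ℝ (fderivWithin ℝ (fderivWithin ℝ φ (halfSpace m)) (halfSpace m))
        (halfSpace m) y) (halfSpace m) y :=
  (h.contDiff_fderiv_fderiv.differentiableWithinAt (by norm_num)).hasFDerivWithinAt

end IsChangeAt

/-- Second derivatives are symmetric also at boundary points, because the half space lies in the
closure of its interior. -/
lemma fderivWithin_symm {F : Type*} [NormedAddCommGroup F] [NormedSpace ℝ F] {f : Coord m → F}
    (hf : ContDiffWithinAt ℝ 2 f (halfSpace m) y) (hy : y ∈ halfSpace m) (u v : Coord m) :
    fderivWithin ℝ (fderivWithin ℝ f (halfSpace m)) (halfSpace m) y u v =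
      fderivWithin ℝ (fderivWithin ℝ f (halfSpace m)) (halfSpace m) y v u :=
  hf.isSymmSndFDerivWithinAt (by simp) uniqueDiffOn_halfSpace
    ((𝓡∂ (m + 1)).range_subset_closure_interior hy) hy u v

namespace IsPullbackAt

variable {φ : Coord m → Coord m}

lemma self (hp : IsPullbackAt G' G φ y) (hy : y ∈ halfSpace m) (v w : Coord m) : bil G' y v w =
    bil G (φ y) (fderivWithin ℝ φ (halfSpace m) y v) (fderivWithin ℝ φ (halfSpace m) y w) :=
  hp.self_of_nhdsWithin hy v w

lemma eventually (hp : IsPullbackAt G' G φ y) :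
    ∀ᶠ z in 𝓝[halfSpace m] y, IsPullbackAt G' G φ z :=
  eventually_eventually_nhdsWithin.2 hp

lemma gam_eq (hp : IsPullbackAt G' G φ y) (hφ : IsChangeAt φ y) (hG' : IsMetricAt G' y)
    (hG : IsMetricAt G (φ y)) (v w : Coord m) :
    fderivWithin ℝ φ (halfSpace m) y (gam G' y v w) =
      gam G (φ y) (fderivWithin ℝ φ (halfSpace m) y v) (fderivWithin ℝ φ (halfSpace m) y w) +
        fderivWithin ℝ (fderivWithin ℝ φ (halfSpace m)) (halfSpace m) y v w :=
  christoffel_change hφ.bij_self.2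
    (fderivWithin_symm (hφ.contDiff.of_le (by norm_num)) hφ.mem) hG.bil_symm hG.bil_nondegenerate
    (hp.self hφ.mem) hG.koszul hG'.koszul
    (pullback_fderiv (uniqueDiffOn_halfSpace y hφ.mem) hφ.hasFDerivWithinAt
      hφ.hasFDerivWithinAt' hφ.tendsto hG.hasFDerivWithinAt_bil hG'.hasFDerivWithinAt_bil hp hφ.mem)
    v w

lemma eventually_gam_eq (hp : IsPullbackAt G' G φ y) (hφ : IsChangeAt φ y)
    (hG' : IsMetricAt G' y) (hG : IsMetricAt G (φ y)) :
    ∀ᶠ z in 𝓝[halfSpace m] y, ∀ v w, fderivWithin ℝ φ (halfSpace m) z (gam G' z v w) =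
      gam G (φ z) (fderivWithin ℝ φ (halfSpace m) z v) (fderivWithin ℝ φ (halfSpace m) z w) +
        fderivWithin ℝ (fderivWithin ℝ φ (halfSpace m)) (halfSpace m) z v w := by
  filter_upwards [hp.eventually, hφ.eventually, hG'.eventually, hφ.tendsto.eventually hG.eventually]
    with z h1 h2 h3 h4 using h1.gam_eq h2 h3 h4

/-- Conjugation invariance of the trace is used twice: once for the Ricci tensor, as a trace of the
curvature, and once for the scalar curvature, as the trace of the Ricci endomorphism. -/
lemma scalarCoord_eq (hp : IsPullbackAt G' G φ y) (hφ : IsChangeAt φ y) (hG' : IsMetricAt G' y)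
    (hG : IsMetricAt G (φ y)) : scalarCoord G' y = scalarCoord G (φ y) := by
  have hc := curv_change (uniqueDiffOn_halfSpace y hφ.mem) hφ.mem hφ.hasFDerivWithinAt
    hφ.hasFDerivWithinAt' hφ.hasFDerivWithinAt''
    (fderivWithin_symm (hφ.contDiff.of_le (by norm_num)) hφ.mem)
    (fun u v w => by rw [fderivWithin_symm hφ.contDiff_fderiv hφ.mem])
    hφ.tendsto hG.hasFDerivWithinAt_gam hG'.hasFDerivWithinAt_gam
    (hp.eventually_gam_eq hφ hG' hG)
  set A := fderivWithin ℝ φ (halfSpace m) y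
  obtain ⟨T, hT⟩ := hG.exists_endomorphism (ricBilin (gam G (φ y))
    (fderivWithin ℝ (gam G) (halfSpace m) (φ y)))
  obtain ⟨T', hT'⟩ := hG'.exists_endomorphism (ricBilin (gam G' y)
    (fderivWithin ℝ (gam G') (halfSpace m) y))
  simp only [scalarCoord, hG'.ricciCoord_eq, hG.ricciCoord_eq, ← ricBilin_apply]
  rw [hG.sum_inv_eq_trace hT, hG'.sum_inv_eq_trace hT']
  refine trace_eq_of_conj hφ.bij_self fun u => hG.ext_bil fun z => ?_
  obtain ⟨z, rfl⟩ := hφ.bij_self.2 z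
  rw [← hp.self hφ.mem, hT, hT', ricBilin_apply, ricBilin_apply]
  exact trace_eq_of_conj hφ.bij_self fun x => hc x z u

lemma fderiv_comp (hφ : IsChangeAt φ y) {h h' : Coord m → ℝ}
    (hh : DifferentiableWithinAt ℝ h (halfSpace m) (φ y))
    (hh' : h' =ᶠ[𝓝[halfSpace m] y] h ∘ φ) (v : Coord m) :
    fderivWithin ℝ h' (halfSpace m) y v =
      fderivWithin ℝ h (halfSpace m) (φ y) (fderivWithin ℝ φ (halfSpace m) y v) := by
  have h1 := (HasFDerivWithinAt.comp_of_tendsto y hh.hasFDerivWithinAt hφ.hasFDerivWithinAt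
    hφ.tendsto).congr_of_eventuallyEq hh' (hh'.self_of_nhdsWithin hφ.mem)
  rw [h1.fderivWithin (uniqueDiffOn_halfSpace y hφ.mem)]; rfl

lemma gradVec_eq (hp : IsPullbackAt G' G φ y) (hφ : IsChangeAt φ y) (hG' : IsMetricAt G' y)
    (hG : IsMetricAt G (φ y)) {h h' : Coord m → ℝ}
    (hh : DifferentiableWithinAt ℝ h (halfSpace m) (φ y))
    (hh' : h' =ᶠ[𝓝[halfSpace m] y] h ∘ φ) :
    fderivWithin ℝ φ (halfSpace m) y (gradVec G' h' y) = gradVec G h (φ y) := by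
  refine hG.ext_bil fun z => ?_
  obtain ⟨z, rfl⟩ := hφ.bij_self.2 z
  rw [← hp.self hφ.mem, hG.bil_gradVec, hG'.bil_gradVec, fderiv_comp hφ hh hh']

lemma gradPair_eq (hp : IsPullbackAt G' G φ y) (hφ : IsChangeAt φ y) (hG' : IsMetricAt G' y)
    (hG : IsMetricAt G (φ y)) {h h' k k' : Coord m → ℝ}
    (hh : DifferentiableWithinAt ℝ h (halfSpace m) (φ y))
    (hk : DifferentiableWithinAt ℝ k (halfSpace m) (φ y))
    (hh' : h' =ᶠ[𝓝[halfSpace m] y] h ∘ φ) (hk' : k' =ᶠ[𝓝[halfSpace m] y] k ∘ φ) :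
    gradPair G' h' k' y = gradPair G h k (φ y) := by
  rw [gradPair, fderiv_comp hφ hh hh', hp.gradVec_eq hφ hG' hG hk hk', gradPair]

/-- The Laplacian is the trace of `u ↦ ∇_u ∇h`; the derivative of `φ` maps one gradient to the other
and so conjugates these endomorphisms. -/
lemma laplaceCoord_eq (hp : IsPullbackAt G' G φ y) (hφ : IsChangeAt φ y) (hG' : IsMetricAt G' y)
    (hG : IsMetricAt G (φ y)) {h h' : Coord m → ℝ}
    (hh : ContDiffWithinAt ℝ 2 h (halfSpace m) (φ y))
    (hh' : h' =ᶠ[𝓝[halfSpace m] y] h ∘ φ) :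
    laplaceCoord G' h' y = laplaceCoord G h (φ y) := by
  have hk : ContDiffWithinAt ℝ 2 h' (halfSpace m) y :=
    (hh.comp_of_preimage_mem_nhdsWithin y (hφ.contDiff.of_le (by norm_num))
      hφ.maps).congr_of_eventuallyEq hh' (hh'.self_of_nhdsWithin hφ.mem)
  rw [hG'.laplaceCoord_eq hk, hG.laplaceCoord_eq hh]
  refine trace_eq_of_conj hφ.bij_self ?_
  refine cov_change (uniqueDiffOn_halfSpace y hφ.mem) hφ.mem hφ.hasFDerivWithinAt
    hφ.hasFDerivWithinAt' hφ.tendsto (hG.hasFDerivWithinAt_gradVec hh)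
    (hG'.hasFDerivWithinAt_gradVec hk) (hp.gam_eq hφ hG' hG) ?_
  have h1 : ∀ᶠ z in 𝓝[halfSpace m] (φ y), DifferentiableWithinAt ℝ h (halfSpace m) z := by
    have := hh.eventually (by simp)
    rw [insert_eq_of_mem hG.mem] at this
    exact this.mono fun z hz => hz.differentiableWithinAt (by norm_num)
  filter_upwards [hp.eventually, hφ.eventually, hG'.eventually, hφ.tendsto.eventually hG.eventually,
    hφ.tendsto.eventually h1, eventually_eventually_nhdsWithin.2 hh']
    with z h1 h2 h3 h4 h5 h6 using h1.gradVec_eq h2 h3 h4 h5 h6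

end IsPullbackAt

/-! ### Conformal changes of the metric -/

variable {m : ℕ} {G Gt : Coord m → Matrix (Fin (m + 1)) (Fin (m + 1)) ℝ} {y : Coord m}
  {w : Coord m → ℝ}

lemma hasFDerivWithinAt_apply {E F : Type*} [NormedAddCommGroup E] [NormedSpace ℝ E]
    [NormedAddCommGroup F] [NormedSpace ℝ F] {s : Set E} {y : E} {c : E → E →L[ℝ] F}
    {c' : E →L[ℝ] E →L[ℝ] F} (h : HasFDerivWithinAt c c' s y)
    (v : E) : HasFDerivWithinAt (fun z => c z v) (c'.flip v) s y := by
  simpa using h.clm_apply (hasFDerivWithinAt_const v y _)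

lemma IsMetricAt.hasFDerivWithinAt_fderivWithin (hG : IsMetricAt G y)
    (hw : ContDiffWithinAt ℝ 2 w (halfSpace m) y) :
    HasFDerivWithinAt (fderivWithin ℝ w (halfSpace m))
      (fderivWithin ℝ (fderivWithin ℝ w (halfSpace m)) (halfSpace m) y) (halfSpace m) y :=
  ((hw.fderivWithin_right (m := 1) uniqueDiffOn_halfSpace (by norm_num)
    hG.mem).differentiableWithinAt (by norm_num)).hasFDerivWithinAt

/-- Derivative of the identity `dw = ⟨∇w, ·⟩`. -/
lemma IsMetricAt.fderivWithin_fderivWithin (hG : IsMetricAt G y)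
    (hw : ContDiffWithinAt ℝ 2 w (halfSpace m) y) (u v : Coord m) :
    fderivWithin ℝ (fderivWithin ℝ w (halfSpace m)) (halfSpace m) y u v =
      fderivWithin ℝ (bil G) (halfSpace m) y u (gradVec G w y) v +
        bil G y (fderivWithin ℝ (gradVec G w) (halfSpace m) y u) v := by
  have h1 := hasFDerivWithinAt_apply (hG.hasFDerivWithinAt_fderivWithin hw) v
  have h2 := (hG.hasFDerivWithinAt_bil.clm_apply (hG.hasFDerivWithinAt_gradVec hw)).clm_apply
    (hasFDerivWithinAt_const v y _)
  have h3 := h2.congr_of_eventuallyEq (f₁ := fun z => fderivWithin ℝ w (halfSpace m) z v) (by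
    filter_upwards [hG.eventually] with z h1
    exact (h1.bil_gradVec w v).symm) (hG.bil_gradVec w v).symm
  have h5 := congrArg (fun L : Coord m →L[ℝ] ℝ => L u)
    ((uniqueDiffOn_halfSpace y hG.mem).eq h1 h3)
  simp at h5
  rw [h5]; ring

lemma IsMetricAt.contDiff_normalCoord (hG : IsMetricAt G y) (i : Fin (m + 1)) :
    ContDiffWithinAt ℝ 2 (normalCoord G i) (halfSpace m) y :=
  (hG.contDiff_inv i 0).neg.div ((hG.contDiff_inv 0 0).sqrt
    (hG.posDef_self.inv.diag_pos (i := 0)).ne')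
    (Real.sqrt_pos.2 (hG.posDef_self.inv.diag_pos (i := 0))).ne'

/-- `Gt = e^(2w) G` near `y`. -/
def IsConformalAt (Gt G : Coord m → Matrix (Fin (m + 1)) (Fin (m + 1)) ℝ) (w : Coord m → ℝ)
    (y : Coord m) : Prop :=
  ∀ᶠ z in 𝓝[halfSpace m] y, Gt z = Real.exp (2 * w z) • G z

namespace IsConformalAt

lemma self (hc : IsConformalAt Gt G w y) (hy : y ∈ halfSpace m) :
    Gt y = Real.exp (2 * w y) • G y := hc.self_of_nhdsWithin hy

lemma eventually (hc : IsConformalAt Gt G w y) :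
    ∀ᶠ z in 𝓝[halfSpace m] y, IsConformalAt Gt G w z :=
  eventually_eventually_nhdsWithin.2 hc

lemma bil_eq (hc : IsConformalAt Gt G w y) (hy : y ∈ halfSpace m) :
    bil Gt y = Real.exp (2 * w y) • bil G y := by
  ext u v
  simp [bil_apply, hc.self hy, Finset.mul_sum, mul_assoc]

lemma fderivWithin_bil (hc : IsConformalAt Gt G w y) (hG : IsMetricAt G y)
    (hGt : IsMetricAt Gt y) (hw : DifferentiableWithinAt ℝ w (halfSpace m) y) (u v x : Coord m) :
    fderivWithin ℝ (bil Gt) (halfSpace m) y u v x =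
      Real.exp (2 * w y) * (2 * fderivWithin ℝ w (halfSpace m) y u * bil G y v x +
        fderivWithin ℝ (bil G) (halfSpace m) y u v x) := by
  have h1 := ((hGt.hasFDerivWithinAt_bil.clm_apply (hasFDerivWithinAt_const v y _)).clm_apply
    (hasFDerivWithinAt_const x y _))
  have h2 := ((hw.hasFDerivWithinAt.const_mul 2).exp).mul
    ((hG.hasFDerivWithinAt_bil.clm_apply (hasFDerivWithinAt_const v y _)).clm_apply
    (hasFDerivWithinAt_const x y _))
  have h3 : (fun z => bil Gt z v x) =ᶠ[𝓝[halfSpace m] y]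
      ((fun z => Real.exp (2 * w z)) * fun z => bil G z v x) := by
    filter_upwards [hc.eventually, self_mem_nhdsWithin] with z hz hz' 
    rw [hz.bil_eq hz']; rfl
  have h4 := h2.congr_of_eventuallyEq h3 (h3.self_of_nhdsWithin hG.mem)
  have h5 := congrArg (fun L : Coord m →L[ℝ] ℝ => L u)
    ((uniqueDiffOn_halfSpace y hG.mem).eq h1 h4)
  simp at h5
  rw [h5]; ring

/-- Subtract the two Koszul formulas after dividing by `exp (2 w)`: only the derivatives of the
factor remain, and one of them is dual to `∇w`. -/
lemma gam_eq (hc : IsConformalAt Gt G w y) (hG : IsMetricAt G y)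
    (hGt : IsMetricAt Gt y) (hw : DifferentiableWithinAt ℝ w (halfSpace m) y) (v x : Coord m) :
    gam Gt y v x = gam G y v x + fderivWithin ℝ w (halfSpace m) y v • x +
      fderivWithin ℝ w (halfSpace m) y x • v - bil G y v x • gradVec G w y := by
  refine hG.ext_bil fun z => ?_
  have h1 := hGt.koszul v x z
  have h2 := hG.koszul v x z
  simp only [hc.bil_eq hG.mem, hc.fderivWithin_bil hG hGt hw, smul_apply, smul_eq_mul] at h1
  simp only [map_add, map_sub, map_smul, add_apply, sub_apply, smul_apply, smul_eq_mul,
    hG.bil_gradVec]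
  refine mul_left_cancel₀ (Real.exp_pos (2 * w y)).ne' ?_
  linear_combination (1 / 2 : ℝ) * h1 - (1 / 2 : ℝ) * Real.exp (2 * w y) * h2

/-- `ric_conformal` with `α = dw` and `N = ∇w`; the dimension is `m + 1`, so `n - 2` appears as `m -
1`. -/
lemma ric_eq (hc : IsConformalAt Gt G w y) (hG : IsMetricAt G y)
    (hGt : IsMetricAt Gt y) (hw : ContDiffWithinAt ℝ 2 w (halfSpace m) y) (v x : Coord m) :
    ric (gam Gt y) (fderivWithin ℝ (gam Gt) (halfSpace m) y) v x =
      ric (gam G y) (fderivWithin ℝ (gam G) (halfSpace m) y) v x -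
      ((m : ℝ) - 1) * (bil G y (cov (gam G y) (gradVec G w y)
        (fderivWithin ℝ (gradVec G w) (halfSpace m) y) v) x -
        fderivWithin ℝ w (halfSpace m) y v * fderivWithin ℝ w (halfSpace m) y x) -
      (laplaceCoord G w y + ((m : ℝ) - 1) * gradPair G w w y) * bil G y v x := by
  have hwev : ∀ᶠ z in 𝓝[halfSpace m] y, DifferentiableWithinAt ℝ w (halfSpace m) z := by
    have := hw.eventually (by simp)
    rw [insert_eq_of_mem hG.mem] at this
    exact this.mono fun z hz => hz.differentiableWithinAt (by norm_num)
  have hdw := hG.hasFDerivWithinAt_fderivWithin hw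
  have h := ric_conformal (Γ := gam G y) (Γt := gam Gt y)
    (dΓ := fderivWithin ℝ (gam G) (halfSpace m) y)
    (dΓt := fderivWithin ℝ (gam Gt) (halfSpace m) y)
    (B := bil G y) (dB := fderivWithin ℝ (bil G) (halfSpace m) y)
    (α := fderivWithin ℝ w (halfSpace m) y)
    (dα := fderivWithin ℝ (fderivWithin ℝ w (halfSpace m)) (halfSpace m) y)
    (N := gradVec G w y) (dN := fderivWithin ℝ (gradVec G w) (halfSpace m) y)
    (hc.gam_eq hG hGt (hw.differentiableWithinAt (by norm_num))) ?_ hG.bil_compat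
    (hG.bil_gradVec w) ?_ (fderivWithin_symm hw hG.mem) hG.gam_symm hG.bil_symm v x
  · rw [h, hG.laplaceCoord_eq hw, finrank_euclideanSpace, Fintype.card_fin, gradPair]
    push_cast; ring
  · intro u v x
    have h1 := hasFDerivWithinAt_apply (hasFDerivWithinAt_apply hGt.hasFDerivWithinAt_gam v) x
    have h2 := (((hasFDerivWithinAt_apply (hasFDerivWithinAt_apply hG.hasFDerivWithinAt_gam v) x).add
      ((hasFDerivWithinAt_apply hdw v).smul_const x)).add ((hasFDerivWithinAt_apply hdw x).smul_const v)).sub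
      ((hasFDerivWithinAt_apply (hasFDerivWithinAt_apply hG.hasFDerivWithinAt_bil v) x).smul (hG.hasFDerivWithinAt_gradVec hw))
    have h3 := h2.congr_of_eventuallyEq (f₁ := fun z => gam Gt z v x) (by
      filter_upwards [hc.eventually, hG.eventually, hGt.eventually, hwev] with z h1 h2 h3 h4
      exact h1.gam_eq h2 h3 h4 v x) (hc.gam_eq hG hGt (hw.differentiableWithinAt (by norm_num)) v x)
    have h5 := congrArg (fun L : Coord m →L[ℝ] Coord m => L u)
      ((uniqueDiffOn_halfSpace y hG.mem).eq h1 h3)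
    simp at h5
    rw [h5]; abel
  · exact hG.fderivWithin_fderivWithin hw

lemma inv_eq (hc : IsConformalAt Gt G w y) (hG : IsMetricAt G y) :
    (Gt y)⁻¹ = Real.exp (-(2 * w y)) • (G y)⁻¹ := by
  rw [hc.self hG.mem]
  refine Matrix.inv_eq_left_inv ?_
  rw [Matrix.smul_mul, Matrix.mul_smul, hG.inv_mul, smul_smul, ← Real.exp_add]
  simp

/-- The scalar curvature of a conformal metric. -/
lemma scalarCoord_eq (hc : IsConformalAt Gt G w y) (hG : IsMetricAt G y)
    (hGt : IsMetricAt Gt y) (hw : ContDiffWithinAt ℝ 2 w (halfSpace m) y) :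
    scalarCoord Gt y = Real.exp (-(2 * w y)) * (scalarCoord G y - 2 * m * laplaceCoord G w y -
      m * (m - 1) * gradPair G w w y) := by
  set L := cov (gam G y) (gradVec G w y) (fderivWithin ℝ (gradVec G w) (halfSpace m) y) with hL
  -- `sum_inv_eq_trace` asks for `⟨T v, x⟩ = b x v` with exchanged arguments, hence the symmetry of
  -- the Hessian.
  have hHs (u v : Coord m) : bil G y (L u) v = bil G y (L v) u := by
    have h1 (u v : Coord m) : fderivWithin ℝ (fderivWithin ℝ w (halfSpace m)) (halfSpace m) y u v =
      bil G y (L u) v + fderivWithin ℝ w (halfSpace m) y (gam G y u v) := by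
      rw [hG.fderivWithin_fderivWithin hw, hG.bil_compat, hG.bil_gradVec, hL, cov_apply, map_add,
        add_apply]
      ring
    have h2 := h1 u v
    rw [fderivWithin_symm hw hG.mem, h1, hG.gam_symm] at h2
    linarith
  have h1 := hG.sum_inv_eq_trace (b := fun v x => - ((m : ℝ) - 1) * (bil G y (L v) x -
        fderivWithin ℝ w (halfSpace m) y v * fderivWithin ℝ w (halfSpace m) y x) -
      (laplaceCoord G w y + ((m : ℝ) - 1) * gradPair G w w y) * bil G y v x)
    (T := -((m : ℝ) - 1) • (L - (fderivWithin ℝ w (halfSpace m) y).toLinearMap.smulRight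
      (gradVec G w y)) - (laplaceCoord G w y + ((m : ℝ) - 1) * gradPair G w w y) • LinearMap.id)
    (by
      intro v x
      simp only [LinearMap.sub_apply, LinearMap.smul_apply, LinearMap.smulRight_apply, map_sub,
        map_smul, sub_apply, smul_apply, smul_eq_mul, hG.bil_gradVec, ContinuousLinearMap.coe_coe,
        LinearMap.id_apply]
      rw [hHs v x, hG.bil_symm v x]; ring)
  simp only [map_sub, map_smul, LinearMap.trace_smulRight, LinearMap.trace_id,
    finrank_euclideanSpace, Fintype.card_fin, hL, ← hG.laplaceCoord_eq hw,
    ContinuousLinearMap.coe_coe, smul_eq_mul] at h1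
  rw [← gradPair] at h1
  simp only [scalarCoord, hGt.ricciCoord_eq, hG.ricciCoord_eq, hc.inv_eq hG, Matrix.smul_apply,
    smul_eq_mul, hc.ric_eq hG hGt hw, mul_assoc, ← Finset.mul_sum]
  congr 1
  simp only [← hL] at *
  have h2 (a b c d : ℝ) : a * (b - c - d) = a * b + a * (-c - d) := by ring
  simp only [h2, Finset.sum_add_distrib]
  simp only [← neg_mul] at *
  rw [h1]
  push_cast
  ring

lemma sqrt_det_eq (hc : IsConformalAt Gt G w y) (hy : y ∈ halfSpace m) :
    √(Gt y).det = Real.exp ((m + 1) * w y) * √(G y).det := by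
  have h1 : Real.exp (2 * w y) ^ (m + 1) = Real.exp ((m + 1) * w y) ^ 2 := by
    rw [← Real.exp_nat_mul, ← Real.exp_nat_mul]; push_cast; ring_nf
  rw [hc.self hy, Matrix.det_smul, Fintype.card_fin, h1, Real.sqrt_mul (sq_nonneg _),
    Real.sqrt_sq (Real.exp_pos _).le]

lemma normalCoord_eq (hc : IsConformalAt Gt G w y) (hG : IsMetricAt G y) (i : Fin (m + 1)) :
    normalCoord Gt i y = Real.exp (-w y) * normalCoord G i y := by
  have h1 : Real.exp (-(2 * w y)) = Real.exp (-w y) ^ 2 := by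
    rw [← Real.exp_nat_mul]; push_cast; ring_nf
  rw [normalCoord, normalCoord, hc.inv_eq hG, Matrix.smul_apply, Matrix.smul_apply, smul_eq_mul,
    smul_eq_mul, h1, Real.sqrt_mul (sq_nonneg _), Real.sqrt_sq (Real.exp_pos _).le]
  have h2 := (Real.sqrt_pos.2 (hG.posDef_self.inv.diag_pos (i := 0))).ne'
  have h3 := (Real.exp_pos (-w y)).ne'
  field_simp

/-- The density scales by `exp ((m + 1) w)` and the unit normal by `exp (-w)`. Their product scales
by `exp (m w)`, and the derivative of this factor is the source of the term with coefficient `m`. -/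
lemma meanCoord_eq (hc : IsConformalAt Gt G w y) (hG : IsMetricAt G y)
    (hw : ContDiffWithinAt ℝ 2 w (halfSpace m) y) :
    meanCoord Gt y = Real.exp (-w y) * (meanCoord G y +
      m * ∑ i, normalCoord G i y * pd i w y) := by
  have hw' := (hw.differentiableWithinAt (by norm_num)).hasFDerivWithinAt
  have h1 (i : Fin (m + 1)) : pd i (fun z => √(Gt z).det * normalCoord Gt i z) y =
      Real.exp (m * w y) * (m * (√(G y).det * normalCoord G i y) * pd i w y +
        pd i (fun z => √(G z).det * normalCoord G i z) y) := by
    have hF : HasFDerivWithinAt (fun z => √(G z).det * normalCoord G i z) _ (halfSpace m) y :=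
      ((hG.contDiff_sqrt_det.mul (hG.contDiff_normalCoord i)).differentiableWithinAt
        (by norm_num)).hasFDerivWithinAt
    have h2 := (hw'.const_mul (m : ℝ)).exp.mul hF
    have h3 := h2.congr_of_eventuallyEq (f₁ := fun z => √(Gt z).det * normalCoord Gt i z) (by
      filter_upwards [hc.eventually, hG.eventually] with z hz hz'
      rw [hz.sqrt_det_eq hz'.mem, hz.normalCoord_eq hz']
      simp only [Pi.mul_apply]
      rw [show (m : ℝ) * w z = (m + 1) * w z + -w z by ring, Real.exp_add]
      ring) (by
      rw [hc.sqrt_det_eq hG.mem, hc.normalCoord_eq hG]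
      simp only [Pi.mul_apply]
      rw [show (m : ℝ) * w y = (m + 1) * w y + -w y by ring, Real.exp_add]
      ring)
    have h5 := congrArg (fun L : Coord m →L[ℝ] ℝ => L (bvec i))
      (h3.fderivWithin (uniqueDiffOn_halfSpace y hG.mem))
    change pd i (fun z => √(Gt z).det * normalCoord Gt i z) y = _ at h5
    rw [h5]
    simp only [add_apply, smul_apply, smul_eq_mul]
    change _ * pd i (fun z => √(G z).det * normalCoord G i z) y + _ * (_ * (_ * pd i w y)) = _
    ring
  rw [meanCoord, divCoord, meanCoord, divCoord, hc.sqrt_det_eq hG.mem]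
  simp only [h1, ← Finset.mul_sum, Finset.sum_add_distrib, mul_assoc]
  rw [show (m : ℝ) * w y = (m + 1) * w y + -w y by ring, Real.exp_add]
  have h2 := (Real.sqrt_pos.2 hG.det_pos).ne'
  have h3 := (Real.exp_pos ((m + 1) * w y)).ne'
  field_simp
  ring

end IsConformalAt

/-- The gradient is `2 exp (-2 w) ∇w`, and its divergence follows from the product rule. This trades
`Δw` for the Laplacian of the weight `1 - μ⁻²` of the rigidity hypothesis. -/
lemma IsMetricAt.laplaceCoord_one_sub_exp (hG : IsMetricAt G y)
    (hw : ContDiffWithinAt ℝ 2 w (halfSpace m) y) :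
    laplaceCoord G (fun z => 1 - Real.exp (-(2 * w z))) y =
      2 * Real.exp (-(2 * w y)) * (laplaceCoord G w y - 2 * gradPair G w w y) := by
  have hwev : ∀ᶠ z in 𝓝[halfSpace m] y, DifferentiableWithinAt ℝ w (halfSpace m) z := by
    have := hw.eventually (by simp)
    rw [insert_eq_of_mem hG.mem] at this
    exact this.mono fun z hz => hz.differentiableWithinAt (by norm_num)
  have hgrad : ∀ z, IsMetricAt G z → DifferentiableWithinAt ℝ w (halfSpace m) z →
      gradVec G (fun z => 1 - Real.exp (-(2 * w z))) z =
        (2 * Real.exp (-(2 * w z))) • gradVec G w z := by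
    intro z hz hwz
    refine hz.ext_bil fun v => ?_
    have h1 := ((hwz.hasFDerivWithinAt.const_mul 2).neg.exp.const_sub 1).fderivWithin
      (uniqueDiffOn_halfSpace z hz.mem)
    rw [hz.bil_gradVec, map_smul, smul_apply, hz.bil_gradVec]
    have h2 := congrArg (fun L : Coord m →L[ℝ] ℝ => L v) h1
    simp at h2
    rw [h2, smul_eq_mul]; ring
  have hd : HasFDerivWithinAt (gradVec G (fun z => 1 - Real.exp (-(2 * w z)))) _
      (halfSpace m) y :=
    ((((hw.differentiableWithinAt (by norm_num)).hasFDerivWithinAt.const_mul 2).neg.exp.const_mul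
      2).smul (hG.hasFDerivWithinAt_gradVec hw)).congr_of_eventuallyEq
      (by filter_upwards [hG.eventually, hwev] with z h1 h2 using hgrad z h1 h2)
      (hgrad y hG (hw.differentiableWithinAt (by norm_num)))
  have h1 : laplaceCoord G (fun z => 1 - Real.exp (-(2 * w z))) y = _ :=
    hG.divCoord_eq (fun _ _ => rfl) hd
  rw [h1, hgrad y hG (hw.differentiableWithinAt (by norm_num)), hG.laplaceCoord_eq hw]
  have h2 : ∀ dN : Coord m →L[ℝ] Coord m, ∀ c : ℝ, ∀ α : Coord m →L[ℝ] ℝ,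
      cov (gam G y) (c • gradVec G w y) (c • dN + α.smulRight (gradVec G w y)) =
      c • cov (gam G y) (gradVec G w y) dN + α.toLinearMap.smulRight (gradVec G w y) := by
    intro dN c α
    ext u
    simp [cov_apply]
    ring
  simp only [Pi.neg_apply]
  rw [h2]
  simp only [map_add, map_smul, LinearMap.trace_smulRight, gradPair]
  simp
  ring

/-! ### Metrics and functions in the charts of the manifold -/

section Charts

variable {m : ℕ} {M : Type*} [TopologicalSpace M] [ChartedSpace (EuclideanHalfSpace (m + 1)) M]
  [IsManifold (𝓡∂ (m + 1)) ∞ M]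

variable (m) in
/-- The chart around `a`. -/
abbrev crd (a : M) : PartialEquiv M (Coord m) := extChartAt (𝓡∂ (m + 1)) a

omit [IsManifold (𝓡∂ (m + 1)) ∞ M] in
lemma crd_target_mem_nhdsWithin {a : M} {y : Coord m} (hy : y ∈ (crd m a).target) :
    (crd m a).target ∈ 𝓝[halfSpace m] y :=
  extChartAt_target_mem_nhdsWithin_of_mem hy

omit [IsManifold (𝓡∂ (m + 1)) ∞ M] in
lemma crd_target_subset (a : M) : (crd m a).target ⊆ halfSpace m := extChartAt_target_subset_range a

/-- The coordinate frame of the chart around `a`, at `p`. -/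
def frame (a p : M) : Coord m →L[ℝ] TangentSpace (𝓡∂ (m + 1)) p :=
  (trivializationAt (Coord m) (TangentSpace (𝓡∂ (m + 1))) a).symmL ℝ p

/-- Identifies the coordinate vectors behind `gram` with the trivialization of the tangent bundle,
where smoothness and the cocycle rule are available. -/
lemma coordVec_eq {a : M} {y : Coord m} (hy : y ∈ (crd m a).target) (i : Fin (m + 1)) :
    coordVec m a y i = frame a ((crd m a).symm y) (bvec i) := by
  have h1 : (crd m a).symm y ∈ (chartAt (EuclideanHalfSpace (m + 1)) a).source := by
    rw [← extChartAt_source (𝓡∂ (m + 1))]; exact (crd m a).map_target hy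
  have h2 := TangentBundle.symmL_trivializationAt (I := 𝓡∂ (m + 1)) h1
  unfold frame
  rw [h2]
  unfold coordVec
  rw [(crd m a).right_inv hy]
  rfl

/-- The cocycle rule of the tangent bundle: the derivative of the transition map relates the frames
of two charts. -/
lemma frame_change {a b p : M} (ha : p ∈ (crd m a).source) (hb : p ∈ (crd m b).source)
    (v : Coord m) : frame a p v =
      frame b p (fderivWithin ℝ (crd m b ∘ (crd m a).symm) (halfSpace m) (crd m a p) v) := by
  have ha' := ha
  have hb' := hb
  rw [extChartAt_source] at ha' hb'
  unfold frame
  rw [TangentBundle.symmL_trivializationAt_eq_core ha',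
    TangentBundle.symmL_trivializationAt_eq_core hb']
  exact (tangentCoordChange_comp (I := 𝓡∂ (m + 1)) (w := a) (x := b) (y := p) (z := p)
    ⟨⟨ha, hb⟩, mem_extChartAt_source p⟩).symm

lemma frame_injective {a p : M} (ha : p ∈ (crd m a).source) :
    Function.Injective (frame (m := m) a p) := by
  intro v w hvw
  have h := congrArg ((trivializationAt (Coord m) (TangentSpace (𝓡∂ (m + 1)))
    a).continuousLinearMapAt ℝ p) hvw
  rw [extChartAt_source] at ha
  have hb : p ∈ (trivializationAt (Coord m) (TangentSpace (𝓡∂ (m + 1))) a).baseSet := ha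
  unfold frame at h
  rwa [Bundle.Trivialization.continuousLinearMapAt_symmL _ hb,
    Bundle.Trivialization.continuousLinearMapAt_symmL _ hb] at h

lemma bil_gram (g : Metric m M) {a : M} {y : Coord m} (hy : y ∈ (crd m a).target)
    (v w : Coord m) : bil (gram g a) y v w = g.inner ((crd m a).symm y)
      (frame a ((crd m a).symm y) v) (frame a ((crd m a).symm y) w) := by
  rw [bil_apply]
  conv_rhs => rw [← sum_bvec v, ← sum_bvec w]
  simp only [map_sum, map_smul, sum_apply, smul_apply, smul_eq_mul, gram, Matrix.of_apply,
    coordVec_eq hy, Finset.mul_sum]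
  rw [Finset.sum_comm]
  refine Finset.sum_congr rfl fun i _ => Finset.sum_congr rfl fun j _ => ?_
  ring

lemma contMDiffOn_frame (a : M) (v : Coord m) :
    ContMDiffOn (𝓡∂ (m + 1)) ((𝓡∂ (m + 1)).prod 𝓘(ℝ, Coord m)) ∞
      (fun p : M => Bundle.TotalSpace.mk' (Coord m)
        (E := fun x : M => TangentSpace (𝓡∂ (m + 1)) x) p (frame a p v)) (crd m a).source := by
  rw [extChartAt_source]
  refine (Bundle.Trivialization.contMDiffOn_section_baseSet_iff (IB := 𝓡∂ (m + 1)) (n := ∞)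
    (trivializationAt (Coord m) (TangentSpace (𝓡∂ (m + 1))) a) (s := fun p => frame a p v)).2
    ((contMDiffOn_const (c := v)).congr fun p hp => ?_)
  have h := Bundle.Trivialization.continuousLinearMapAt_symmL (R := ℝ)
    (trivializationAt (Coord m) (TangentSpace (𝓡∂ (m + 1))) a) hp v
  rwa [Bundle.Trivialization.continuousLinearMapAt_apply,
    Bundle.Trivialization.linearMapAt_apply, if_pos hp] at h

lemma contDiff_gram (g : Metric m M) {a : M} {y : Coord m} (hy : y ∈ (crd m a).target)
    (i j : Fin (m + 1)) :
    ContDiffWithinAt ℝ ∞ (fun z => gram g a z i j) (halfSpace m) y := by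
  have h1 : ContMDiffOn (𝓡∂ (m + 1)) 𝓘(ℝ, ℝ) ∞
      (fun p : M => g.inner p (frame a p (bvec i)) (frame a p (bvec j))) (crd m a).source := by
    intro p hp
    have h := ContMDiffOn.clm_bundle_apply₂ (F₁ := Coord m) (F₂ := Coord m) (F₃ := ℝ)
      (E₃ := fun _ : M => ℝ) (b := fun p : M => p)
      (E₁ := fun x : M => TangentSpace (𝓡∂ (m + 1)) x)
      (E₂ := fun x : M => TangentSpace (𝓡∂ (m + 1)) x) (n := ∞) (IB := 𝓡∂ (m + 1))
      (IM := 𝓡∂ (m + 1)) g.contMDiff.contMDiffOn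
      (contMDiffOn_frame a (bvec i)) (contMDiffOn_frame a (bvec j)) p hp
    rw [Bundle.contMDiffWithinAt_totalSpace] at h
    exact h.2
  have h2 := h1.comp (contMDiffOn_extChartAt_symm (I := 𝓡∂ (m + 1)) (n := ∞) a)
    (fun z hz => (crd m a).map_target hz)
  have h3 := (contMDiffOn_iff_contDiffOn.1 h2 y hy).mono_of_mem_nhdsWithin
    (crd_target_mem_nhdsWithin hy)
  refine h3.congr_of_eventuallyEq ?_ ?_
  · filter_upwards [crd_target_mem_nhdsWithin hy] with z hz
    simp only [Function.comp_apply, gram, Matrix.of_apply, coordVec_eq hz]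
  · simp only [Function.comp_apply, gram, Matrix.of_apply, coordVec_eq hy]

lemma posDef_gram (g : Metric m M) {a : M} {y : Coord m} (hy : y ∈ (crd m a).target) :
    (gram g a y).PosDef := by
  refine Matrix.PosDef.of_dotProduct_mulVec_pos ?_ fun x hx => ?_
  · ext i j
    exact g.symm _ _ _
  · have h1 : star x ⬝ᵥ (gram g a y).mulVec x =
        bil (gram g a) y (WithLp.toLp 2 x) (WithLp.toLp 2 x) := by
      simp only [bil_apply, dotProduct, Matrix.mulVec, Finset.mul_sum]
      exact Finset.sum_congr rfl fun i _ => Finset.sum_congr rfl fun j _ => by simp; ring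
    rw [h1, bil_gram g hy]
    refine g.pos _ _ fun h0 => hx ?_
    have h2 := frame_injective ((crd m a).map_target hy) (h0.trans (map_zero _).symm)
    ext i
    exact congrArg (fun v : Coord m => v i) h2

lemma isMetricAt_gram (g : Metric m M) {a : M} {y : Coord m} (hy : y ∈ (crd m a).target) :
    IsMetricAt (gram g a) y where
  mem := crd_target_subset a hy
  contDiff i j := (contDiff_gram g hy i j).of_le (mod_cast ENat.LEInfty.out)
  posDef := by
    filter_upwards [crd_target_mem_nhdsWithin hy] with z hz using posDef_gram g hz

end Charts

/-! ### Continuity of the coordinate expressions. -/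

section Continuity

variable {m : ℕ} {G : Coord m → Matrix (Fin (m + 1)) (Fin (m + 1)) ℝ} {y : Coord m}
  {h k : Coord m → ℝ}

namespace IsMetricAt

lemma continuousWithinAt_scalarCoord (hG : IsMetricAt G y) :
    ContinuousWithinAt (scalarCoord G) (halfSpace m) y := by
  have hp (a k i j) : ContinuousWithinAt (pd a (christoffel G k i j)) (halfSpace m) y :=
    (contDiff_pd (l := 0) (hG.contDiff_christoffel k i j) (by norm_num) hG.mem a).continuousWithinAt
  have hc (k i j) : ContinuousWithinAt (christoffel G k i j) (halfSpace m) y :=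
    (hG.contDiff_christoffel k i j).continuousWithinAt
  refine tendsto_finsetSum _ fun j _ => tendsto_finsetSum _ fun k _ =>
    (hG.contDiff_inv j k).continuousWithinAt.mul (ContinuousWithinAt.add ?_ ?_)
  · exact tendsto_finsetSum _ fun i _ => (hp _ _ _ _).sub (hp _ _ _ _)
  · exact tendsto_finsetSum _ fun i _ => tendsto_finsetSum _ fun l _ =>
      ((hc _ _ _).mul (hc _ _ _)).sub ((hc _ _ _).mul (hc _ _ _))

lemma contDiff_gradCoord (hG : IsMetricAt G y) {n : WithTop ℕ∞} (hn : n ≤ 2)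
    (hh : ContDiffWithinAt ℝ (n + 1) h (halfSpace m) y) (i : Fin (m + 1)) :
    ContDiffWithinAt ℝ n (gradCoord G h i) (halfSpace m) y :=
  ContDiffWithinAt.sum fun j _ => ((hG.contDiff_inv i j).of_le hn).mul
    (contDiff_pd hh le_rfl hG.mem j)

lemma continuousWithinAt_laplaceCoord (hG : IsMetricAt G y)
    (hh : ContDiffWithinAt ℝ 2 h (halfSpace m) y) :
    ContinuousWithinAt (laplaceCoord G h) (halfSpace m) y := by
  refine ContinuousWithinAt.mul (hG.contDiff_sqrt_det.continuousWithinAt.inv₀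
    (Real.sqrt_pos.2 hG.det_pos).ne') (tendsto_finsetSum _ fun i _ => ?_)
  exact (contDiff_pd (l := 0) (k := 1) ((hG.contDiff_sqrt_det.of_le (by norm_num)).mul
    (hG.contDiff_gradCoord (n := 1) (by norm_num) (by simpa [one_add_one_eq_two] using hh) i))
    (by norm_num) hG.mem i).continuousWithinAt

lemma continuousWithinAt_gradPair (hG : IsMetricAt G y)
    (hh : ContDiffWithinAt ℝ 1 h (halfSpace m) y) (hk : ContDiffWithinAt ℝ 1 k (halfSpace m) y) :
    ContinuousWithinAt (gradPair G h k) (halfSpace m) y := by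
  have : gradPair G h k = fun y => ∑ i, gradCoord G k i y * pd i h y := by
    funext y; exact gradPair_eq_sum h k
  rw [this]
  exact tendsto_finsetSum _ fun i _ =>
    (hG.contDiff_gradCoord (n := 0) (by norm_num) (by simpa using hk) i).continuousWithinAt.mul
      (contDiff_pd (l := 0) hh (by norm_num) hG.mem i).continuousWithinAt

end IsMetricAt

end Continuity

/-! ### Independence of the chart, and the conformal identities on the manifold. -/

section Charts

variable {m : ℕ} {M : Type*} [TopologicalSpace M] [ChartedSpace (EuclideanHalfSpace (m + 1)) M]

lemma one_le_infty : (1 : WithTop ℕ∞) ≤ ∞ := by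
  exact_mod_cast (le_top : (1 : ℕ∞) ≤ ⊤)

lemma eventually_overlap {a b : M} {y : Coord m} (hy : y ∈ (crd m a).target)
    (hb : (crd m a).symm y ∈ (crd m b).source) :
    ∀ᶠ z in 𝓝[halfSpace m] y, z ∈ (crd m a).target ∧ (crd m a).symm z ∈ (crd m b).source := by
  have h1 : ContinuousWithinAt (crd m a).symm (halfSpace m) y :=
    (continuousAt_extChartAt_symm'' hy).continuousWithinAt
  filter_upwards [crd_target_mem_nhdsWithin hy,
    h1.eventually ((isOpen_extChartAt_source b).mem_nhds hb)] with z hz hz' using ⟨hz, hz'⟩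

lemma comp_symm_eventuallyEq {a b : M} {y : Coord m} (hy : y ∈ (crd m a).target)
    (hb : (crd m a).symm y ∈ (crd m b).source) (h : M → ℝ) :
    h ∘ (crd m a).symm =ᶠ[𝓝[halfSpace m] y]
      (h ∘ (crd m b).symm) ∘ (crd m b ∘ (crd m a).symm) := by
  filter_upwards [eventually_overlap hy hb] with z hz
  simp only [Function.comp_apply]
  rw [(crd m b).left_inv hz.2]

variable [IsManifold (𝓡∂ (m + 1)) ∞ M]

lemma contDiffWithinAt_comp_symm {n : WithTop ℕ∞} (hn : n ≤ ∞) {h : M → ℝ} {a p : M}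
    (hp : p ∈ (crd m a).source) (hh : ContMDiffAt (𝓡∂ (m + 1)) 𝓘(ℝ, ℝ) n h p) :
    ContDiffWithinAt ℝ n (h ∘ (crd m a).symm) (halfSpace m) (crd m a p) := by
  have h1 := (contMDiffOn_extChartAt_symm (I := 𝓡∂ (m + 1)) (n := ∞) (M := M) a
    (crd m a p) ((crd m a).map_source hp)).of_le hn
  have h2 : ContMDiffAt (𝓡∂ (m + 1)) 𝓘(ℝ, ℝ) n h ((crd m a).symm (crd m a p)) := by
    rwa [(crd m a).left_inv hp]
  have h3 := ContMDiffAt.comp_contMDiffWithinAt _ h2 h1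
  exact (contMDiffWithinAt_iff_contDiffWithinAt.1 h3).mono_of_mem_nhdsWithin
    (crd_target_mem_nhdsWithin ((crd m a).map_source hp))

lemma frame_bijective {a b : M} {y : Coord m} (hy : y ∈ (crd m a).target)
    (hb : (crd m a).symm y ∈ (crd m b).source) : Function.Bijective
      (fderivWithin ℝ (crd m b ∘ (crd m a).symm) (halfSpace m) y) := by
  have h1 : Function.Injective
      (fderivWithin ℝ (crd m b ∘ (crd m a).symm) (halfSpace m) y) := by
    intro v w hvw
    have h2 := (crd m a).map_target hy
    refine frame_injective h2 ?_
    rw [frame_change h2 hb, frame_change h2 hb, (crd m a).right_inv hy, hvw]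
  exact ⟨h1, LinearMap.injective_iff_surjective (f := (fderivWithin ℝ (crd m b ∘ (crd m a).symm)
    (halfSpace m) y).toLinearMap) |>.1 h1⟩

lemma isChangeAt_crd {a b : M} {y : Coord m} (hy : y ∈ (crd m a).target)
    (hb : (crd m a).symm y ∈ (crd m b).source) :
    IsChangeAt (crd m b ∘ (crd m a).symm) y where
  mem := crd_target_subset a hy
  contDiff := contDiffWithinAt_ext_coord_change (n := ∞) b a
    (by rw [PartialEquiv.trans_source]; exact ⟨hy, hb⟩) |>.of_le (mod_cast ENat.LEInfty.out)
  maps := by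
    filter_upwards [eventually_overlap hy hb] with z hz
    exact crd_target_subset b ((crd m b).map_source hz.2)
  bij := by
    filter_upwards [eventually_overlap hy hb] with z hz using frame_bijective hz.1 hz.2

lemma isPullbackAt_gram (g : Metric m M) {a b : M} {y : Coord m} (hy : y ∈ (crd m a).target)
    (hb : (crd m a).symm y ∈ (crd m b).source) :
    IsPullbackAt (gram g a) (gram g b) (crd m b ∘ (crd m a).symm) y := by
  filter_upwards [eventually_overlap hy hb] with z hz v w
  have h1 := (crd m a).map_target hz.1
  rw [bil_gram g hz.1, frame_change h1 hz.2, frame_change h1 hz.2, (crd m a).right_inv hz.1,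
    Function.comp_apply, bil_gram g ((crd m b).map_source hz.2), (crd m b).left_inv hz.2]

/-- The definition changes the chart with the point. With one chart for all nearby points,
continuity can be discussed. -/
lemma scalarCurvature_eq (g : Metric m M) {a p : M} (hp : p ∈ (crd m a).source) :
    scalarCurvature g p = scalarCoord (gram g a) (crd m a p) := by
  have hy := (crd m a).map_source hp
  have hb : (crd m a).symm (crd m a p) ∈ (crd m p).source := by
    rw [(crd m a).left_inv hp]; exact mem_extChartAt_source p
  have he : (crd m p ∘ (crd m a).symm) (crd m a p) = crd m p p := by
    rw [Function.comp_apply, (crd m a).left_inv hp]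
  have hG : IsMetricAt (gram g p) ((crd m p ∘ (crd m a).symm) (crd m a p)) := by
    rw [he]; exact isMetricAt_gram g (mem_extChartAt_target p)
  rw [scalarCurvature, (isPullbackAt_gram g hy hb).scalarCoord_eq (isChangeAt_crd hy hb)
    (isMetricAt_gram g hy) hG, he]

/-- The pairing `⟨∇h, ∇k⟩` of the gradients of two functions. -/
def gradDot (g : Metric m M) (h k : M → ℝ) (p : M) : ℝ :=
  gradPair (gram g p) (h ∘ (crd m p).symm) (k ∘ (crd m p).symm) (crd m p p)

lemma laplacian_eq (g : Metric m M) {h : M → ℝ} {a p : M} (hp : p ∈ (crd m a).source)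
    (hh : ContMDiffAt (𝓡∂ (m + 1)) 𝓘(ℝ, ℝ) 2 h p) :
    laplacian g h p = laplaceCoord (gram g a) (h ∘ (crd m a).symm) (crd m a p) := by
  have hy := (crd m a).map_source hp
  have hb : (crd m a).symm (crd m a p) ∈ (crd m p).source := by
    rw [(crd m a).left_inv hp]; exact mem_extChartAt_source p
  have he : (crd m p ∘ (crd m a).symm) (crd m a p) = crd m p p := by
    rw [Function.comp_apply, (crd m a).left_inv hp]
  have hG : IsMetricAt (gram g p) ((crd m p ∘ (crd m a).symm) (crd m a p)) := by
    rw [he]; exact isMetricAt_gram g (mem_extChartAt_target p)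
  have hh' := contDiffWithinAt_comp_symm (mod_cast ENat.LEInfty.out) (mem_extChartAt_source p) hh
  rw [← he] at hh'
  rw [laplacian, (isPullbackAt_gram g hy hb).laplaceCoord_eq (isChangeAt_crd hy hb)
    (isMetricAt_gram g hy) hG hh' (comp_symm_eventuallyEq hy hb h), he]

lemma gradDot_eq (g : Metric m M) {h k : M → ℝ} {a p : M} (hp : p ∈ (crd m a).source)
    (hh : ContMDiffAt (𝓡∂ (m + 1)) 𝓘(ℝ, ℝ) 1 h p) (hk : ContMDiffAt (𝓡∂ (m + 1)) 𝓘(ℝ, ℝ) 1 k p) :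
    gradDot g h k p =
      gradPair (gram g a) (h ∘ (crd m a).symm) (k ∘ (crd m a).symm) (crd m a p) := by
  have hy := (crd m a).map_source hp
  have hb : (crd m a).symm (crd m a p) ∈ (crd m p).source := by
    rw [(crd m a).left_inv hp]; exact mem_extChartAt_source p
  have he : (crd m p ∘ (crd m a).symm) (crd m a p) = crd m p p := by
    rw [Function.comp_apply, (crd m a).left_inv hp]
  have hG : IsMetricAt (gram g p) ((crd m p ∘ (crd m a).symm) (crd m a p)) := by
    rw [he]; exact isMetricAt_gram g (mem_extChartAt_target p)
  have hh' := (contDiffWithinAt_comp_symm one_le_infty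
    (mem_extChartAt_source p) hh).differentiableWithinAt (by norm_num)
  have hk' := (contDiffWithinAt_comp_symm one_le_infty
    (mem_extChartAt_source p) hk).differentiableWithinAt (by norm_num)
  rw [← he] at hh' hk'
  rw [gradDot, (isPullbackAt_gram g hy hb).gradPair_eq (isChangeAt_crd hy hb)
    (isMetricAt_gram g hy) hG hh' hk' (comp_symm_eventuallyEq hy hb h)
    (comp_symm_eventuallyEq hy hb k), he]

omit [IsManifold (𝓡∂ (m + 1)) ∞ M] in
lemma continuousAt_of_crd {F : M → ℝ} {a : M} {Φ : Coord m → ℝ}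
    (h : ∀ p ∈ (crd m a).source, F p = Φ (crd m a p)) {p : M} (hp : p ∈ (crd m a).source)
    (hΦ : ContinuousWithinAt Φ (halfSpace m) (crd m a p)) : ContinuousAt F p := by
  have h1 : Tendsto (crd m a) (𝓝 p) (𝓝[halfSpace m] (crd m a p)) := by
    refine tendsto_nhdsWithin_iff.2 ⟨continuousAt_extChartAt' hp, ?_⟩
    filter_upwards [(isOpen_extChartAt_source a).mem_nhds hp] with q hq
    exact crd_target_subset a ((crd m a).map_source hq)
  have h2 : Tendsto (Φ ∘ crd m a) (𝓝 p) (𝓝 (Φ (crd m a p))) := hΦ.tendsto.comp h1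
  rw [← h p hp] at h2
  refine h2.congr' ?_
  filter_upwards [(isOpen_extChartAt_source a).mem_nhds hp] with q hq using (h q hq).symm

lemma continuous_scalarCurvature (g : Metric m M) : Continuous (scalarCurvature g) :=
  continuous_iff_continuousAt.2 fun p => continuousAt_of_crd (a := p)
    (fun _ hq => scalarCurvature_eq g hq) (mem_extChartAt_source p)
    (isMetricAt_gram g (mem_extChartAt_target p)).continuousWithinAt_scalarCoord

lemma continuous_laplacian (g : Metric m M) {h : M → ℝ}
    (hh : ContMDiff (𝓡∂ (m + 1)) 𝓘(ℝ, ℝ) 2 h) : Continuous (laplacian g h) :=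
  continuous_iff_continuousAt.2 fun p => continuousAt_of_crd (a := p)
    (fun _ hq => laplacian_eq g hq (hh _)) (mem_extChartAt_source p)
    ((isMetricAt_gram g (mem_extChartAt_target p)).continuousWithinAt_laplaceCoord
      (contDiffWithinAt_comp_symm (mod_cast ENat.LEInfty.out) (mem_extChartAt_source p) (hh p)))

lemma continuous_gradDot (g : Metric m M) {h k : M → ℝ}
    (hh : ContMDiff (𝓡∂ (m + 1)) 𝓘(ℝ, ℝ) 1 h) (hk : ContMDiff (𝓡∂ (m + 1)) 𝓘(ℝ, ℝ) 1 k) :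
    Continuous (gradDot g h k) :=
  continuous_iff_continuousAt.2 fun p => continuousAt_of_crd (a := p)
    (fun _ hq => gradDot_eq g hq (hh _) (hk _)) (mem_extChartAt_source p)
    ((isMetricAt_gram g (mem_extChartAt_target p)).continuousWithinAt_gradPair
      (contDiffWithinAt_comp_symm one_le_infty (mem_extChartAt_source p) (hh p))
      (contDiffWithinAt_comp_symm one_le_infty (mem_extChartAt_source p) (hk p)))

/-- The curvature identity behind the rigidity theorem. -/
lemma scalarCurvature_conformal {g₀ g : Metric m M} {w : M → ℝ}
    (hw : ContMDiff (𝓡∂ (m + 1)) 𝓘(ℝ, ℝ) 2 w)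
    (hg : ∀ (x : M) (v v' : TangentSpace (𝓡∂ (m + 1)) x),
      g.inner x v v' = Real.exp (2 * w x) * g₀.inner x v v') (p : M) :
    scalarCurvature g p - scalarCurvature g₀ p =
      -(1 - Real.exp (-(2 * w p))) * scalarCurvature g₀ p -
        m * laplacian g₀ (fun x => 1 - Real.exp (-(2 * w x))) p -
        m * (m + 3) * Real.exp (-(2 * w p)) * gradDot g₀ w w p := by
  have hG₀ := isMetricAt_gram g₀ (mem_extChartAt_target (I := 𝓡∂ (m + 1)) p)
  have hG := isMetricAt_gram g (mem_extChartAt_target (I := 𝓡∂ (m + 1)) p)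
  have hc : IsConformalAt (gram g p) (gram g₀ p) (w ∘ (crd m p).symm) (crd m p p) :=
    Eventually.of_forall fun z => by
      ext i j
      exact hg _ _ _
  have hw' : ContDiffWithinAt ℝ 2 (w ∘ (crd m p).symm) (halfSpace m) (crd m p p) :=
    contDiffWithinAt_comp_symm (mod_cast ENat.LEInfty.out) (mem_extChartAt_source p) (hw p)
  have h1 := hc.scalarCoord_eq hG₀ hG hw'
  have h2 := hG₀.laplaceCoord_one_sub_exp hw'
  have h3 : (w ∘ (crd m p).symm) (crd m p p) = w p := by
    rw [Function.comp_apply, (crd m p).left_inv (mem_extChartAt_source p)]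
  rw [h3] at h1 h2
  have h4 : laplacian g₀ (fun x => 1 - Real.exp (-(2 * w x))) p = _ := h2
  rw [h4]
  unfold scalarCurvature gradDot
  -- Replacing `-2 m Δw` by the Laplacian of `1 - exp (-2 w)` costs `4 m` gradient terms; `m (m - 1)
  -- + 4 m = m (m + 3)`.
  rw [h1]
  ring

/-- The change of the mean curvature where the conformal factor is `1`. -/
lemma meanCurvature_conformal {g₀ g : Metric m M} {w : M → ℝ}
    (hw : ContMDiff (𝓡∂ (m + 1)) 𝓘(ℝ, ℝ) 2 w)
    (hg : ∀ (x : M) (v v' : TangentSpace (𝓡∂ (m + 1)) x),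
      g.inner x v v' = Real.exp (2 * w x) * g₀.inner x v v') (p : M) (hp : w p = 0) :
    meanCurvature g p - meanCurvature g₀ p =
      m * ∑ i, normalCoord (gram g₀ p) i (crd m p p) *
        pd i (w ∘ (crd m p).symm) (crd m p p) := by
  have hG₀ := isMetricAt_gram g₀ (mem_extChartAt_target (I := 𝓡∂ (m + 1)) p)
  have hc : IsConformalAt (gram g p) (gram g₀ p) (w ∘ (crd m p).symm) (crd m p p) :=
    Eventually.of_forall fun z => by
      ext i j
      exact hg _ _ _
  have hw' : ContDiffWithinAt ℝ 2 (w ∘ (crd m p).symm) (halfSpace m) (crd m p p) :=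
    contDiffWithinAt_comp_symm (mod_cast ENat.LEInfty.out) (mem_extChartAt_source p) (hw p)
  have h1 := hc.meanCoord_eq hG₀ hw'
  have h3 : (w ∘ (crd m p).symm) (crd m p p) = w p := by
    rw [Function.comp_apply, (crd m p).left_inv (mem_extChartAt_source p)]
  rw [h3, hp, neg_zero, Real.exp_zero, one_mul] at h1
  unfold meanCurvature
  rw [h1]
  ring

end Charts

/-! ### Measures given by compatible densities in parametrizations -/

/-- A family of parametrizations of parts of `M` with compatible densities. -/
structure ParamFamily (E M ι : Type*) [NormedAddCommGroup E] [NormedSpace ℝ E] [MeasurableSpace E]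
    [MeasurableSpace M] (μ : Measure E) where
  e : ι → E → M
  c : ι → M → E
  Q : ι → Set E
  r : ι → E → ℝ
  measurableSet_Q : ∀ a, MeasurableSet (Q a)
  measurable_e : ∀ a, Measurable ((Q a).domRestrict (e a))
  measurableSet_image : ∀ a, MeasurableSet (e a '' Q a)
  left_inv : ∀ a, ∀ y ∈ Q a, c a (e a y) = y
  aemeasurable_r : ∀ a, AEMeasurable (r a) (μ.restrict (Q a))
  r_nonneg : ∀ a, ∀ y ∈ Q a, 0 ≤ r a y
  transition : ∀ a b, ∀ y ∈ Q a, e a y ∈ e b '' Q b → ∃ τ' : E →L[ℝ] E,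
    HasFDerivWithinAt (c b ∘ e a) τ' (Q a ∩ e a ⁻¹' (e b '' Q b)) y ∧
      r a y = |τ'.det| * r b (c b (e a y))

namespace ParamFamily

variable {E M ι : Type*} [NormedAddCommGroup E] [NormedSpace ℝ E] [FiniteDimensional ℝ E]
  [MeasurableSpace E] [BorelSpace E] [MeasurableSpace M] {μ : Measure E} [μ.IsAddHaarMeasure]
  (P : ParamFamily E M ι μ)

/-- The measure of one parametrization. -/
def part (a : ι) : Measure M :=
  ((μ.restrict (P.Q a)).withDensity fun y => ENNReal.ofReal (P.r a y)).map (P.e a)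

/-- The measure of the family. -/
def total : Measure M := ⨆ a, P.part a

omit [FiniteDimensional ℝ E] [BorelSpace E] [μ.IsAddHaarMeasure] in
lemma measurableSet_preimage (a : ι) {S : Set M} (hS : MeasurableSet S) :
    MeasurableSet (P.e a ⁻¹' S ∩ P.Q a) := by
  have := (P.measurableSet_Q a).subtype_image (P.measurable_e a hS)
  convert this using 1
  ext y
  simp only [mem_inter_iff, mem_preimage, mem_image, Subtype.exists]
  constructor
  · rintro ⟨h1, h2⟩; exact ⟨y, h2, h1, rfl⟩
  · rintro ⟨z, h2, h1, rfl⟩; exact ⟨h1, h2⟩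

omit [FiniteDimensional ℝ E] [BorelSpace E] [μ.IsAddHaarMeasure] in
lemma aemeasurable_e (a : ι) : AEMeasurable (P.e a) (μ.restrict (P.Q a)) :=
  (aemeasurable_restrict_iff_comap_subtype (P.measurableSet_Q a)).2 (P.measurable_e a).aemeasurable

omit [FiniteDimensional ℝ E] [BorelSpace E] [μ.IsAddHaarMeasure] in
lemma aemeasurable_e' (a : ι) : AEMeasurable (P.e a)
    ((μ.restrict (P.Q a)).withDensity fun y => ENNReal.ofReal (P.r a y)) :=
  (P.aemeasurable_e a).mono_ac (withDensity_absolutelyContinuous _ _)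

omit [FiniteDimensional ℝ E] [BorelSpace E] [μ.IsAddHaarMeasure] in
lemma part_apply [SFinite μ] (a : ι) {S : Set M} (hS : MeasurableSet S) :
    P.part a S = ∫⁻ y in P.e a ⁻¹' S ∩ P.Q a, ENNReal.ofReal (P.r a y) ∂μ := by
  rw [part, Measure.map_apply_of_aemeasurable (P.aemeasurable_e' a) hS, withDensity_apply',
    Measure.restrict_restrict' (P.measurableSet_Q a)]

omit [FiniteDimensional ℝ E] [BorelSpace E] [μ.IsAddHaarMeasure] in
lemma right_inv (a : ι) {p : M} (hp : p ∈ P.e a '' P.Q a) : P.e a (P.c a p) = p := by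
  obtain ⟨y, hy, rfl⟩ := hp
  rw [P.left_inv a y hy]

/-- Change of variables by the transition map; the field `transition` says exactly that the Jacobian
matches the densities. -/
lemma part_eq_part (a b : ι) {S : Set M} (hS : MeasurableSet S) (ha : S ⊆ P.e a '' P.Q a)
    (hb : S ⊆ P.e b '' P.Q b) : P.part a S = P.part b S := by
  rw [P.part_apply a hS, P.part_apply b hS]
  set T := P.e a ⁻¹' S ∩ P.Q a with hT
  have h1 : (P.c b ∘ P.e a) '' T = P.e b ⁻¹' S ∩ P.Q b := by
    ext z
    constructor
    · rintro ⟨y, ⟨hy1, hy2⟩, rfl⟩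
      have h2 := P.right_inv b (hb hy1)
      refine ⟨by simpa [h2] using hy1, ?_⟩
      obtain ⟨y', hy', he⟩ := hb hy1
      simpa [← he, P.left_inv b y' hy'] using hy'
    · rintro ⟨hz1, hz2⟩
      obtain ⟨y, hy, he⟩ := ha hz1
      exact ⟨y, ⟨by simpa [he] using hz1, hy⟩, by simp [he, P.left_inv b z hz2]⟩
  have hinj : InjOn (P.c b ∘ P.e a) T := by
    rintro y ⟨hy1, hy2⟩ z ⟨hz1, hz2⟩ h
    have h2 := congrArg (P.e b) h
    simp only [Function.comp_apply] at h2
    rw [P.right_inv b (hb hy1), P.right_inv b (hb hz1)] at h2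
    rw [← P.left_inv a y hy2, h2, P.left_inv a z hz2]
  have hex : ∀ y, ∃ τ' : E →L[ℝ] E, y ∈ T → HasFDerivWithinAt (P.c b ∘ P.e a) τ' T y ∧
      P.r a y = |τ'.det| * P.r b (P.c b (P.e a y)) := by
    intro y
    by_cases hy : y ∈ T
    · obtain ⟨τ', h2, h3⟩ := P.transition a b y hy.2 (hb hy.1)
      exact ⟨τ', fun _ => ⟨h2.mono fun z hz => ⟨hz.2, hb hz.1⟩, h3⟩⟩
    · exact ⟨0, fun h => absurd h hy⟩
  choose τ' hτ' using hex
  have hTm := P.measurableSet_preimage a hS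
  rw [← h1, lintegral_image_eq_lintegral_abs_det_fderiv_mul μ hTm (fun y hy => (hτ' y hy).1) hinj]
  refine setLIntegral_congr_fun hTm fun y hy => ?_
  simp only [Function.comp_apply]
  rw [(hτ' y hy).2, ENNReal.ofReal_mul (abs_nonneg _)]

omit [FiniteDimensional ℝ E] [BorelSpace E] [μ.IsAddHaarMeasure] in
lemma part_compl [SFinite μ] (a : ι) : P.part a (P.e a '' P.Q a)ᶜ = 0 := by
  rw [P.part_apply a (P.measurableSet_image a).compl]
  have : P.e a ⁻¹' (P.e a '' P.Q a)ᶜ ∩ P.Q a = ∅ := by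
    ext y
    simp only [mem_inter_iff, mem_preimage, mem_compl_iff, mem_empty_iff_false, iff_false, not_and]
    exact fun h1 h2 => h1 ⟨y, h2, rfl⟩
  rw [this]; simp

/-- Compatibility on overlaps makes the supremum of the measures restrict to each of them, so all
integrals of functions supported in one chart can be computed there. -/
lemma total_restrict (a : ι) : P.total.restrict (P.e a '' P.Q a) = P.part a := by
  have hm := P.measurableSet_image
  have h0 (b : ι) : P.part b ≤ P.total := le_iSup P.part b
  refine le_antisymm ?_ ?_
  · have h1 : P.total ≤ P.total.restrict (P.e a '' P.Q a)ᶜ + P.part a := by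
      refine iSup_le fun b => Measure.le_iff.2 fun S hS => ?_
      rw [Measure.add_apply, Measure.restrict_apply hS, ← measure_inter_add_sdiff S (hm a), add_comm]
      refine add_le_add (h0 b _) ?_
      have h2 : P.part b (S ∩ P.e a '' P.Q a) =
          P.part b (S ∩ P.e a '' P.Q a ∩ P.e b '' P.Q b) := by
        refine (measure_inter_conull (P.part_compl b) ).symm
      rw [h2, P.part_eq_part b a ((hS.inter (hm a)).inter (hm b)) inter_subset_right
        (fun p hp => hp.1.2)]
      exact measure_mono fun p hp => hp.1.1
    refine Measure.le_iff.2 fun S hS => ?_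
    rw [Measure.restrict_apply hS]
    refine (h1 _).trans ?_
    rw [Measure.add_apply, Measure.restrict_apply (hS.inter (hm a)), inter_assoc, inter_compl_self,
      inter_empty, measure_empty, zero_add]
    exact measure_mono inter_subset_left
  · refine Measure.le_iff.2 fun S hS => ?_
    rw [Measure.restrict_apply hS, ← measure_inter_conull (P.part_compl a)]
    exact h0 a _

lemma total_lt_top (a : ι) {S : Set M} (hS : MeasurableSet S) (ha : S ⊆ P.e a '' P.Q a)
    (hr : IntegrableOn (P.r a) (P.e a ⁻¹' S ∩ P.Q a) μ) : P.total S < ⊤ := by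
  have h1 : P.total S = P.part a S := by
    rw [← P.total_restrict a, Measure.restrict_apply hS, inter_eq_self_of_subset_left ha]
  rw [h1, P.part_apply a hS]
  exact hr.lintegral_lt_top

omit [BorelSpace E] in
lemma total_compl_eq_zero {S : Set M} (hS : MeasurableSet S)
    (h : ∀ a, ∀ y ∈ P.Q a, P.e a y ∈ S) : P.total Sᶜ = 0 := by
  have h1 : P.total ≤ P.total.restrict S := by
    refine iSup_le fun a => ?_
    refine Measure.le_iff.2 fun T hT => ?_
    rw [Measure.restrict_apply hT]
    have h2 : P.part a Sᶜ = 0 := by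
      refine measure_mono_null ?_ (P.part_compl a)
      rintro p hp ⟨y, hy, rfl⟩
      exact hp (h a y hy)
    rw [← measure_inter_conull h2]
    exact le_iSup P.part a _
  have h3 := h1 Sᶜ
  rw [Measure.restrict_apply hS.compl, compl_inter_self, measure_empty] at h3
  exact le_antisymm h3 zero_le

lemma integrableOn_chart (a : ι) {F : M → ℝ} (hF : Integrable F P.total) :
    IntegrableOn (fun y => P.r a y * F (P.e a y)) (P.Q a) μ := by
  have h1 : Integrable F (P.part a) := by rw [← P.total_restrict a]; exact hF.restrict
  have h2 := (integrable_map_measure h1.aestronglyMeasurable (P.aemeasurable_e' a)).1 h1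
  rw [integrable_withDensity_iff_integrable_smul₀' (P.aemeasurable_r a).ennreal_ofReal
    (Eventually.of_forall fun _ => ENNReal.ofReal_lt_top)] at h2
  refine h2.congr ?_
  filter_upwards [ae_restrict_mem (P.measurableSet_Q a)] with y hy
  simp [ENNReal.toReal_ofReal (P.r_nonneg a y hy)]

lemma integral_chart (a : ι) {F : M → ℝ} (hF : AEStronglyMeasurable F P.total)
    (h0 : ∀ p, p ∉ P.e a '' P.Q a → F p = 0) :
    ∫ p, F p ∂P.total = ∫ y in P.Q a, P.r a y * F (P.e a y) ∂μ := by
  have h1 : ∫ p, F p ∂P.total = ∫ p, F p ∂P.part a := by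
    rw [← P.total_restrict a]
    exact (setIntegral_eq_integral_of_forall_compl_eq_zero fun p hp => h0 p hp).symm
  have h2 : AEStronglyMeasurable F (P.part a) := by
    rw [← P.total_restrict a]; exact hF.restrict
  rw [h1, part, integral_map (P.aemeasurable_e' a) h2,
    integral_withDensity_eq_integral_toReal_smul₀ (P.aemeasurable_r a).ennreal_ofReal
    (Eventually.of_forall fun _ => ENNReal.ofReal_lt_top)]
  refine setIntegral_congr_fun (P.measurableSet_Q a) fun y hy => ?_
  simp [ENNReal.toReal_ofReal (P.r_nonneg a y hy)]

lemma ae_chart (a : ι) (hr : ∀ y ∈ P.Q a, 0 < P.r a y) {p : M → Prop}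
    (hp : ∀ᵐ x ∂P.total, p x) : ∀ᵐ y ∂μ, y ∈ P.Q a → p (P.e a y) := by
  have h1 : ∀ᵐ x ∂P.part a, p x := by rw [← P.total_restrict a]; exact ae_restrict_of_ae hp
  have h2 := ae_of_ae_map (P.aemeasurable_e' a) h1
  rw [ae_withDensity_iff' (P.aemeasurable_r a).ennreal_ofReal,
    ae_restrict_iff' (P.measurableSet_Q a)] at h2
  filter_upwards [h2] with y hy hyQ
  exact hy hyQ (by simpa using hr y hyQ)

end ParamFamily

/-! ### The boundary of the half space -/

section HalfSpace

variable {m : ℕ}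

lemma mem_halfSpace {y : Coord m} : y ∈ halfSpace m ↔ 0 ≤ y 0 := by
  rw [halfSpace, range_modelWithCornersEuclideanHalfSpace]; rfl

lemma halfSpace_mem_nhds {y : Coord m} (hy : 0 < y 0) : halfSpace m ∈ 𝓝 y := by
  rw [mem_nhds_iff]
  exact ⟨_, interior_subset, isOpen_interior,
    by rw [interior_range_modelWithCornersEuclideanHalfSpace]; exact hy⟩

lemma isClosed_halfSpace : IsClosed (halfSpace m) := (𝓡∂ (m + 1)).isClosed_range

lemma convex_halfSpace : Convex ℝ (halfSpace m) := (𝓡∂ (m + 1)).convex_range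

/-- The inclusion of the boundary of the half space as a linear map. -/
def inclL (m : ℕ) : (Fin m → ℝ) →L[ℝ] Coord m :=
  LinearMap.toContinuousLinearMap
    { toFun := bdryIncl
      map_add' := fun z w => by
        ext i; refine Fin.cases ?_ (fun j => ?_) i <;> simp [bdryIncl]
      map_smul' := fun c z => by
        ext i; refine Fin.cases ?_ (fun j => ?_) i <;> simp [bdryIncl] }

/-- The projection of the half space to its boundary. -/
def tailL (m : ℕ) : Coord m →L[ℝ] (Fin m → ℝ) :=
  ContinuousLinearMap.pi fun i => EuclideanSpace.proj i.succ

lemma inclL_apply (z : Fin m → ℝ) : inclL m z = bdryIncl z := rfl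

lemma bdryIncl_zero (z : Fin m → ℝ) : bdryIncl z 0 = 0 := rfl

lemma bdryIncl_tailL {y : Coord m} (hy : y 0 = 0) : bdryIncl (tailL m y) = y := by
  ext i
  refine Fin.cases hy.symm (fun j => rfl) i

lemma tailL_bdryIncl (z : Fin m → ℝ) : tailL m (bdryIncl z) = z := rfl

lemma bdryIncl_mem (z : Fin m → ℝ) : bdryIncl z ∈ halfSpace m := mem_halfSpace.2 le_rfl

namespace IsChangeAt

variable {φ : Coord m → Coord m} {y : Coord m}

/-- A change of coordinates that maps a boundary point to a boundary point pulls the conormal back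
to a positive multiple of the conormal. -/
lemma exists_conormal (hφ : IsChangeAt φ y) (hy : y 0 = 0) (hφy : φ y 0 = 0) :
    ∃ c : ℝ, 0 < c ∧ ∀ v, fderivWithin ℝ φ (halfSpace m) y v 0 = c * v 0 := by
  set A := fderivWithin ℝ φ (halfSpace m) y with hA
  have hd : HasFDerivWithinAt (fun z => φ z 0)
      ((EuclideanSpace.proj 0 : Coord m →L[ℝ] ℝ).comp A) (halfSpace m) y :=
    (EuclideanSpace.proj 0 : Coord m →L[ℝ] ℝ).hasFDerivAt.comp_hasFDerivWithinAt y
      hφ.hasFDerivWithinAt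
  -- As `φ` stays in the half space, its coordinate `0` has a local minimum at `y`. The derivative
  -- thus vanishes in tangential directions and is nonnegative in the inward one.
  have hmin : IsLocalMinOn (fun z => φ z 0) (halfSpace m) y := by
    filter_upwards [hφ.maps] with z hz
    rw [hφy]; exact mem_halfSpace.1 hz
  have hcone (v : Coord m) (hv : 0 ≤ v 0) : v ∈ posTangentConeAt (halfSpace m) y := by
    refine mem_posTangentConeAt_of_segment_subset
      (convex_halfSpace.segment_subset hφ.mem (mem_halfSpace.2 ?_))
    simp [hy, hv]
  have h0 (v : Coord m) (hv : v 0 = 0) : A v 0 = 0 :=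
    hmin.hasFDerivWithinAt_eq_zero hd (hcone v hv.ge) (hcone (-v) (by simp [hv]))
  have h1 : 0 ≤ A (bvec 0) 0 :=
    hmin.hasFDerivWithinAt_nonneg hd (hcone _ (by simp))
  have h2 (v : Coord m) : A v 0 = A (bvec 0) 0 * v 0 := by
    have h3 := h0 (v - v 0 • bvec 0) (by simp)
    rw [map_sub, map_smul] at h3
    simp only [PiLp.sub_apply, PiLp.smul_apply, smul_eq_mul] at h3
    linarith
  refine ⟨A (bvec 0) 0, lt_of_le_of_ne h1 fun h => ?_, h2⟩
  -- If `c` were zero, the derivative would miss `bvec 0`, contrary to surjectivity.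
  obtain ⟨v, hv⟩ := hφ.bij_self.2 (bvec 0)
  have h3 := h2 v
  rw [hv, ← h] at h3
  simp at h3

end IsChangeAt

variable {G G' : Coord m → Matrix (Fin (m + 1)) (Fin (m + 1)) ℝ} {y y' : Coord m}

lemma continuousLinearMap_det_eq (A : Coord m →L[ℝ] Coord m) :
    A.det = (Matrix.of fun i j => A (bvec j) i).det := by
  rw [ContinuousLinearMap.det, ← LinearMap.det_toMatrix
    (EuclideanSpace.basisFun (Fin (m + 1)) ℝ).toBasis]
  rfl

lemma det_pullback {A : Coord m →L[ℝ] Coord m}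
    (h : ∀ v w, bil G' y v w = bil G y' (A v) (A w)) : (G' y).det = A.det ^ 2 * (G y').det := by
  have h1 : G' y = (Matrix.of fun i j => A (bvec j) i).transpose * G y' *
      (Matrix.of fun i j => A (bvec j) i) := by
    ext i j
    rw [← bil_bvec (G := G') (y := y) i j, h, bil_apply, Matrix.mul_apply, Finset.sum_comm]
    refine Finset.sum_congr rfl fun b _ => ?_
    rw [Matrix.mul_apply, Finset.sum_mul]
    refine Finset.sum_congr rfl fun a _ => ?_
    simp only [Matrix.transpose_apply, Matrix.of_apply]
    ring
  rw [h1, Matrix.det_mul, Matrix.det_mul, Matrix.det_transpose, continuousLinearMap_det_eq]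
  ring

/-- `hc` says that `A` preserves the hyperplane `{v₀ = 0}`, so only its tangential block enters the
Gram matrix of the boundary. -/
lemma det_pullback_boundary {A : Coord m →L[ℝ] Coord m}
    (h : ∀ v w, bil G' y v w = bil G y' (A v) (A w)) {c : ℝ} (hc : ∀ v, A v 0 = c * v 0) :
    ((G' y).submatrix Fin.succ Fin.succ).det =
      ((tailL m).comp (A.comp (inclL m))).det ^ 2 *
        ((G y').submatrix Fin.succ Fin.succ).det := by
  have hincl (j : Fin m) : inclL m (Pi.single j 1) = bvec j.succ := by
    rw [inclL_apply]
    ext i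
    refine Fin.cases ?_ (fun k => ?_) i
    · simp [bdryIncl, (Fin.succ_ne_zero j).symm]
    · simp [bdryIncl, Pi.single_apply]
  have h0 : ((tailL m).comp (A.comp (inclL m))).det =
      (Matrix.of fun i j : Fin m => A (bvec j.succ) i.succ).det := by
    rw [ContinuousLinearMap.det, ← LinearMap.det_toMatrix']
    congr 1
    ext i j
    rw [LinearMap.toMatrix'_apply, Matrix.of_apply, ← hincl]
    rfl
  have h1 : (G' y).submatrix Fin.succ Fin.succ =
      (Matrix.of fun i j : Fin m => A (bvec j.succ) i.succ).transpose *
        (G y').submatrix Fin.succ Fin.succ *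
      (Matrix.of fun i j : Fin m => A (bvec j.succ) i.succ) := by
    ext i j
    have hz (j : Fin m) : A (bvec j.succ) 0 = 0 := by rw [hc]; simp [(Fin.succ_ne_zero j).symm]
    rw [Matrix.submatrix_apply, ← bil_bvec (G := G') (y := y), h, bil_apply, Matrix.mul_apply, Finset.sum_comm,
      Fin.sum_univ_succ]
    simp only [hz, mul_zero, Finset.sum_const_zero, zero_add]
    refine Finset.sum_congr rfl fun b _ => ?_
    rw [Matrix.mul_apply, Finset.sum_mul, Fin.sum_univ_succ]
    simp only [hz, zero_mul, mul_zero, zero_add]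
    refine Finset.sum_congr rfl fun a _ => ?_
    simp only [Matrix.transpose_apply, Matrix.of_apply, Matrix.submatrix_apply]
    ring
  rw [h1, Matrix.det_mul, Matrix.det_mul, Matrix.det_transpose, h0]
  ring

end HalfSpace

/-! ### The Riemannian volume and boundary measures as parametrized families. -/

section Manifold

variable {m : ℕ} {M : Type*} [TopologicalSpace M] [ChartedSpace (EuclideanHalfSpace (m + 1)) M]
  [IsManifold (𝓡∂ (m + 1)) ∞ M]

lemma mem_boundary_iff {a p : M} (hp : p ∈ (crd m a).source) :
    p ∈ (𝓡∂ (m + 1)).boundary M ↔ crd m a p 0 = 0 := by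
  have h1 : p ∈ (chartAt (EuclideanHalfSpace (m + 1)) a).source := by
    rwa [extChartAt_source] at hp
  have h2 := (𝓡∂ (m + 1)).isInteriorPoint_iff_of_mem_atlas (n := ∞) (by simp)
    (chart_mem_atlas (EuclideanHalfSpace (m + 1)) a) h1
  have h3 : crd m a p ∈ interior (crd m a).target ↔ 0 < crd m a p 0 := by
    constructor
    · intro h
      have h4 := interior_mono (crd_target_subset (m := m) a) h
      rw [interior_range_modelWithCornersEuclideanHalfSpace] at h4
      exact h4
    · intro h
      have h4 := crd_target_mem_nhdsWithin ((crd m a).map_source hp)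
      rw [nhdsWithin_eq_nhds.2 (halfSpace_mem_nhds h)] at h4
      exact mem_interior_iff_mem_nhds.2 h4
  rw [← (𝓡∂ (m + 1)).compl_interior, mem_compl_iff]
  change ¬ (𝓡∂ (m + 1)).IsInteriorPoint p ↔ _
  rw [h2]
  change ¬ (crd m a p ∈ interior (crd m a).target) ↔ _
  rw [h3, not_lt]
  have h5 : 0 ≤ crd m a p 0 := mem_halfSpace.1 (crd_target_subset a ((crd m a).map_source hp))
  exact ⟨fun h => le_antisymm h h5, fun h => h.le⟩

omit [IsManifold (𝓡∂ (m + 1)) ∞ M] in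
lemma measurableSet_crd_target (a : M) : MeasurableSet (crd m a).target := by
  rw [extChartAt_target]
  exact (((𝓡∂ (m + 1)).continuous_symm.isOpen_preimage _
    (chartAt _ a).open_target).measurableSet).inter isClosed_halfSpace.measurableSet

lemma continuousOn_sqrt_det (g : Metric m M) (a : M) :
    ContinuousOn (fun y => √(gram g a y).det) (crd m a).target := fun _ hy =>
  (isMetricAt_gram g hy).contDiff_sqrt_det.continuousWithinAt.mono (crd_target_subset a)

/-- The charts with the densities of the Riemannian volume. -/
def volFamily [MeasurableSpace M] [BorelSpace M] (g : Metric m M) :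
    ParamFamily (Coord m) M M volume where
  e a := (crd m a).symm
  c a := crd m a
  Q a := (crd m a).target
  r a y := √(gram g a y).det
  measurableSet_Q := measurableSet_crd_target
  measurable_e a := (continuousOn_extChartAt_symm a).domRestrict.measurable
  measurableSet_image a := by
    rw [(crd m a).symm_image_target_eq_source]
    exact (isOpen_extChartAt_source a).measurableSet
  left_inv a y hy := (crd m a).right_inv hy
  aemeasurable_r a := (continuousOn_sqrt_det g a).aemeasurable (measurableSet_crd_target a)
  r_nonneg a y hy := Real.sqrt_nonneg _
  transition a b y hy hb := by
    rw [(crd m b).symm_image_target_eq_source] at hb ⊢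
    refine ⟨_, (isChangeAt_crd hy hb).hasFDerivWithinAt.mono
      (inter_subset_left.trans (crd_target_subset a)), ?_⟩
    have h1 := det_pullback ((isPullbackAt_gram g hy hb).self (crd_target_subset a hy))
    change √(gram g a y).det = _ * √(gram g b _).det
    rw [h1, Real.sqrt_mul (sq_nonneg _), Real.sqrt_sq_eq_abs]
    rfl

lemma continuousOn_sqrt_det_boundary (g : Metric m M) (a : M) :
    ContinuousOn (fun z => √((gram g a (bdryIncl z)).submatrix Fin.succ Fin.succ).det)
      {z | bdryIncl z ∈ (crd m a).target} := by
  have h1 : ContinuousOn (fun y => √((gram g a y).submatrix Fin.succ Fin.succ).det)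
      (crd m a).target := fun y hy => by
    have h2 : ContDiffWithinAt ℝ 2 (fun y => ((gram g a y).submatrix Fin.succ Fin.succ).det)
        (halfSpace m) y :=
      contDiffWithinAt_det fun i j => (isMetricAt_gram g hy).contDiff i.succ j.succ
    exact h2.continuousWithinAt.sqrt.mono (crd_target_subset a)
  exact h1.comp (inclL m).continuous.continuousOn fun z hz => hz

omit [IsManifold (𝓡∂ (m + 1)) ∞ M] in
lemma measurableSet_boundary_target (a : M) :
    MeasurableSet {z : Fin m → ℝ | bdryIncl z ∈ (crd m a).target} :=
  (inclL m).continuous.measurable (measurableSet_crd_target a)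

lemma image_boundary (a : M) : (fun z => (crd m a).symm (bdryIncl z)) ''
    {z | bdryIncl z ∈ (crd m a).target} = (crd m a).source ∩ (𝓡∂ (m + 1)).boundary M := by
  ext p
  constructor
  · rintro ⟨z, hz, rfl⟩
    have h1 := (crd m a).map_target hz
    refine ⟨h1, (mem_boundary_iff h1).2 ?_⟩
    rw [(crd m a).right_inv hz]; rfl
  · rintro ⟨h1, h2⟩
    have h3 := bdryIncl_tailL ((mem_boundary_iff h1).1 h2)
    refine ⟨tailL m (crd m a p), ?_, ?_⟩
    · rw [mem_ofPred_eq, h3]; exact (crd m a).map_source h1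
    · simp only [h3]; exact (crd m a).left_inv h1

/-- The charts of the boundary with the densities of the induced Riemannian measure. -/
def areaFamily [MeasurableSpace M] [BorelSpace M] (g : Metric m M) :
    ParamFamily (Fin m → ℝ) M M volume where
  e a z := (crd m a).symm (bdryIncl z)
  c a p := tailL m (crd m a p)
  Q a := {z | bdryIncl z ∈ (crd m a).target}
  r a z := √((gram g a (bdryIncl z)).submatrix Fin.succ Fin.succ).det
  measurableSet_Q := measurableSet_boundary_target
  measurable_e a := ((continuousOn_extChartAt_symm a).comp (inclL m).continuous.continuousOn
    fun z hz => hz).domRestrict.measurable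
  measurableSet_image a := by
    rw [image_boundary]
    exact (isOpen_extChartAt_source a).measurableSet.inter
      ((𝓡∂ (m + 1)).isClosed_boundary (M := M) (n := ∞) (by simp)).measurableSet
  left_inv a z hz := by rw [(crd m a).right_inv hz, tailL_bdryIncl]
  aemeasurable_r a :=
    (continuousOn_sqrt_det_boundary g a).aemeasurable (measurableSet_boundary_target a)
  r_nonneg a y hy := Real.sqrt_nonneg _
  transition a b z hz hb := by
    rw [image_boundary] at hb ⊢
    have hφ := isChangeAt_crd hz hb.1
    have h0 : (crd m b ∘ (crd m a).symm) (bdryIncl z) 0 = 0 := (mem_boundary_iff hb.1).1 hb.2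
    obtain ⟨c, hc, hc'⟩ := hφ.exists_conormal (bdryIncl_zero z) h0
    refine ⟨(tailL m).comp ((fderivWithin ℝ (crd m b ∘ (crd m a).symm) (halfSpace m)
      (bdryIncl z)).comp (inclL m)), ?_, ?_⟩
    · exact (tailL m).hasFDerivAt.comp_hasFDerivWithinAt z
        (hφ.hasFDerivWithinAt.comp z (inclL m).hasFDerivWithinAt fun z _ => bdryIncl_mem z)
    · have h1 := det_pullback_boundary ((isPullbackAt_gram g hz hb.1).self
        (crd_target_subset a hz)) hc'
      change _ = _ * √((gram g b (bdryIncl (tailL m ((crd m b ∘ (crd m a).symm)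
        (bdryIncl z))))).submatrix Fin.succ Fin.succ).det
      rw [bdryIncl_tailL h0, h1, Real.sqrt_mul (sq_nonneg _), Real.sqrt_sq_eq_abs]

end Manifold

/-! ### The normal derivative along the boundary -/

section Normal

variable {m : ℕ} {G G' : Coord m → Matrix (Fin (m + 1)) (Fin (m + 1)) ℝ} {y : Coord m}

/-- The derivative of `h` in the direction of the unit normal. -/
def normalDeriv (G : Coord m → Matrix (Fin (m + 1)) (Fin (m + 1)) ℝ) (h : Coord m → ℝ)
    (y : Coord m) : ℝ := ∑ i, normalCoord G i y * pd i h y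

lemma pd_congr {h h' : Coord m → ℝ} (hh : h =ᶠ[𝓝[halfSpace m] y] h') (hy : y ∈ halfSpace m)
    (i : Fin (m + 1)) : pd i h y = pd i h' y := by
  unfold pd
  rw [Filter.EventuallyEq.fderivWithin_eq hh (hh.self_of_nhdsWithin hy)]

lemma pd_coord (hy : y ∈ halfSpace m) (i : Fin (m + 1)) :
    pd i (fun z => z 0) y = if i = 0 then 1 else 0 := by
  have h1 : HasFDerivWithinAt (fun z : Coord m => z 0) (EuclideanSpace.proj 0 : Coord m →L[ℝ] ℝ)
    (halfSpace m) y := (EuclideanSpace.proj 0 : Coord m →L[ℝ] ℝ).hasFDerivWithinAt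
  unfold pd
  rw [h1.fderivWithin (uniqueDiffOn_halfSpace y hy)]
  simp [eq_comm]

/-- Writes the normal derivative through pairings with the gradient of `y₀`, for which invariance is
known. -/
lemma IsMetricAt.normalDeriv_eq (hG : IsMetricAt G y) (h : Coord m → ℝ) :
    normalDeriv G h y = -gradPair G h (fun z => z 0) y /
      √(gradPair G (fun z => z 0) (fun z => z 0) y) := by
  simp only [normalDeriv, gradPair_eq_sum, gradCoord, pd_coord hG.mem, normalCoord, mul_ite, mul_one,
    mul_zero, Finset.sum_ite_eq', Finset.mem_univ, if_true]
  rw [← Finset.sum_neg_distrib, Finset.sum_div]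
  exact Finset.sum_congr rfl fun i _ => by ring

lemma gradVec_smul {h k : Coord m → ℝ} {c : ℝ} (hc : ∀ i, pd i h y = c * pd i k y) :
    gradVec G h y = c • gradVec G k y := by
  ext i
  change ∑ j, (G y)⁻¹ i j * pd j h y = c * ∑ j, (G y)⁻¹ i j * pd j k y
  rw [Finset.mul_sum]
  exact Finset.sum_congr rfl fun j _ => by rw [hc]; ring

/-- At a boundary point the differentials of the first coordinates of two charts differ by a factor
`c > 0`. It appears once in the numerator and as `√(c ^ 2)` in the denominator, so it cancels. -/
lemma IsPullbackAt.normalDeriv_eq {φ : Coord m → Coord m} (hp : IsPullbackAt G' G φ y)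
    (hφ : IsChangeAt φ y) (hG' : IsMetricAt G' y) (hG : IsMetricAt G (φ y)) (hy : y 0 = 0)
    (hφy : φ y 0 = 0) {h h' : Coord m → ℝ}
    (hh : DifferentiableWithinAt ℝ h (halfSpace m) (φ y))
    (hh' : h' =ᶠ[𝓝[halfSpace m] y] h ∘ φ) :
    normalDeriv G' h' y = normalDeriv G h (φ y) := by
  obtain ⟨c, hc, hc'⟩ := hφ.exists_conormal hy hφy
  have h0 : HasFDerivWithinAt (fun z : Coord m => z 0)
    (EuclideanSpace.proj 0 : Coord m →L[ℝ] ℝ) (halfSpace m) (φ y) :=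
    (EuclideanSpace.proj 0 : Coord m →L[ℝ] ℝ).hasFDerivWithinAt
  have h1 := hp.gradPair_eq hφ hG' hG hh h0.differentiableWithinAt hh' (EventuallyEq.refl _ _)
  have h2 := hp.gradPair_eq hφ hG' hG h0.differentiableWithinAt h0.differentiableWithinAt
    (EventuallyEq.refl _ _) (EventuallyEq.refl _ _)
  have h3 (v : Coord m) : fderivWithin ℝ ((fun z : Coord m => z 0) ∘ φ) (halfSpace m) y v =
      c * fderivWithin ℝ (fun z : Coord m => z 0) (halfSpace m) y v := by
    rw [IsPullbackAt.fderiv_comp hφ h0.differentiableWithinAt (EventuallyEq.refl _ _),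
      h0.fderivWithin (uniqueDiffOn_halfSpace _ hG.mem)]
    have h0' : HasFDerivWithinAt (fun z : Coord m => z 0)
      (EuclideanSpace.proj 0 : Coord m →L[ℝ] ℝ) (halfSpace m) y :=
      (EuclideanSpace.proj 0 : Coord m →L[ℝ] ℝ).hasFDerivWithinAt
    rw [h0'.fderivWithin (uniqueDiffOn_halfSpace _ hφ.mem)]
    exact hc' v
  have h4 : gradVec G' ((fun z : Coord m => z 0) ∘ φ) y = c • gradVec G' (fun z => z 0) y :=
    gradVec_smul fun i => h3 (bvec i)
  rw [hG.normalDeriv_eq, hG'.normalDeriv_eq, ← h1, ← h2]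
  unfold gradPair
  rw [h4, map_smul, map_smul, h3, smul_eq_mul, smul_eq_mul, ← mul_assoc, ← sq,
    Real.sqrt_mul (sq_nonneg _), Real.sqrt_sq hc.le, ← mul_neg, mul_div_mul_left _ _ hc.ne']

lemma IsMetricAt.continuousWithinAt_normalDeriv (hG : IsMetricAt G y) {h : Coord m → ℝ}
    (hh : ContDiffWithinAt ℝ 1 h (halfSpace m) y) :
    ContinuousWithinAt (normalDeriv G h) (halfSpace m) y :=
  tendsto_finsetSum _ fun i _ => (hG.contDiff_normalCoord i).continuousWithinAt.mul
    (contDiff_pd (l := 0) hh (by norm_num) hG.mem i).continuousWithinAt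

/-- The density of the boundary measure. -/
lemma IsMetricAt.sqrt_det_submatrix (hG : IsMetricAt G y) :
    √((G y).submatrix Fin.succ Fin.succ).det = √(G y).det * √((G y)⁻¹ 0 0) := by
  rw [← Real.sqrt_mul hG.det_pos.le]
  congr 1
  have h1 : (G y)⁻¹ 0 0 = (G y).det⁻¹ * (G y).adjugate 0 0 := by
    rw [Matrix.inv_def, Matrix.smul_apply, Ring.inverse_eq_inv', smul_eq_mul]
  rw [h1, mul_inv_cancel_left₀ hG.det_pos.ne', Matrix.adjugate_fin_succ_eq_det_submatrix]
  simp [Fin.succAbove_zero]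

end Normal

/-! ### The divergence theorem on the half space -/

/-- The divergence theorem on a box containing the support. Differentiability is asked only in the
open half space, which is what a function `C²` in the interior can provide. -/
lemma integral_divergence_halfSpace {m : ℕ} (V : Fin (m + 1) → Coord m → ℝ) {R : ℝ} (hR : 0 < R)
    (hc : ∀ i, ContinuousOn (V i) (halfSpace m))
    (hd : ∀ i y, 0 < y 0 → DifferentiableWithinAt ℝ (V i) (halfSpace m) y)
    (hV : ∀ i, ∀ y ∈ halfSpace m, V i y ≠ 0 → ∀ j, |y j| < R)
    (hint : IntegrableOn (fun y => ∑ i, pd i (V i) y) (halfSpace m)) :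
    ∫ y in halfSpace m, ∑ i, pd i (V i) y = -∫ z : Fin m → ℝ, V 0 (bdryIncl z) := by
  set D : Coord m → ℝ := fun y => ∑ i, pd i (V i) y with hD
  let L : (Fin (m + 1) → ℝ) →L[ℝ] Coord m :=
    (EuclideanSpace.equiv (Fin (m + 1)) ℝ).symm.toContinuousLinearMap
  have hL (x : Fin (m + 1) → ℝ) : L x = WithLp.toLp 2 x := rfl
  -- The box is `[0, R] × [-R, R]^m`: one face lies on the boundary of the half space, and the field
  -- vanishes on all the others because the bound on its support is strict.
  let a : Fin (m + 1) → ℝ := Fin.cons 0 fun _ => -R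
  let b : Fin (m + 1) → ℝ := fun _ => R
  have hab : a ≤ b := by
    intro i; refine Fin.cases ?_ (fun j => ?_) i
    · exact hR.le
    · change -R ≤ R; linarith
  have hsub : ∀ x ∈ Icc a b, L x ∈ halfSpace m := fun x hx => mem_halfSpace.2 (hx.1 0)
  have hmp := PiLp.volume_preserving_toLp (Fin (m + 1))
  have hemb : MeasurableEmbedding (WithLp.toLp 2 : (Fin (m + 1) → ℝ) → Coord m) :=
    (MeasurableEquiv.toLp 2 (Fin (m + 1) → ℝ)).measurableEmbedding
  have hpre : ∫ y in halfSpace m, D y = ∫ x in L ⁻¹' halfSpace m, D (L x) :=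
    (hmp.setIntegral_preimage_emb hemb D (halfSpace m)).symm
  have hint' : IntegrableOn (fun x => D (L x)) (L ⁻¹' halfSpace m) :=
    (hmp.integrableOn_comp_preimage hemb).2 hint
  have hbox : ∫ x in L ⁻¹' halfSpace m, D (L x) = ∫ x in Icc a b, D (L x) := by
    refine setIntegral_eq_of_subset_of_forall_sdiff_eq_zero
      (isClosed_halfSpace.preimage L.continuous).measurableSet (fun x hx => hsub x hx) ?_
    rintro x ⟨hx1, hx2⟩
    refine Finset.sum_eq_zero fun i _ => ?_
    have hzero : ∀ z ∈ halfSpace m, z ∉ L '' Icc a b → V i z = 0 := by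
      intro z hz hz'
      by_contra hne
      have h1 := hV i z hz hne
      refine hz' ⟨fun i => z i, ⟨fun j => ?_, fun j => (abs_lt.1 (h1 j)).2.le⟩, rfl⟩
      refine Fin.cases ?_ (fun k => ?_) j
      · exact mem_halfSpace.1 hz
      · exact (abs_lt.1 (h1 k.succ)).1.le
    have hcl : IsClosed (L '' Icc a b) := (isCompact_Icc.image L.continuous).isClosed
    have hx3 : L x ∉ L '' Icc a b := by
      rintro ⟨x', hx', he⟩
      exact hx2 ((EuclideanSpace.equiv (Fin (m + 1)) ℝ).symm.injective he ▸ hx')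
    have h2 : V i =ᶠ[𝓝[halfSpace m] (L x)] fun _ => 0 := by
      filter_upwards [self_mem_nhdsWithin, mem_nhdsWithin_of_mem_nhds (hcl.isOpen_compl.mem_nhds hx3)]
        with z hz1 hz2 using hzero z hz1 hz2
    rw [pd_congr h2 hx1]
    simp [pd]
  have hdiv := integral_divergence_of_hasFDerivAt_off_countable' a b hab
    (fun i x => V i (L x)) (fun i x => (fderivWithin ℝ (V i) (halfSpace m) (L x)).comp L) ∅
    countable_empty (fun i => (hc i).comp L.continuous.continuousOn hsub)
    (by
      rintro x ⟨hx, -⟩ i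
      have hx0 : 0 < L x 0 := (hx 0 (mem_univ _)).1
      exact (((hd i _ hx0).hasFDerivWithinAt.hasFDerivAt
        (halfSpace_mem_nhds hx0)).comp x L.hasFDerivAt))
    (hint'.mono_set hsub)
  have hDL (x : Fin (m + 1) → ℝ) : D (L x) = ∑ i, (fderivWithin ℝ (V i) (halfSpace m) (L x)).comp L
      (Pi.single i 1) := rfl
  rw [hpre, hbox]
  simp only [hDL]
  rw [hdiv, Fin.sum_univ_succ]
  have hV0 (i : Fin (m + 1)) (y : Coord m) (hy : y ∈ halfSpace m) (j : Fin (m + 1))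
      (hj : R ≤ |y j|) : V i y = 0 := by
    by_contra hne
    exact absurd (hV i y hy hne j) (not_lt.2 hj)
  have hfront (i : Fin (m + 1)) : ∫ x in Icc (a ∘ i.succAbove) (b ∘ i.succAbove),
      V i (L (i.insertNth (b i) x)) = 0 := by
    refine setIntegral_eq_zero_of_forall_eq_zero fun x hx => hV0 i _ (hsub _ ?_) i ?_
    · rw [Fin.insertNth_mem_Icc]; exact ⟨⟨hab i, le_rfl⟩, hx⟩
    · rw [hL]; simp [b, le_abs_self]
  have hback (i : Fin m) : ∫ x in Icc (a ∘ i.succ.succAbove) (b ∘ i.succ.succAbove),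
      V i.succ (L (i.succ.insertNth (a i.succ) x)) = 0 := by
    refine setIntegral_eq_zero_of_forall_eq_zero fun x hx => hV0 _ _ (hsub _ ?_) i.succ ?_
    · rw [Fin.insertNth_mem_Icc]; exact ⟨⟨le_rfl, hab _⟩, hx⟩
    · rw [hL]; simp [a, le_abs_self]
  have hback0 : ∫ x in Icc (a ∘ (0 : Fin (m + 1)).succAbove) (b ∘ (0 : Fin (m + 1)).succAbove),
      V 0 (L ((0 : Fin (m + 1)).insertNth (a 0) x)) = ∫ z : Fin m → ℝ, V 0 (bdryIncl z) := by
    have h1 (x : Fin m → ℝ) : L ((0 : Fin (m + 1)).insertNth (a 0) x) = bdryIncl x := by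
      rw [hL, Fin.insertNth_zero]; rfl
    simp only [h1]
    refine setIntegral_eq_integral_of_forall_compl_eq_zero fun x hx => ?_
    by_contra hne
    have h2 := hV 0 _ (bdryIncl_mem x) hne
    refine hx ⟨fun j => ?_, fun j => ?_⟩
    · exact (abs_lt.1 (h2 j.succ)).1.le
    · exact (abs_lt.1 (h2 j.succ)).2.le
  simp only [hfront, hback, hback0, sub_zero, zero_sub, Finset.sum_const_zero, add_zero]

/-! ### Finiteness of the measures and the normal derivative of a function on the manifold -/

section Manifold

variable {m : ℕ} {M : Type*} [TopologicalSpace M] [ChartedSpace (EuclideanHalfSpace (m + 1)) M]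
  [IsManifold (𝓡∂ (m + 1)) ∞ M]

omit [IsManifold (𝓡∂ (m + 1)) ∞ M] in
/-- A point has an open neighborhood that a chart maps into a compact part of its target. -/
lemma exists_nhds_compact (p : M) : ∃ (S : Set M) (K : Set (Coord m)), IsOpen S ∧ p ∈ S ∧
    S ⊆ (crd m p).source ∧ IsCompact K ∧ K ⊆ (crd m p).target ∧
      ∀ y ∈ (crd m p).target, (crd m p).symm y ∈ S → y ∈ K := by
  obtain ⟨ε, hε, h⟩ := Metric.mem_nhdsWithin_iff.1
    (crd_target_mem_nhdsWithin (mem_extChartAt_target (I := 𝓡∂ (m + 1)) p))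
  refine ⟨(crd m p).source ∩ crd m p ⁻¹' Metric.ball (crd m p p) (ε / 2),
    Metric.closedBall (crd m p p) (ε / 2) ∩ halfSpace m,
    (continuousOn_extChartAt p).isOpen_inter_preimage (isOpen_extChartAt_source p)
      Metric.isOpen_ball, ⟨mem_extChartAt_source p, Metric.mem_ball_self (half_pos hε)⟩,
    inter_subset_left, (isCompact_closedBall _ _).inter_right isClosed_halfSpace,
    (inter_subset_inter_left _ (Metric.closedBall_subset_ball (half_lt_self hε))).trans h, ?_⟩
  rintro y hy ⟨-, hy'⟩
  rw [mem_preimage, (crd m p).right_inv hy] at hy'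
  exact ⟨Metric.ball_subset_closedBall hy', crd_target_subset p hy⟩

variable [MeasurableSpace M] [BorelSpace M]

/-- The continuous density is bounded on a compact part of the chart target. On compact `M` this
makes continuous functions integrable. -/
lemma isLocallyFiniteMeasure_vol (g : Metric m M) : IsLocallyFiniteMeasure (vol g) := by
  refine ⟨fun p => ?_⟩
  obtain ⟨S, K, hS, hp, hSs, hK, hKt, hSK⟩ := exists_nhds_compact (m := m) p
  refine ⟨S, hS.mem_nhds hp, (volFamily g).total_lt_top p hS.measurableSet ?_ ?_⟩
  · exact hSs.trans (crd m p).symm_image_target_eq_source.ge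
  · exact (((continuousOn_sqrt_det g p).mono hKt).integrableOn_compact hK).mono_set
      fun y hy => hSK y hy.2 hy.1

lemma area_compl_boundary (g : Metric m M) : area g ((𝓡∂ (m + 1)).boundary M)ᶜ = 0 := by
  refine (areaFamily g).total_compl_eq_zero
    ((𝓡∂ (m + 1)).isClosed_boundary (M := M) (n := ∞) (by simp)).measurableSet fun a z hz => ?_
  have h := mem_image_of_mem (fun z => (crd m a).symm (bdryIncl z)) hz
  exact ((image_boundary a).subset h).2

lemma isLocallyFiniteMeasure_area (g : Metric m M) : IsLocallyFiniteMeasure (area g) := by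
  refine ⟨fun p => ?_⟩
  obtain ⟨S, K, hS, hp, hSs, hK, hKt, hSK⟩ := exists_nhds_compact (m := m) p
  refine ⟨S, hS.mem_nhds hp, ?_⟩
  rw [← measure_inter_conull (area_compl_boundary g)]
  refine (areaFamily g).total_lt_top p (hS.measurableSet.inter
    ((𝓡∂ (m + 1)).isClosed_boundary (M := M) (n := ∞) (by simp)).measurableSet) ?_ ?_
  · exact (inter_subset_inter_left _ hSs).trans (image_boundary p).ge
  · have hinj : Function.Injective (inclL m) := fun z w h => congrArg (tailL m) h
    have hK' : IsCompact (inclL m ⁻¹' K) :=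
      ((inclL m).toLinearMap.isClosedEmbedding_of_injective
        (LinearMap.ker_eq_bot.2 hinj)).isCompact_preimage hK
    exact (((continuousOn_sqrt_det_boundary g p).mono fun z hz => hKt hz).integrableOn_compact
      hK').mono_set fun z hz => hSK _ hz.2 hz.1.1

/-- The derivative of a function in the direction of the exterior unit normal of the boundary,
extended by zero off the boundary. -/
def bdryDeriv (g : Metric m M) (u : M → ℝ) (p : M) : ℝ := by
  classical exact
  if p ∈ (𝓡∂ (m + 1)).boundary M then
    normalDeriv (gram g p) (u ∘ (crd m p).symm) (crd m p p) else 0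

omit [MeasurableSpace M] [BorelSpace M] in
lemma bdryDeriv_of_notMem (g : Metric m M) (u : M → ℝ) {p : M}
    (hp : p ∉ (𝓡∂ (m + 1)).boundary M) : bdryDeriv g u p = 0 := if_neg hp

omit [MeasurableSpace M] [BorelSpace M] in
lemma bdryDeriv_self (g : Metric m M) (u : M → ℝ) {p : M}
    (hp : p ∈ (𝓡∂ (m + 1)).boundary M) : bdryDeriv g u p =
      normalDeriv (gram g p) (u ∘ (crd m p).symm) (crd m p p) := if_pos hp

omit [MeasurableSpace M] [BorelSpace M] in
lemma bdryDeriv_eq (g : Metric m M) {u : M → ℝ} {a p : M} (hp : p ∈ (crd m a).source)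
    (hpb : p ∈ (𝓡∂ (m + 1)).boundary M) (hu : ContMDiffAt (𝓡∂ (m + 1)) 𝓘(ℝ, ℝ) 1 u p) :
    bdryDeriv g u p = normalDeriv (gram g a) (u ∘ (crd m a).symm) (crd m a p) := by
  have hy := (crd m a).map_source hp
  have hb : (crd m a).symm (crd m a p) ∈ (crd m p).source := by
    rw [(crd m a).left_inv hp]; exact mem_extChartAt_source p
  have he : (crd m p ∘ (crd m a).symm) (crd m a p) = crd m p p := by
    rw [Function.comp_apply, (crd m a).left_inv hp]
  have hG : IsMetricAt (gram g p) ((crd m p ∘ (crd m a).symm) (crd m a p)) := by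
    rw [he]; exact isMetricAt_gram g (mem_extChartAt_target p)
  have hu' := (contDiffWithinAt_comp_symm one_le_infty
    (mem_extChartAt_source p) hu).differentiableWithinAt (by norm_num)
  rw [← he] at hu'
  rw [bdryDeriv_self g u hpb, (isPullbackAt_gram g hy hb).normalDeriv_eq (isChangeAt_crd hy hb)
    (isMetricAt_gram g hy) hG ((mem_boundary_iff hp).1 hpb)
    (by rw [he]; exact (mem_boundary_iff (mem_extChartAt_source p)).1 hpb) hu'
    (comp_symm_eventuallyEq hy hb u), he]

omit [MeasurableSpace M] [BorelSpace M] in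
lemma continuousOn_bdryDeriv (g : Metric m M) {u : M → ℝ}
    (hu : ContMDiff (𝓡∂ (m + 1)) 𝓘(ℝ, ℝ) 1 u) :
    ContinuousOn (bdryDeriv g u) ((𝓡∂ (m + 1)).boundary M) := by
  intro p hp
  have h1 : ContinuousAt (fun q => normalDeriv (gram g p) (u ∘ (crd m p).symm) (crd m p q)) p :=
    continuousAt_of_crd (m := m) (a := p) (fun _ _ => rfl) (mem_extChartAt_source p)
      ((isMetricAt_gram g (mem_extChartAt_target p)).continuousWithinAt_normalDeriv
        (contDiffWithinAt_comp_symm one_le_infty (mem_extChartAt_source p) (hu p)))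
  refine h1.continuousWithinAt.congr_of_eventuallyEq ?_ (bdryDeriv_self g u hp)
  filter_upwards [self_mem_nhdsWithin, mem_nhdsWithin_of_mem_nhds
    ((isOpen_extChartAt_source (I := 𝓡∂ (m + 1)) p).mem_nhds (mem_extChartAt_source p))]
    with q hq hq'
  exact bdryDeriv_eq g hq' hq (hu q)

lemma measurable_bdryDeriv (g : Metric m M) {u : M → ℝ}
    (hu : ContMDiff (𝓡∂ (m + 1)) 𝓘(ℝ, ℝ) 1 u) : Measurable (bdryDeriv g u) := by
  classical
  have h1 : bdryDeriv g u = ((𝓡∂ (m + 1)).boundary M).piecewise (bdryDeriv g u) 0 := by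
    funext p
    by_cases hp : p ∈ (𝓡∂ (m + 1)).boundary M
    · rw [piecewise_eq_of_mem _ _ _ hp]
    · rw [piecewise_eq_of_notMem _ _ _ hp, bdryDeriv_of_notMem g u hp]; rfl
  rw [h1]
  exact (continuousOn_bdryDeriv g hu).measurable_piecewise continuousOn_const
    ((𝓡∂ (m + 1)).isClosed_boundary (M := M) (n := ∞) (by simp)).measurableSet

variable [CompactSpace M]

lemma integrable_vol (g : Metric m M) {F : M → ℝ} (hF : Continuous F) :
    Integrable F (vol g) := by
  have := isLocallyFiniteMeasure_vol g
  exact hF.integrable_of_hasCompactSupport (HasCompactSupport.of_compactSpace F)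

lemma integrable_bdryDeriv (g : Metric m M) {f u : M → ℝ} (hf : Continuous f)
    (hu : ContMDiff (𝓡∂ (m + 1)) 𝓘(ℝ, ℝ) 1 u) :
    Integrable (fun p => f p * bdryDeriv g u p) (area g) := by
  have := isLocallyFiniteMeasure_area g
  have hb := (𝓡∂ (m + 1)).isClosed_boundary (M := M) (n := ∞) (by simp)
  obtain ⟨C, hC⟩ := hb.isCompact.exists_bound_of_continuousOn
    (hf.continuousOn.mul (continuousOn_bdryDeriv g hu))
  refine Integrable.of_bound (hf.measurable.mul (measurable_bdryDeriv g hu)).aestronglyMeasurable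
    C ?_
  have h1 : ∀ᵐ p ∂area g, p ∈ (𝓡∂ (m + 1)).boundary M := area_compl_boundary g
  filter_upwards [h1] with p hp using hC p hp

end Manifold

/-! ### Green's formula -/

section Coordinates

variable {m : ℕ} {G : Coord m → Matrix (Fin (m + 1)) (Fin (m + 1)) ℝ} {y : Coord m}

/-- The density of the vector field `χ (f ∇u - u ∇f)`. -/
def greenField (G : Coord m → Matrix (Fin (m + 1)) (Fin (m + 1)) ℝ) (χ f u : Coord m → ℝ)
    (i : Fin (m + 1)) (y : Coord m) : ℝ :=
  √(G y).det * (χ y * (f y * gradCoord G u i y - u y * gradCoord G f i y))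

lemma IsMetricAt.continuousWithinAt_greenField (hG : IsMetricAt G y) {χ f u : Coord m → ℝ}
    (hχ : ContinuousWithinAt χ (halfSpace m) y) (hf : ContDiffWithinAt ℝ 1 f (halfSpace m) y)
    (hu : ContDiffWithinAt ℝ 1 u (halfSpace m) y) (i : Fin (m + 1)) :
    ContinuousWithinAt (greenField G χ f u i) (halfSpace m) y :=
  hG.contDiff_sqrt_det.continuousWithinAt.mul (hχ.mul
    ((hf.continuousWithinAt.mul
      (hG.contDiff_gradCoord (n := 0) (by norm_num) (by simpa using hu) i).continuousWithinAt).sub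
    (hu.continuousWithinAt.mul
      (hG.contDiff_gradCoord (n := 0) (by norm_num) (by simpa using hf) i).continuousWithinAt)))

lemma IsMetricAt.differentiableWithinAt_mul_gradCoord (hG : IsMetricAt G y) {u : Coord m → ℝ}
    (hu : ContDiffWithinAt ℝ 2 u (halfSpace m) y) (i : Fin (m + 1)) :
    DifferentiableWithinAt ℝ (fun z => √(G z).det * gradCoord G u i z) (halfSpace m) y :=
  ((hG.contDiff_sqrt_det.of_le (by norm_num)).mul (hG.contDiff_gradCoord (n := 1) (by norm_num)
    (by simpa [one_add_one_eq_two] using hu) i)).differentiableWithinAt (by norm_num)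

lemma IsMetricAt.differentiableWithinAt_greenField (hG : IsMetricAt G y) {χ f u : Coord m → ℝ}
    (hχ : DifferentiableWithinAt ℝ χ (halfSpace m) y) (hf : ContDiffWithinAt ℝ 2 f (halfSpace m) y)
    (hu : ContDiffWithinAt ℝ 2 u (halfSpace m) y) (i : Fin (m + 1)) :
    DifferentiableWithinAt ℝ (greenField G χ f u i) (halfSpace m) y := by
  have h := hχ.mul (((hf.differentiableWithinAt (by norm_num)).mul
    (hG.differentiableWithinAt_mul_gradCoord hu i)).sub ((hu.differentiableWithinAt (by norm_num)).mul
    (hG.differentiableWithinAt_mul_gradCoord hf i)))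
  refine h.congr_of_eventuallyEq_of_mem (Eventually.of_forall fun z => ?_) hG.mem
  simp only [greenField, Pi.mul_apply, Pi.sub_apply]
  ring

/-- The cross terms `⟨∇f, ∇u⟩` cancel by symmetry; the derivatives of the cutoff `χ` remain and
disappear only after summing over a partition of unity. -/
lemma IsMetricAt.sum_pd_greenField (hG : IsMetricAt G y) {χ f u : Coord m → ℝ}
    (hχ : DifferentiableWithinAt ℝ χ (halfSpace m) y) (hf : ContDiffWithinAt ℝ 2 f (halfSpace m) y)
    (hu : ContDiffWithinAt ℝ 2 u (halfSpace m) y) :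
    ∑ i, pd i (greenField G χ f u i) y = √(G y).det *
      (χ y * (f y * laplaceCoord G u y - u y * laplaceCoord G f y) +
        (f y * gradPair G χ u y - u y * gradPair G χ f y)) := by
  have hf' := (hf.differentiableWithinAt (by norm_num)).hasFDerivWithinAt
  have hu' := (hu.differentiableWithinAt (by norm_num)).hasFDerivWithinAt
  have h1 (i : Fin (m + 1)) : pd i (greenField G χ f u i) y =
      χ y * (f y * pd i (fun z => √(G z).det * gradCoord G u i z) y -
        u y * pd i (fun z => √(G z).det * gradCoord G f i z) y) +
      √(G y).det * (χ y * (gradCoord G u i y * pd i f y - gradCoord G f i y * pd i u y) +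
        (f y * (gradCoord G u i y * pd i χ y) - u y * (gradCoord G f i y * pd i χ y))) := by
    have h := hχ.hasFDerivWithinAt.mul ((hf'.mul
      (hG.differentiableWithinAt_mul_gradCoord hu i).hasFDerivWithinAt).sub
      (hu'.mul (hG.differentiableWithinAt_mul_gradCoord hf i).hasFDerivWithinAt))
    have h2 : HasFDerivWithinAt (greenField G χ f u i) _ (halfSpace m) y :=
      h.congr_of_eventuallyEq (Eventually.of_forall fun z => by
        simp only [greenField, Pi.mul_apply, Pi.sub_apply]; ring) (by
        simp only [greenField, Pi.mul_apply, Pi.sub_apply]; ring)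
    have h3 := congrArg (fun L : Coord m →L[ℝ] ℝ => L (bvec i))
      (h2.fderivWithin (uniqueDiffOn_halfSpace y hG.mem))
    have h4 : pd i (greenField G χ f u i) y = _ := h3
    rw [h4]
    simp only [pd, add_apply, sub_apply, smul_apply, smul_eq_mul, Pi.mul_apply, Pi.sub_apply]
    ring
  have h5 (k : Coord m → ℝ) : ∑ i, pd i (fun z => √(G z).det * gradCoord G k i z) y =
      √(G y).det * laplaceCoord G k y := by
    rw [laplaceCoord, divCoord, mul_inv_cancel_left₀ (Real.sqrt_pos.2 hG.det_pos).ne']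
  simp only [h1, Finset.sum_add_distrib, ← Finset.mul_sum, Finset.sum_sub_distrib, h5,
    ← gradPair_eq_sum]
  rw [hG.gradPair_symm f u]
  ring

/-- The normal component of `χ (f ∇u - u ∇f)` where `u` vanishes. -/
lemma IsMetricAt.greenField_zero (hG : IsMetricAt G y) {χ f u : Coord m → ℝ} (hu : u y = 0) :
    greenField G χ f u 0 y =
      -(√((G y).submatrix Fin.succ Fin.succ).det * (χ y * (f y * normalDeriv G u y))) := by
  have h1 := (Real.sqrt_pos.2 (hG.posDef_self.inv.diag_pos (i := 0))).ne'
  have h2 : normalDeriv G u y = -gradCoord G u 0 y / √((G y)⁻¹ 0 0) := by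
    rw [normalDeriv, gradCoord, ← Finset.sum_neg_distrib, Finset.sum_div]
    refine Finset.sum_congr rfl fun i _ => ?_
    rw [normalCoord, hG.inv_symm_apply i 0]
    ring
  rw [h2, hG.sqrt_det_submatrix, greenField, hu]
  field_simp
  ring

end Coordinates

/-- The boundary hyperplane is null, so formulas with second derivatives of `f` are needed only
where `y₀ > 0`. -/
lemma ae_halfSpace_pos (m : ℕ) :
    ∀ᵐ y ∂(volume : Measure (Coord m)).restrict (halfSpace m), 0 < y 0 := by
  rw [ae_restrict_iff' isClosed_halfSpace.measurableSet]
  have h1 : ∀ᵐ y ∂(volume : Measure (Coord m)), y ∉ frontier (halfSpace m) :=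
    measure_eq_zero_iff_ae_notMem.1 (convex_halfSpace.addHaar_frontier volume)
  filter_upwards [h1] with y hy hy'
  have h2 : y ∈ interior (halfSpace m) := by
    by_contra h3
    exact hy ⟨subset_closure hy', h3⟩
  rwa [interior_range_modelWithCornersEuclideanHalfSpace] at h2

/-! ### Green's formula on the manifold, by localization to charts. -/

section Manifold

variable {m : ℕ} {M : Type*} [TopologicalSpace M] [ChartedSpace (EuclideanHalfSpace (m + 1)) M]
  [IsManifold (𝓡∂ (m + 1)) ∞ M]

lemma gradDot_eq_zero (g : Metric m M) {χ : M → ℝ} (k : M → ℝ) {p : M} (hp : p ∉ tsupport χ) :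
    gradDot g χ k p = 0 := by
  have h1 : Tendsto (crd m p).symm (𝓝[halfSpace m] (crd m p p)) (𝓝 p) := by
    have := continuousAt_extChartAt_symm (I := 𝓡∂ (m + 1)) p
    have h2 := this.tendsto
    rw [extChartAt_to_inv] at h2
    exact h2.mono_left nhdsWithin_le_nhds
  have h2 : χ ∘ (crd m p).symm =ᶠ[𝓝[halfSpace m] (crd m p p)] fun _ => 0 :=
    h1.eventually (notMem_tsupport_iff_eventuallyEq.1 hp)
  rw [gradDot, gradPair, h2.fderivWithin_eq (h2.self_of_nhdsWithin
    (crd_target_subset p (mem_extChartAt_target p)))]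
  simp

variable [MeasurableSpace M] [BorelSpace M] [CompactSpace M]

/-- Green's formula for a field supported in a chart. -/
lemma integral_green_chart (g : Metric m M) {a : M} {χ f u : M → ℝ}
    (hχ : ContMDiff (𝓡∂ (m + 1)) 𝓘(ℝ, ℝ) 1 χ) (hs : tsupport χ ⊆ (crd m a).source)
    (hf₁ : ContMDiff (𝓡∂ (m + 1)) 𝓘(ℝ, ℝ) 1 f)
    (hf₂ : ContMDiffOn (𝓡∂ (m + 1)) 𝓘(ℝ, ℝ) 2 f ((𝓡∂ (m + 1)).interior M))
    (hu : ContMDiff (𝓡∂ (m + 1)) 𝓘(ℝ, ℝ) 2 u) (hu₀ : ∀ p ∈ (𝓡∂ (m + 1)).boundary M, u p = 0)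
    (hint : Integrable (fun p => χ p * (f p * laplacian g u p - u p * laplacian g f p) +
      (f p * gradDot g χ u p - u p * gradDot g χ f p)) (vol g)) :
    ∫ p, (χ p * (f p * laplacian g u p - u p * laplacian g f p) +
      (f p * gradDot g χ u p - u p * gradDot g χ f p)) ∂vol g =
      ∫ p, χ p * (f p * bdryDeriv g u p) ∂area g := by
  set F : M → ℝ := fun p => χ p * (f p * laplacian g u p - u p * laplacian g f p) +
      (f p * gradDot g χ u p - u p * gradDot g χ f p) with hF
  have h12 : (1 : WithTop ℕ∞) ≤ 2 := by norm_num
  have h2i : (2 : WithTop ℕ∞) ≤ ∞ := mod_cast ENat.LEInfty.out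
  set T := (crd m a).target
  set G := gram g a
  have hG : ∀ y ∈ T, IsMetricAt G y := fun y hy => isMetricAt_gram g hy
  have hcd {n : WithTop ℕ∞} (hn : n ≤ ∞) {h : M → ℝ} {y : Coord m} (hy : y ∈ T)
      (hh : ContMDiffAt (𝓡∂ (m + 1)) 𝓘(ℝ, ℝ) n h ((crd m a).symm y)) :
      ContDiffWithinAt ℝ n (h ∘ (crd m a).symm) (halfSpace m) y := by
    have := contDiffWithinAt_comp_symm hn ((crd m a).map_target hy) hh
    rwa [(crd m a).right_inv hy] at this
  have hint₀ {y : Coord m} (hy : y ∈ T) (hy0 : 0 < y 0) :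
      ContMDiffAt (𝓡∂ (m + 1)) 𝓘(ℝ, ℝ) 2 f ((crd m a).symm y) := by
    have h1 : (crd m a).symm y ∈ (𝓡∂ (m + 1)).interior M := by
      rw [← (𝓡∂ (m + 1)).compl_boundary, mem_compl_iff,
        mem_boundary_iff ((crd m a).map_target hy), (crd m a).right_inv hy]
      exact hy0.ne'
    exact hf₂.contMDiffAt (((𝓡∂ (m + 1)).isOpen_interior (M := M) (n := ∞) (by simp)).mem_nhds h1)
  let W := greenField G (χ ∘ (crd m a).symm) (f ∘ (crd m a).symm) (u ∘ (crd m a).symm)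
  -- Extension by zero keeps the regularity of `W`, since the support of the cutoff is compact
  -- inside the chart.
  let V : Fin (m + 1) → Coord m → ℝ := fun i => T.indicator (W i)
  have hVW (i : Fin (m + 1)) {y : Coord m} (hy : y ∈ T) : V i =ᶠ[𝓝[halfSpace m] y] W i := by
    filter_upwards [crd_target_mem_nhdsWithin hy] with z hz using indicator_of_mem hz _
  set K := crd m a '' tsupport χ
  have hKc : IsCompact K :=
    (isClosed_tsupport χ).isCompact.image_of_continuousOn ((continuousOn_extChartAt a).mono hs)
  have hV0 (i : Fin (m + 1)) (y : Coord m) (hy : y ∉ K) : V i y = 0 := by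
    by_cases hyT : y ∈ T
    · have h1 : χ ((crd m a).symm y) = 0 := by
        by_contra h2
        exact hy ⟨_, subset_tsupport _ h2, (crd m a).right_inv hyT⟩
      change T.indicator (W i) y = 0
      rw [indicator_of_mem hyT]
      simp only [W, greenField, Function.comp_apply, h1, zero_mul, mul_zero]
    · exact indicator_of_notMem hyT _
  have hKT : K ⊆ T := by
    rintro _ ⟨p, hp, rfl⟩
    exact (crd m a).map_source (hs hp)
  have hV0' (i : Fin (m + 1)) {y : Coord m} (hy : y ∉ T) :
      V i =ᶠ[𝓝[halfSpace m] y] fun _ => 0 := by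
    filter_upwards [mem_nhdsWithin_of_mem_nhds (hKc.isClosed.isOpen_compl.mem_nhds
      fun h => hy (hKT h))] with z hz using hV0 i z hz
  obtain ⟨R, hR, hKR⟩ : ∃ R : ℝ, 0 < R ∧ ∀ y ∈ K, ‖y‖ < R := by
    obtain ⟨R, hR, h⟩ := hKc.isBounded.exists_pos_norm_lt
    exact ⟨R, hR, h⟩
  -- Equality holds only off `{y₀ = 0}`, where `f` is twice differentiable; this is enough for the
  -- integrals.
  have hsum : ∀ᵐ y ∂(volume : Measure (Coord m)).restrict (halfSpace m),
      T.indicator (fun y => √(G y).det * F ((crd m a).symm y)) y = ∑ i, pd i (V i) y := by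
    filter_upwards [ae_halfSpace_pos m, ae_restrict_mem isClosed_halfSpace.measurableSet]
      with y hy0 hy
    by_cases hyT : y ∈ T
    · have h1 := (crd m a).map_target hyT
      rw [indicator_of_mem hyT, Finset.sum_congr rfl fun i _ => pd_congr (hVW i hyT) hy i]
      rw [(hG y hyT).sum_pd_greenField
        ((hcd one_le_infty hyT (hχ _)).differentiableWithinAt (by norm_num))
        (hcd h2i hyT (hint₀ hyT hy0)) (hcd h2i hyT (hu _)), hF]
      simp only
      rw [laplacian_eq g h1 (hu _), laplacian_eq g h1 (hint₀ hyT hy0),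
        gradDot_eq g h1 (hχ _) ((hu _).of_le h12), gradDot_eq g h1 (hχ _) (hf₁ _),
        (crd m a).right_inv hyT]
      rfl
    · rw [indicator_of_notMem hyT]
      refine (Finset.sum_eq_zero fun i _ => ?_).symm
      rw [pd_congr (hV0' i hyT) hy]
      simp [pd]
  have hI1 : IntegrableOn (fun y => √(G y).det * F ((crd m a).symm y)) T :=
    (volFamily g).integrableOn_chart a hint
  have hI2 : IntegrableOn (fun y => ∑ i, pd i (V i) y) (halfSpace m) :=
    (hI1.integrable_indicator (measurableSet_crd_target a)).integrableOn.congr hsum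
  have hdiv := integral_divergence_halfSpace V hR
    (fun i y hy => by
      by_cases hyT : y ∈ T
      · exact ((hG y hyT).continuousWithinAt_greenField
          (hcd one_le_infty hyT (hχ _)).continuousWithinAt (hcd one_le_infty hyT (hf₁ _))
          (hcd one_le_infty hyT ((hu _).of_le h12)) i).congr_of_eventuallyEq (hVW i hyT)
          ((hVW i hyT).self_of_nhdsWithin hy)
      · exact continuousWithinAt_const.congr_of_eventuallyEq (hV0' i hyT)
          ((hV0' i hyT).self_of_nhdsWithin hy))
    (fun i y hy0 => by
      have hy : y ∈ halfSpace m := mem_halfSpace.2 hy0.le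
      by_cases hyT : y ∈ T
      · exact ((hG y hyT).differentiableWithinAt_greenField
          ((hcd one_le_infty hyT (hχ _)).differentiableWithinAt (by norm_num))
          (hcd h2i hyT (hint₀ hyT hy0)) (hcd h2i hyT (hu _)) i).congr_of_eventuallyEq (hVW i hyT)
          ((hVW i hyT).self_of_nhdsWithin hy)
      · exact (differentiableWithinAt_const 0).congr_of_eventuallyEq (hV0' i hyT)
          ((hV0' i hyT).self_of_nhdsWithin hy))
    (fun i y _ hne j => by
      have hyK : y ∈ K := by
        by_contra h
        exact hne (hV0 i y h)
      exact (PiLp.norm_apply_le y j).trans_lt (hKR y hyK)) hI2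
  -- The gradient terms also vanish off the support of `χ`, so the global integral is an integral in
  -- this chart.
  have hF0 : ∀ p, p ∉ (crd m a).source → F p = 0 := by
    intro p hp
    have hp' : p ∉ tsupport χ := fun h => hp (hs h)
    rw [hF]
    simp only
    rw [gradDot_eq_zero g u hp', gradDot_eq_zero g f hp', image_eq_zero_of_notMem_tsupport hp']
    ring
  have hleft : ∫ p, F p ∂vol g = ∫ y in halfSpace m, ∑ i, pd i (V i) y := by
    rw [← integral_congr_ae hsum, setIntegral_indicator (measurableSet_crd_target a),
      inter_eq_self_of_subset_right (crd_target_subset a)]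
    refine (volFamily g).integral_chart a hint.aestronglyMeasurable fun p hp => hF0 p ?_
    rwa [← (crd m a).symm_image_target_eq_source]
  have hright : ∫ p, χ p * (f p * bdryDeriv g u p) ∂area g =
      -∫ z : Fin m → ℝ, V 0 (bdryIncl z) := by
    have hmeas : AEStronglyMeasurable (fun p => χ p * (f p * bdryDeriv g u p)) (area g) :=
      (hχ.continuous.measurable.mul (hf₁.continuous.measurable.mul
        (measurable_bdryDeriv g (hu.of_le h12)))).aestronglyMeasurable
    refine ((areaFamily g).integral_chart a hmeas fun p hp => ?_).trans ?_
    · have hp' : p ∉ (crd m a).source ∩ (𝓡∂ (m + 1)).boundary M := by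
        rwa [← image_boundary a]
      by_cases hps : p ∈ (crd m a).source
      · rw [bdryDeriv_of_notMem g u fun h => hp' ⟨hps, h⟩, mul_zero, mul_zero]
      · rw [image_eq_zero_of_notMem_tsupport fun h => hps (hs h), zero_mul]
    · rw [← integral_neg, ← integral_indicator ((areaFamily g).measurableSet_Q a)]
      refine integral_congr_ae (Eventually.of_forall fun z => ?_)
      by_cases hz : bdryIncl z ∈ T
      · have h1 := (crd m a).map_target hz
        have h2 : (crd m a).symm (bdryIncl z) ∈ (𝓡∂ (m + 1)).boundary M := by
          rw [mem_boundary_iff h1, (crd m a).right_inv hz]; rfl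
        have h3 : V 0 (bdryIncl z) = W 0 (bdryIncl z) := indicator_of_mem hz _
        have h4 := (hG _ hz).greenField_zero (χ := χ ∘ (crd m a).symm)
          (f := f ∘ (crd m a).symm) (u := u ∘ (crd m a).symm) (hu₀ _ h2)
        have h5 : W 0 (bdryIncl z) = _ := h4
        refine (indicator_of_mem (show z ∈ {z | bdryIncl z ∈ T} from hz) _).trans ?_
        simp only [h3, h5, neg_neg]
        have h6 := bdryDeriv_eq g h1 h2 ((hu _).of_le h12)
        rw [(crd m a).right_inv hz] at h6
        change _ * (_ * (_ * bdryDeriv g u ((crd m a).symm (bdryIncl z)))) = _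
        rw [h6]
        rfl
      · have h3 : V 0 (bdryIncl z) = 0 := indicator_of_notMem hz _
        refine (indicator_of_notMem (show z ∉ {z | bdryIncl z ∈ T} from hz) _).trans ?_
        simp only [h3, neg_zero]
  rw [hleft, hdiv, hright]

variable [T2Space M]

/-- Green's formula. -/
theorem integral_green (g : Metric m M) {f u : M → ℝ}
    (hf₁ : ContMDiff (𝓡∂ (m + 1)) 𝓘(ℝ, ℝ) 1 f)
    (hf₂ : ContMDiffOn (𝓡∂ (m + 1)) 𝓘(ℝ, ℝ) 2 f ((𝓡∂ (m + 1)).interior M))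
    (hu : ContMDiff (𝓡∂ (m + 1)) 𝓘(ℝ, ℝ) 2 u) (hu₀ : ∀ p ∈ (𝓡∂ (m + 1)).boundary M, u p = 0)
    (hint : Integrable (fun p => f p * laplacian g u p - u p * laplacian g f p) (vol g)) :
    ∫ p, (f p * laplacian g u p - u p * laplacian g f p) ∂vol g =
      ∫ p, f p * bdryDeriv g u p ∂area g := by
  have h12 : (1 : WithTop ℕ∞) ≤ 2 := by norm_num
  obtain ⟨t, ht⟩ := isCompact_univ.elim_finite_subcover (fun a : M => (crd m a).source)
    (fun a => isOpen_extChartAt_source a) fun p _ => mem_iUnion.2 ⟨p, mem_extChartAt_source p⟩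
  obtain ⟨ρ, hρ⟩ := SmoothPartitionOfUnity.exists_isSubordinate (𝓡∂ (m + 1)) isClosed_univ
    (fun a : t => (crd m (a : M)).source) (fun a => isOpen_extChartAt_source (a : M))
    (fun p hp => by
      obtain ⟨a, ha, hpa⟩ := mem_iUnion₂.1 (ht hp)
      exact mem_iUnion.2 ⟨⟨a, ha⟩, hpa⟩)
  have hρ1 (p : M) : ∑ a, ρ a p = 1 := by
    rw [← finsum_eq_sum_of_fintype]; exact ρ.sum_eq_one (mem_univ p)
  have hρc (a : t) : ContMDiff (𝓡∂ (m + 1)) 𝓘(ℝ, ℝ) 1 (ρ a) :=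
    (ρ a).contMDiff.of_le one_le_infty
  -- The gradients of a partition of unity sum to zero, which removes the cutoff terms.
  have hρ0 (k : M → ℝ) (p : M) : ∑ a, gradDot g (ρ a) k p = 0 := by
    have h1 (a : t) := (contDiffWithinAt_comp_symm one_le_infty (mem_extChartAt_source p)
      (hρc a p)).differentiableWithinAt (by norm_num)
    have h2 : HasFDerivWithinAt (fun y => ∑ a, (ρ a ∘ (crd m p).symm) y)
        (∑ a, fderivWithin ℝ (ρ a ∘ (crd m p).symm) (halfSpace m) (crd m p p)) (halfSpace m)
        (crd m p p) := HasFDerivWithinAt.fun_sum fun a _ => (h1 a).hasFDerivWithinAt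
    have h3 : (fun y => ∑ a, (ρ a ∘ (crd m p).symm) y) = fun _ => (1 : ℝ) :=
      funext fun y => hρ1 _
    rw [h3] at h2
    have h4 := (h2.fderivWithin (uniqueDiffOn_halfSpace _
      (crd_target_subset p (mem_extChartAt_target p)))).symm.trans
      (fderivWithin_const_apply (𝕜 := ℝ) (s := halfSpace m) (x := crd m p p) (1 : ℝ))
    simp only [gradDot, gradPair]
    rw [← sum_apply, h4]
    rfl
  -- The cutoff is bounded, so it preserves integrability of the given combination; the gradient
  -- terms are continuous, as they involve only first derivatives of `f`.
  have hi (a : t) : Integrable (fun p => ρ a p * (f p * laplacian g u p - u p * laplacian g f p) +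
      (f p * gradDot g (ρ a) u p - u p * gradDot g (ρ a) f p)) (vol g) := by
    refine Integrable.add (hint.bdd_mul (c := 1) (ρ a).contMDiff.continuous.aestronglyMeasurable
      (Eventually.of_forall fun p => ?_)) (integrable_vol g ?_)
    · rw [Real.norm_of_nonneg (ρ.nonneg a p)]; exact ρ.le_one a p
    · exact (hf₁.continuous.mul (continuous_gradDot g (hρc a) (hu.of_le h12))).sub
        (hu.continuous.mul (continuous_gradDot g (hρc a) hf₁))
  have hj (a : t) : Integrable (fun p => ρ a p * (f p * bdryDeriv g u p)) (area g) := by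
    refine (integrable_bdryDeriv g hf₁.continuous (hu.of_le h12)).bdd_mul (c := 1)
      (ρ a).contMDiff.continuous.aestronglyMeasurable (Eventually.of_forall fun p => ?_)
    rw [Real.norm_of_nonneg (ρ.nonneg a p)]; exact ρ.le_one a p
  have hkey := Finset.sum_congr (rfl : (Finset.univ : Finset t) = Finset.univ) fun a _ =>
    integral_green_chart g (hρc a) (hρ a) hf₁ hf₂ hu hu₀ (hi a)
  rw [← integral_finsetSum _ fun a _ => hi a, ← integral_finsetSum _ fun a _ => hj a] at hkey
  simpa only [Finset.sum_add_distrib, Finset.sum_sub_distrib, ← Finset.mul_sum, ← Finset.sum_mul,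
    hρ1, hρ0, one_mul, mul_zero, sub_zero, add_zero] using hkey

end Manifold

/-! ### Functions with vanishing gradient -/

section Manifold

variable {m : ℕ} {M : Type*} [TopologicalSpace M] [ChartedSpace (EuclideanHalfSpace (m + 1)) M]
  [IsManifold (𝓡∂ (m + 1)) ∞ M]

lemma gradDot_self_nonneg (g : Metric m M) (w : M → ℝ) (p : M) : 0 ≤ gradDot g w w p := by
  have hy := mem_extChartAt_target (I := 𝓡∂ (m + 1)) p
  rw [gradDot, gradPair, ← (isMetricAt_gram g hy).bil_gradVec, bil_gram g hy]
  set v := frame p ((crd m p).symm (crd m p p)) (gradVec (gram g p) (w ∘ (crd m p).symm) (crd m p p))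
  by_cases hv : v = 0
  · rw [hv, map_zero]
  · exact (g.pos _ _ hv).le

lemma fderivWithin_eq_zero_of_gradPair (g : Metric m M) {h : Coord m → ℝ} {a : M} {y : Coord m}
    (hy : y ∈ (crd m a).target) (h0 : gradPair (gram g a) h h y = 0) :
    fderivWithin ℝ h (halfSpace m) y = 0 := by
  have hG := isMetricAt_gram g hy
  rw [gradPair, ← hG.bil_gradVec, bil_gram g hy] at h0
  have h1 : gradVec (gram g a) h y = 0 := by
    by_contra hne
    refine (g.pos _ _ fun hv => hne ?_).ne' h0
    exact frame_injective ((crd m a).map_target hy) (hv.trans (map_zero _).symm)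
  ext v
  rw [← hG.bil_gradVec, h1, map_zero]

/-- A function with vanishing gradient is constant on connected components. -/
lemma eq_of_gradDot_eq_zero (g : Metric m M) {w : M → ℝ}
    (hw : ContMDiff (𝓡∂ (m + 1)) 𝓘(ℝ, ℝ) 1 w) (h0 : ∀ p, gradDot g w w p = 0) {p q : M}
    (hq : q ∈ connectedComponent p) : w q = w p := by
  have hloc : IsLocallyConstant w := by
    refine (IsLocallyConstant.iff_eventually_eq w).2 fun x => ?_
    have hx := mem_extChartAt_source (I := 𝓡∂ (m + 1)) x
    obtain ⟨ε, hε, h⟩ := Metric.mem_nhdsWithin_iff.1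
      (crd_target_mem_nhdsWithin (mem_extChartAt_target (I := 𝓡∂ (m + 1)) x))
    have h1 : ∀ y ∈ Metric.ball (crd m x x) ε ∩ halfSpace m,
        HasFDerivWithinAt (w ∘ (crd m x).symm) (0 : Coord m →L[ℝ] ℝ)
          (Metric.ball (crd m x x) ε ∩ halfSpace m) y := by
      intro y hy
      have hs := (crd m x).map_target (h hy)
      have h2 := (contDiffWithinAt_comp_symm one_le_infty hs (hw _)).differentiableWithinAt
        (by norm_num)
      have h3 := gradDot_eq g hs (hw _) (hw _)
      rw [(crd m x).right_inv (h hy)] at h2 h3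
      have h4 := h2.hasFDerivWithinAt
      rw [fderivWithin_eq_zero_of_gradPair g (h hy) (h3.symm.trans (h0 _))] at h4
      exact h4.mono inter_subset_right
    -- A ball intersected with the half space is convex, so the mean value inequality also applies
    -- at boundary points.
    have hc : Convex ℝ (Metric.ball (crd m x x) ε ∩ halfSpace m) :=
      (convex_ball _ _).inter convex_halfSpace
    filter_upwards [(isOpen_extChartAt_source (I := 𝓡∂ (m + 1)) x).mem_nhds hx,
      (continuousAt_extChartAt (I := 𝓡∂ (m + 1)) x).preimage_mem_nhds (Metric.ball_mem_nhds _ hε)]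
      with z hz hz'
    have h5 := hc.norm_image_sub_le_of_norm_hasFDerivWithin_le (C := 0) h1 (fun _ _ => by simp)
      ⟨Metric.mem_ball_self hε, crd_target_subset x (mem_extChartAt_target x)⟩
      ⟨hz', crd_target_subset x ((crd m x).map_source hz)⟩
    rw [zero_mul, norm_le_zero_iff, sub_eq_zero, Function.comp_apply, Function.comp_apply,
      (crd m x).left_inv hz, (crd m x).left_inv hx] at h5
    exact h5
  exact hloc.apply_eq_of_isPreconnected isPreconnected_connectedComponent hq mem_connectedComponent

/-- The Riemannian volume charges every nonempty open set. -/
lemma eq_zero_of_ae_eq_zero [MeasurableSpace M] [BorelSpace M] (g : Metric m M) {F : M → ℝ}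
    (hF : Continuous F) (h0 : ∀ᵐ p ∂vol g, F p = 0) (p : M) : F p = 0 := by
  by_contra hp
  have hy := mem_extChartAt_target (I := 𝓡∂ (m + 1)) p
  have h1 := (volFamily g).ae_chart p
    (fun y hy => Real.sqrt_pos.2 (isMetricAt_gram g hy).det_pos) h0
  have h2 : ∀ᶠ y in 𝓝[halfSpace m] (crd m p p),
      y ∈ (crd m p).target ∧ F ((crd m p).symm y) ≠ 0 := by
    have h3 : ContinuousWithinAt (F ∘ (crd m p).symm) (halfSpace m) (crd m p p) :=
      (hF.continuousAt.comp (continuousAt_extChartAt_symm p)).continuousWithinAt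
    refine Eventually.and (crd_target_mem_nhdsWithin hy) (h3.eventually_ne ?_)
    rwa [Function.comp_apply, extChartAt_to_inv]
  obtain ⟨O, hO, hpO, hOs⟩ := mem_nhdsWithin.1 h2
  -- A neighborhood in the half space of a boundary point has positive volume because it meets the
  -- open half space.
  have h4 : crd m p p ∈ closure (interior (halfSpace m)) :=
    (𝓡∂ (m + 1)).range_subset_closure_interior (crd_target_subset p hy)
  have h5 := mem_closure_iff.1 h4 O hO hpO
  have h6 : 0 < (volume : Measure (Coord m)) (O ∩ interior (halfSpace m)) :=
    (hO.inter isOpen_interior).measure_pos _ h5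
  refine h6.ne' (measure_mono_null ?_ h1)
  rintro y ⟨hyO, hyi⟩ h7
  have h8 := hOs ⟨hyO, interior_subset hyi⟩
  exact h8.2 (h7 h8.1)

/-! ### Rigidity -/

/-- The mean curvature of a conformal metric in terms of `u = 1 - exp (-2 w)`. -/
lemma two_mul_meanCurvature_conformal {g₀ g : Metric m M} {w : M → ℝ}
    (hw : ContMDiff (𝓡∂ (m + 1)) 𝓘(ℝ, ℝ) 2 w)
    (hg : ∀ (x : M) (v v' : TangentSpace (𝓡∂ (m + 1)) x),
      g.inner x v v' = Real.exp (2 * w x) * g₀.inner x v v') {p : M}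
    (hp : p ∈ (𝓡∂ (m + 1)).boundary M) (hp0 : w p = 0) :
    2 * (meanCurvature g p - meanCurvature g₀ p) =
      m * bdryDeriv g₀ (fun x => 1 - Real.exp (-(2 * w x))) p := by
  have hy := mem_extChartAt_target (I := 𝓡∂ (m + 1)) p
  have h1 (i : Fin (m + 1)) :
      pd i ((fun x => 1 - Real.exp (-(2 * w x))) ∘ (crd m p).symm) (crd m p p) =
        2 * pd i (w ∘ (crd m p).symm) (crd m p p) := by
    have h2 := ((contDiffWithinAt_comp_symm (mod_cast ENat.LEInfty.out)
      (mem_extChartAt_source p) (hw p)).differentiableWithinAt (by norm_num)).hasFDerivWithinAt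
    -- Since `w p = 0`, the derivative of `1 - exp (-2 t)` is taken at `0` and equals `2`, which
    -- absorbs the factor `2` before the mean curvature.
    have h3 : HasDerivAt (fun t : ℝ => 1 - Real.exp (-(2 * t))) 2
        ((w ∘ (crd m p).symm) (crd m p p)) := by
      rw [Function.comp_apply, extChartAt_to_inv, hp0]
      have h4 := ((((hasDerivAt_id (0 : ℝ)).const_mul 2).neg).exp).const_sub 1
      simpa using h4
    have h5 := (h3.comp_hasFDerivWithinAt _ h2).fderivWithin
      (uniqueDiffOn_halfSpace _ (crd_target_subset p hy))
    exact congrArg (fun L : Coord m →L[ℝ] ℝ => L (bvec i)) h5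
  rw [meanCurvature_conformal hw hg p hp0, bdryDeriv_self g₀ _ hp, normalDeriv]
  simp only [h1]
  rw [mul_left_comm, Finset.mul_sum]
  congr 1
  exact Finset.sum_congr rfl fun i _ => by ring

variable [MeasurableSpace M] [BorelSpace M] [CompactSpace M] [T2Space M]

/-- Under the curvature hypotheses of the rigidity theorem, the conformal factor has vanishing
gradient. -/
lemma gradDot_eq_zero_of_conformal (hm : 1 ≤ m) {g₀ g : Metric m M} {w f : M → ℝ}
    (hw : ContMDiff (𝓡∂ (m + 1)) 𝓘(ℝ, ℝ) 2 w)
    (hg : ∀ (x : M) (v v' : TangentSpace (𝓡∂ (m + 1)) x),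
      g.inner x v v' = Real.exp (2 * w x) * g₀.inner x v v')
    (hw₀ : ∀ p ∈ (𝓡∂ (m + 1)).boundary M, w p = 0)
    (hf₁ : ContMDiff (𝓡∂ (m + 1)) 𝓘(ℝ, ℝ) 1 f)
    (hf₂ : ContMDiffOn (𝓡∂ (m + 1)) 𝓘(ℝ, ℝ) 2 f ((𝓡∂ (m + 1)).interior M))
    (hf_pos : ∀ᵐ x ∂vol g₀, 0 < f x)
    (hcurv : 0 ≤ (∫ x, f x * (scalarCurvature g x - scalarCurvature g₀ x) ∂vol g₀) +
      2 * ∫ x, f x * (meanCurvature g x - meanCurvature g₀ x) ∂area g₀)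
    (hint : Integrable (fun x => linOp g₀ f x * (1 - Real.exp (-(2 * w x)))) (vol g₀))
    (hlin : 0 ≤ ∫ x, linOp g₀ f x * (1 - Real.exp (-(2 * w x))) ∂vol g₀) (p : M) :
    gradDot g₀ w w p = 0 := by
  have h12 : (1 : WithTop ℕ∞) ≤ 2 := by norm_num
  have hm0 : (m : ℝ) ≠ 0 := by positivity
  set u : M → ℝ := fun x => 1 - Real.exp (-(2 * w x)) with hu_def
  have hu : ContMDiff (𝓡∂ (m + 1)) 𝓘(ℝ, ℝ) 2 u := by
    have h1 : ContDiff ℝ 2 fun t : ℝ => 1 - Real.exp (-(2 * t)) := by fun_prop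
    exact h1.contMDiff.comp hw
  have hu₀ : ∀ p ∈ (𝓡∂ (m + 1)).boundary M, u p = 0 := fun p hp => by simp [hu_def, hw₀ p hp]
  set D : M → ℝ := fun x => f x * laplacian g₀ u x - u x * laplacian g₀ f x with hD
  -- `u Δf` alone is not known to be integrable. Subtracting the integrable `u 𝓛f` from the
  -- continuous function `f Δu + (R / m) f u` leaves exactly `D`.
  have hDi : Integrable D (vol g₀) := by
    have h1 : Integrable (fun x => f x * laplacian g₀ u x + scalarCurvature g₀ x / m * f x * u x)
        (vol g₀) := integrable_vol g₀ ((hf₁.continuous.mul (continuous_laplacian g₀ hu)).add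
      ((((continuous_scalarCurvature g₀).div_const _).mul hf₁.continuous).mul hu.continuous))
    refine (h1.sub hint).congr (Eventually.of_forall fun x => ?_)
    simp only [Pi.sub_apply, hD, linOp]
    ring
  set Q : M → ℝ := fun x => f x * (Real.exp (-(2 * w x)) * gradDot g₀ w w x) with hQ
  have hQi : Integrable Q (vol g₀) := integrable_vol g₀ (hf₁.continuous.mul
    ((Real.continuous_exp.comp (hw.continuous.const_mul 2).neg).mul
      (continuous_gradDot g₀ (hw.of_le h12) (hw.of_le h12))))
  have hgreen := integral_green g₀ hf₁ hf₂ hu hu₀ hDi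
  -- Pointwise `-u R f = -m u 𝓛f + m u Δf`; the term `m u Δf` combines with `-m f Δu` to `-m D`.
  have hR : ∫ x, f x * (scalarCurvature g x - scalarCurvature g₀ x) ∂vol g₀ =
      -(m * ∫ x, linOp g₀ f x * u x ∂vol g₀) - m * (∫ x, D x ∂vol g₀) -
        m * (m + 3) * ∫ x, Q x ∂vol g₀ := by
    have h1 : Integrable (fun x => -(m * (linOp g₀ f x * u x))) (vol g₀) := (hint.const_mul _).neg
    have h2 : Integrable (fun x => m * D x) (vol g₀) := hDi.const_mul _
    have h3 : Integrable (fun x => -(m * (linOp g₀ f x * u x)) - m * D x) (vol g₀) := h1.sub h2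
    rw [← integral_const_mul, ← integral_const_mul, ← integral_const_mul, ← integral_neg,
      ← integral_sub h1 h2, ← integral_sub h3 (hQi.const_mul _)]
    refine integral_congr_ae (Eventually.of_forall fun x => ?_)
    simp only [scalarCurvature_conformal hw hg, hD, hQ, linOp, ← hu_def]
    rw [show 1 - Real.exp (-(2 * w x)) = u x from rfl]
    field_simp
    ring
  have hH : 2 * ∫ x, f x * (meanCurvature g x - meanCurvature g₀ x) ∂area g₀ =
      m * ∫ x, f x * bdryDeriv g₀ u x ∂area g₀ := by
    rw [← integral_const_mul, ← integral_const_mul]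
    refine integral_congr_ae ?_
    have h1 : ∀ᵐ p ∂area g₀, p ∈ (𝓡∂ (m + 1)).boundary M := area_compl_boundary g₀
    filter_upwards [h1] with x hx
    rw [mul_left_comm, two_mul_meanCurvature_conformal hw hg hx (hw₀ x hx)]
    ring
  -- After Green's formula the boundary integral and the integral of `D` cancel, leaving two terms
  -- that are both at most zero.
  rw [hR, hH, ← hgreen] at hcurv
  have hQ0 : 0 ≤ᵐ[vol g₀] Q := by
    filter_upwards [hf_pos] with x hx
    exact mul_nonneg hx.le (mul_nonneg (Real.exp_pos _).le (gradDot_self_nonneg g₀ w x))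
  have hQint : ∫ x, Q x ∂vol g₀ = 0 := by
    refine le_antisymm ?_ (integral_nonneg_of_ae hQ0)
    have h1 : (0 : ℝ) < m * (m + 3) := by positivity
    have h2 := mul_nonneg (Nat.cast_nonneg m : (0 : ℝ) ≤ m) hlin
    by_contra h3
    have h4 := mul_pos h1 (not_le.1 h3)
    linarith
  -- `f` and the exponential are positive almost everywhere, so the gradient vanishes almost
  -- everywhere; it is continuous and the volume charges open sets.
  refine eq_zero_of_ae_eq_zero g₀ (continuous_gradDot g₀ (hw.of_le h12) (hw.of_le h12)) ?_ p
  filter_upwards [(integral_eq_zero_iff_of_nonneg_ae hQ0 hQi).1 hQint, hf_pos] with x hx hfx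
  rcases mul_eq_zero.1 hx with h | h
  · exact absurd h hfx.ne'
  · exact (mul_eq_zero.1 h).resolve_left (Real.exp_pos _).ne'

end Manifold

end ConformalRigidity

end

/-! ### The rigidity theorem. -/

theorem mainTheorem1
    (m : ℕ) (hm : 1 ≤ m)
    (M : Type*) [TopologicalSpace M] [T2Space M] [CompactSpace M]
    [ChartedSpace (EuclideanHalfSpace (m + 1)) M] [IsManifold (𝓡∂ (m + 1)) ∞ M]
    [MeasurableSpace M] [BorelSpace M]
    (hM : ∀ x : M, (connectedComponent x ∩ (𝓡∂ (m + 1)).boundary M).Nonempty)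
    (g₀ g : ConformalRigidity.Metric m M)
    (μ : M → ℝ) (hμ : ContMDiff (𝓡∂ (m + 1)) 𝓘(ℝ, ℝ) ∞ μ) (hμ_pos : ∀ x, 0 < μ x)
    (hg : ∀ (x : M) (v w : TangentSpace (𝓡∂ (m + 1)) x),
      g.inner x v w = μ x ^ 2 * g₀.inner x v w)
    (hbdry : ∀ x ∈ (𝓡∂ (m + 1)).boundary M, g.inner x = g₀.inner x)
    (f : M → ℝ) (hf₁ : ContMDiff (𝓡∂ (m + 1)) 𝓘(ℝ, ℝ) 1 f)
    (hf₂ : ContMDiffOn (𝓡∂ (m + 1)) 𝓘(ℝ, ℝ) 2 f ((𝓡∂ (m + 1)).interior M))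
    (hf_pos : ∀ᵐ x ∂(ConformalRigidity.vol g₀), 0 < f x)
    (hcurv : 0 ≤ (∫ x, f x * (ConformalRigidity.scalarCurvature g x -
          ConformalRigidity.scalarCurvature g₀ x) ∂(ConformalRigidity.vol g₀)) +
        2 * (∫ x, f x * (ConformalRigidity.meanCurvature g x -
          ConformalRigidity.meanCurvature g₀ x) ∂(ConformalRigidity.area g₀)))
    (hint : Integrable (fun x => ConformalRigidity.linOp g₀ f x * (1 - (μ x ^ 2)⁻¹))
      (ConformalRigidity.vol g₀))
    (hlin : 0 ≤ ∫ x, ConformalRigidity.linOp g₀ f x * (1 - (μ x ^ 2)⁻¹)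
      ∂(ConformalRigidity.vol g₀)) :
    g = g₀ := by
  have hw : ContMDiff (𝓡∂ (m + 1)) 𝓘(ℝ, ℝ) ∞ fun x => Real.log (μ x) := fun x =>
    (Real.contDiffAt_log.2 (hμ_pos x).ne').contMDiffAt.comp x (hμ x)
  have hexp : ∀ x, Real.exp (2 * Real.log (μ x)) = μ x ^ 2 := fun x => by
    rw [two_mul, Real.exp_add, Real.exp_log (hμ_pos x), sq]
  have hinv : ∀ x, Real.exp (-(2 * Real.log (μ x))) = (μ x ^ 2)⁻¹ := fun x => by
    rw [Real.exp_neg, hexp]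
  -- Equality of the metrics on a single nonzero tangent vector already forces `μ ^ 2 = 1`.
  have hone : ∀ x ∈ (𝓡∂ (m + 1)).boundary M, Real.log (μ x) = 0 := by
    intro x hx
    have hv : (EuclideanSpace.single 0 1 : ConformalRigidity.Coord m) ≠ 0 := by simp
    have h1 := hg x (EuclideanSpace.single 0 1 : ConformalRigidity.Coord m)
      (EuclideanSpace.single 0 1 : ConformalRigidity.Coord m)
    rw [hbdry x hx] at h1
    have h2 := mul_right_cancel₀ (g₀.pos x _ hv).ne' ((one_mul _).trans h1)
    have h3 : 2 * Real.log (μ x) = 0 := by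
      rw [← Real.log_exp (2 * Real.log (μ x)), hexp, ← h2, Real.log_one]
    linarith
  have hgrad := ConformalRigidity.gradDot_eq_zero_of_conformal hm
    (hw.of_le (mod_cast ENat.LEInfty.out)) (g₀ := g₀) (g := g)
    (fun x v v' => by rw [hexp]; exact hg x v v') hone hf₁ hf₂ hf_pos hcurv
    (by simpa only [hinv] using hint) (by simpa only [hinv] using hlin)
  -- `log μ` is constant on the component of `x`, which contains a boundary point `q` where it
  -- vanishes.
  have hμ1 : ∀ x, μ x ^ 2 = 1 := by
    intro x
    obtain ⟨q, hqx, hq⟩ := hM x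
    rw [← hexp, ← ConformalRigidity.eq_of_gradDot_eq_zero g₀
      (hw.of_le ConformalRigidity.one_le_infty) hgrad hqx, hone q hq, mul_zero, Real.exp_zero]
  have hinner : g.inner = g₀.inner := by
    funext x
    refine ContinuousLinearMap.ext fun v => ContinuousLinearMap.ext fun v' => ?_
    rw [hg, hμ1, one_mul]
  cases g
  cases g₀
  congr
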